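/- The induced odd cycle packing number $\mathrm{iocp}(G)$ of a finite simple graph $G$ is the maximum integer $k$ such that $G$ has an induced subgraph that is the disjoint union of $k$ odd cycles (triangles included; distinct cycles share no vertex and are joined by no edge). Let $\alpha(G)$ denote the independence number of $G$. Algorithms run on a word RAM with unit-cost operations on words, including drawing a uniformly random element of $\{0,\dots,m-1\}$ for a word $m$; graphs are given by adjacency matrices, and the word length may be any number $w\ge c\log_2(n+1)+O_{k,t}(1)$ (in the second part $O_{k,b,a}(1)$), where $c$ is a constant depending only on the algorithm. 1. There exists a randomized algorithm that, for input integers $k\ge 0$ and $t\ge 1$ and an $n$-vertex graph $G$ with $\mathrm{iocp}(G)\le k$, always stops in time $O_{k,t}(n^{k+4})$ (in time $O_{k,t}(1)$ if $n=0$) and returns an independent set of $G$, and with probability at least $1/2$ the returned set has size at least $\alpha(G)-n/t$. 2. Consequently, the independence number has a randomized EPTAS on graphs of bounded induced odd cycle packing number and linear independence number, without any assumption on the VC dimension: there exists a randomized algorithm that, for input integers $k\ge 0$ and $a,b\ge 1$ and an $n$-vertex graph $G$ with $\mathrm{iocp}(G)\le k$ and $\alpha(G)\ge n/b$, always stops in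 time $O_{k,b,a}(n^{k+4})$ (in time $O_{k,b,a}(1)$ if $n=0$) and returns an independent set of $G$, and with probability at least $1/2$ the returned set has size at least $(1-1/a)\,\alpha(G)$. -/

import Mathlib

open scoped ENNReal

/-! ### Induced odd cycle packings -/

/-- `G` contains an induced subgraph consisting of `k` pairwise vertex-disjoint odd cycles: there
are `k` induced cycles of odd lengths (at least `3`) in `G` such that no two of them share a vertex
or are joined by an edge. -/
def SimpleGraph.HasInducedOddCyclePacking {V : Type*} (G : SimpleGraph V) (k : ℕ) : Prop :=
  ∃ (len : Fin k → ℕ) (f : ∀ i, SimpleGraph.cycleGraph (len i) ↪g G),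
    (∀ i, 3 ≤ len i ∧ Odd (len i)) ∧
    ∀ i j, i ≠ j → ∀ (a : Fin (len i)) (b : Fin (len j)), f i a ≠ f j b ∧ ¬ G.Adj (f i a) (f j b)

/-- The induced odd cycle packing number of a (finite) graph. -/
noncomputable def SimpleGraph.iocp {V : Type*} (G : SimpleGraph V) : ℕ :=
  sSup {k | G.HasInducedOddCyclePacking k}

/-! ### A randomized word RAM

Programs of a random access machine whose variables and memory cells hold `w`-bit words, written in
structured form. Every basic operation on words costs one time unit. -/

namespace WordRAM

/-- The basic binary operations on words. -/
inductive Op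
  | add | sub | mul | div | mod | lt | eq

/-- Basic operations on `w`-bit words: sum and product are taken modulo `2 ^ w`, the difference is
truncated at `0`, the comparisons return `1` for true and `0` for false. -/
def Op.eval (w : ℕ) : Op → ℕ → ℕ → ℕ
  | .add, a, b => (a + b) % 2 ^ w
  | .sub, a, b => a - b
  | .mul, a, b => (a * b) % 2 ^ w
  | .div, a, b => a / b
  | .mod, a, b => a % b
  | .lt, a, b => if a < b then 1 else 0
  | .eq, a, b => if a = b then 1 else 0

/-- Arithmetic expressions; `load e` reads the memory cell whose address is the value of `e`. -/
inductive Expr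
  | const (c : ℕ)
  | var (x : ℕ)
  | load (e : Expr)
  | op (o : Op) (e₁ e₂ : Expr)

/-- Programs. A program mentions only finitely many variables; all other storage is in the memory.
The command `rand x e` draws a uniformly random element of `{0, …, m - 1}`, where `m` is the value
of `e`, and stores it in the variable `x`. -/
inductive Cmd
  | skip
  | assign (x : ℕ) (e : Expr)
  | store (addr e : Expr)
  | rand (x : ℕ) (e : Expr)
  | seq (p q : Cmd)
  | ite (e : Expr) (p q : Cmd)
  | loop (e : Expr) (p : Cmd)

/-- A state of the machine: the values of the variables and the contents of the memory. -/
structure State where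
  var : ℕ → ℕ
  mem : ℕ → ℕ

/-- The value of an expression. -/
def Expr.eval (w : ℕ) (s : State) : Expr → ℕ
  | .const c => c % 2 ^ w
  | .var x => s.var x
  | .load e => s.mem (e.eval w s)
  | .op o e₁ e₂ => o.eval w (e₁.eval w s) (e₂.eval w s)

/-- The time needed to evaluate an expression: the number of its operations, memory accesses,
variables and constants. -/
def Expr.cost : Expr → ℕ
  | .const _ => 1
  | .var _ => 1
  | .load e => e.cost + 1
  | .op _ e₁ e₂ => e₁.cost + e₂.cost + 1

/-- The result of a computation: `some (s, c)` means that it stopped in the state `s` after `c`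
time units, `none` that some loop was cut off. -/
abbrev Outcome := Option (State × ℕ)

/-- The uniform distribution on `{0, …, m - 1}` (the constant `0` for `m = 0`). -/
noncomputable def uniformBelow : ℕ → PMF ℕ
  | 0 => PMF.pure 0
  | m + 1 => (PMF.uniformOfFintype (Fin (m + 1))).map Fin.val

/-- Run `g` on the state reached by the first computation; the first computation and `g` take
together the sum of their times. -/
noncomputable def andThen (p : PMF Outcome) (g : State → PMF Outcome) : PMF Outcome :=
  p.bind fun o => match o with
    | none => PMF.pure none
    | some (s, c) => (g s).map (Option.map fun r => (r.1, c + r.2))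

/-- A computation that takes `c` time units and moves to the state `s`. -/
noncomputable def tick (c : ℕ) (s : State) : PMF Outcome := PMF.pure (some (s, c))

/-- `while e do body`, cut off if the condition is tested more than `fuel` times. -/
noncomputable def iterate (w : ℕ) (e : Expr) (body : State → PMF Outcome) :
    (fuel : ℕ) → State → PMF Outcome
  | 0, _ => PMF.pure none
  | fuel + 1, s =>
    andThen (tick (e.cost + 1) s) fun s =>
      if e.eval w s ≠ 0 then andThen (body s) (iterate w e body fuel) else tick 0 s

/-- The distribution of the final state and of the running time of a program started in a given
state, on a machine with word length `w`. The parameter `fuel` only serves to make the definition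
total: each execution of a loop that tests its condition more than `fuel` times gives `none`, and
`fuel` is irrelevant for the computations that are not cut off. -/
noncomputable def Cmd.exec (w fuel : ℕ) : Cmd → State → PMF Outcome
  | .skip, s => tick 1 s
  | .assign x e, s => tick (e.cost + 1) { s with var := Function.update s.var x (e.eval w s) }
  | .store a e, s =>
    tick (a.cost + e.cost + 1) { s with mem := Function.update s.mem (a.eval w s) (e.eval w s) }
  | .rand x e, s =>
    (uniformBelow (e.eval w s)).bind fun v =>
      tick (e.cost + 1) { s with var := Function.update s.var x v }
  | .seq p q, s => andThen (p.exec w fuel s) (q.exec w fuel)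
  | .ite e p q, s =>
    andThen (tick (e.cost + 1) s) fun s =>
      if e.eval w s ≠ 0 then p.exec w fuel s else q.exec w fuel s
  | .loop e p, s => iterate w e (p.exec w fuel) fuel s

/-! ### Algorithms for graphs on the machine -/

open Classical in
/-- The input: variable `0` holds the number `n` of vertices, variables `1, 2, …` hold the
parameters, the cells `0, …, n ^ 2 - 1` hold the adjacency matrix of `G`; everything else is `0`. -/
noncomputable def input {n : ℕ} (G : SimpleGraph (Fin n)) (params : List ℕ) : State where
  var x := (n :: params).getD x 0
  mem a := if ∃ u v : Fin n, a = u * n + v ∧ G.Adj u v then 1 else 0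

/-- The returned set of vertices, given by its indicator in the cells `n ^ 2, …, n ^ 2 + n - 1`. -/
def output (n : ℕ) (s : State) : Finset (Fin n) :=
  Finset.univ.filter fun v => s.mem (n * n + v) ≠ 0

/-- On a machine with word length `w`, the randomized program `P`, given `G` and `params`, always
stops after at most `T` time units and returns an independent set of `G`, and with probability at
least `1 / 2` this set has at least `m` elements. -/
def FindsIndepSet (P : Cmd) {n : ℕ} (G : SimpleGraph (Fin n)) (params : List ℕ) (w T : ℕ)
    (m : ℝ) : Prop :=
  ∃ fuel : ℕ,
    (∀ o ∈ (P.exec w fuel (input G params)).support, ∃ (s : State) (c : ℕ),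
      o = some (s, c) ∧ c ≤ T ∧ G.IsIndepSet (output n s : Set (Fin n))) ∧
    (1 / 2 : ℝ≥0∞) ≤ (P.exec w fuel (input G params)).toOuterMeasure
      {o | ∃ (s : State) (c : ℕ), o = some (s, c) ∧ m ≤ ((output n s).card : ℝ)}

end WordRAM

/-!
A maximum independent set `I` of a graph without an induced packing of `k + 1` odd cycles is
approximated by deleting few vertices of `I` until the graph is bipartite.

*One level.* In the current induced subgraph `G[X]`, an induced odd cycle `C` is removed together
with all vertices through which other odd cycles could touch `C`. By
`HasInducedOddCyclePacking.succ` this decreases the induced odd cycle packing number of `G[X]`, so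
that `k` levels leave a bipartite graph. A greedy packing of vertex-disjoint shortest odd cycles of
bounded length is computed first. If it is large, then `C` is a random one of its cycles, and `C`
is removed with its neighbourhood. If it is small, all its cycles are removed; a shortest odd cycle
`C` of the rest is long, and it suffices to delete one layer at a bounded distance `i` from `C` and
one layer around a vertex of `C`: the vertices at distance less than `i` from `C` then induce a
bipartite graph (`ShortestOddCycle.separated`). Among the first layers there are small ones
(`cut_spec`).

*Sampling.* In the first case few vertices of `I` must be lost. This is so if no vertex of `C` is
heavy, that is, has a large number of neighbours in `I` (`loss_of_cycle`). A random sample of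
boundedly many vertices of `I` whose neighbourhoods are deleted beforehand (which costs nothing of
`I`) leaves few heavy vertices (`card_many_heavy`), and then most of the disjoint short cycles
avoid them (`card_bad_level`). Since `I` is not known, the algorithm draws random vertices of `G`
and tries all subsets of them as the sample; the subset of those that lie in `I` is good with
probability at least `1 / 2` (`card_good`).

*Bipartite graphs.* A largest independent set of the remaining bipartite graph is found by an
auction that computes a matching and prices; the vertices on one side below some price, together
with the vertices on the other side without such neighbours, form a maximum independent set
(`exists_threshold`).

*The machine.* The algorithm is written in a language of array programs with a total semantics,
which is compiled to the word RAM once and for all (`AProg.comp_ends`). The random vertices are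
drawn at the beginning and stored in the memory, so that everything else is deterministic; the
distribution of the result is the image of the uniform distribution on tuples of vertices
(`drawLoop_randEnds`, `findsIndepSet_of_randEnds`). The cost of the compiled program is a
polynomial in `n` whose degree is read off from the program (`AProg.cost_le`).
-/

namespace WordRAM

/-! ### Deterministic computations of the machine -/

/-- On word length `w` the program `p`, started in `s`, stops with certainty in `s'` after exactly
`k` time units. Every test of a loop costs time, so that `k` also bounds the fuel that is needed.
-/
def Runs (w : ℕ) (p : Cmd) (s s' : State) (k : ℕ) : Prop :=
  ∀ fuel, k ≤ fuel → p.exec w fuel s = PMF.pure (some (s', k))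

/-- The program `p`, started in `s`, stops deterministically within `B` time units in a state that
satisfies `Q`. -/
def Ends (w : ℕ) (p : Cmd) (s : State) (B : ℕ) (Q : State → Prop) : Prop :=
  ∃ s' k, Runs w p s s' k ∧ k ≤ B ∧ Q s'

theorem andThen_pure (s : State) (c : ℕ) (g : State → PMF Outcome) :
    andThen (PMF.pure (some (s, c))) g = (g s).map (Option.map fun r => (r.1, c + r.2)) := by
  simp [andThen, PMF.pure_bind]

theorem andThen_pure_pure {s s' : State} {c k : ℕ} {g : State → PMF Outcome}
    (h : g s = PMF.pure (some (s', k))) :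
    andThen (PMF.pure (some (s, c))) g = PMF.pure (some (s', c + k)) := by
  rw [andThen_pure, h, PMF.pure_map]; rfl

theorem Ends.mono {w p s B B'} {Q Q' : State → Prop} (h : Ends w p s B Q) (hB : B ≤ B')
    (hQ : ∀ s', Q s' → Q' s') : Ends w p s B' Q' := by
  obtain ⟨s', k, h1, h2, h3⟩ := h
  exact ⟨s', k, h1, h2.trans hB, hQ _ h3⟩

theorem Ends.skip {w s B} {Q : State → Prop} (hB : 1 ≤ B) (h : Q s) : Ends w .skip s B Q :=
  ⟨s, 1, fun _ _ => rfl, hB, h⟩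

theorem Ends.assign {w x e s B} {Q : State → Prop} (hB : e.cost + 1 ≤ B)
    (h : Q { s with var := Function.update s.var x (e.eval w s) }) : Ends w (.assign x e) s B Q :=
  ⟨_, e.cost + 1, fun _ _ => rfl, hB, h⟩

theorem Ends.store {w a e s B} {Q : State → Prop} (hB : a.cost + e.cost + 1 ≤ B)
    (h : Q { s with mem := Function.update s.mem (a.eval w s) (e.eval w s) }) :
    Ends w (.store a e) s B Q :=
  ⟨_, a.cost + e.cost + 1, fun _ _ => rfl, hB, h⟩

theorem Ends.seq {w p q s B B₁ B₂} {Q R : State → Prop} (hp : Ends w p s B₁ R)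
    (hq : ∀ s', R s' → Ends w q s' B₂ Q) (hB : B₁ + B₂ ≤ B) : Ends w (.seq p q) s B Q := by
  obtain ⟨s₁, k₁, h1, h2, h3⟩ := hp
  obtain ⟨s₂, k₂, h4, h5, h6⟩ := hq s₁ h3
  refine ⟨s₂, k₁ + k₂, fun fuel hf => ?_, by omega, h6⟩
  rw [Cmd.exec, h1 fuel (by omega)]
  exact andThen_pure_pure (h4 fuel (by omega))

theorem Ends.ite {w e p q s B B'} {Q : State → Prop}
    (hp : e.eval w s ≠ 0 → Ends w p s B' Q) (hq : e.eval w s = 0 → Ends w q s B' Q)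
    (hB : e.cost + 1 + B' ≤ B) : Ends w (.ite e p q) s B Q := by
  by_cases h : e.eval w s = 0
  · obtain ⟨s₁, k₁, h1, h2, h3⟩ := hq h
    refine ⟨s₁, e.cost + 1 + k₁, fun fuel hf => ?_, by omega, h3⟩
    rw [Cmd.exec]
    exact andThen_pure_pure (by simpa [h] using h1 fuel (by omega))
  · obtain ⟨s₁, k₁, h1, h2, h3⟩ := hp h
    refine ⟨s₁, e.cost + 1 + k₁, fun fuel hf => ?_, by omega, h3⟩
    rw [Cmd.exec]
    exact andThen_pure_pure (by simpa [h] using h1 fuel (by omega))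

/-- A loop with invariant `I`, run exactly `N` times. -/
theorem Ends.loop {w e p B b} (N : ℕ) (I : ℕ → State → Prop)
    (hb : ∀ i < N, ∀ s, I i s → e.eval w s ≠ 0 ∧ Ends w p s b (I (i + 1)))
    (hN : ∀ s, I N s → e.eval w s = 0) (hB : N * (b + e.cost + 1) + e.cost + 1 ≤ B)
    {s : State} (h0 : I 0 s) : Ends w (.loop e p) s B (I N) := by
  suffices H : ∀ m i s, i + m = N → I i s → ∃ s' k, k ≤ m * (b + e.cost + 1) + e.cost + 1 ∧
      (I N) s' ∧ ∀ fuel f', k ≤ fuel → k ≤ f' →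
        iterate w e (p.exec w fuel) f' s = PMF.pure (some (s', k)) by
    obtain ⟨s', k, h1, h2, h3⟩ := H N 0 s (by omega) h0
    exact ⟨s', k, fun fuel hf => h3 fuel fuel hf hf, h1.trans hB, h2⟩
  intro m
  induction m with
  | zero =>
    intro i s hi hI
    obtain rfl : i = N := by omega
    refine ⟨s, e.cost + 1, by omega, hI, fun fuel f' _ hf => ?_⟩
    obtain ⟨f', rfl⟩ : ∃ g, f' = g + 1 := ⟨f' - 1, by omega⟩
    rw [iterate]
    exact andThen_pure_pure (k := 0) (by simp [hN s hI, tick])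
  | succ m ih =>
    intro i s hi hI
    obtain ⟨hc, s₁, k₁, hr, hk, hI'⟩ := hb i (by omega) s hI
    obtain ⟨s₂, k₂, hk2, hI2, h2⟩ := ih (i + 1) s₁ (by omega) hI'
    refine ⟨s₂, e.cost + 1 + (k₁ + k₂), ?_, hI2, fun fuel f' hf hf' => ?_⟩
    · rw [add_mul]; omega
    · obtain ⟨f', rfl⟩ : ∃ g, f' = g + 1 := ⟨f' - 1, by omega⟩
      rw [iterate]
      refine andThen_pure_pure ?_
      rw [if_pos hc, hr fuel (by omega)]
      exact andThen_pure_pure (h2 fuel f' (by omega) (by omega))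

/-! ### A language of array programs

The algorithm is written in a small language with a total, deterministic semantics. A single
simulation theorem, `AProg.comp_ends`, transfers its correctness and a syntactic time bound to the
machine. The random numbers are drawn beforehand and are part of the input of an array program. -/

/-- The state of an array program on `n`-vertex graphs: scalar variables, vertex variables, and
sixteen arrays indexed by vertices. -/
structure Store (n : ℕ) where
  v : ℕ → ℕ
  i : ℕ → Fin n
  a : Fin 16 → Fin n → ℕ

namespace Store
variable {n : ℕ}

/-- Assign `k` to the scalar variable `x`. -/
def setV (σ : Store n) (x k : ℕ) : Store n := { σ with v := Function.update σ.v x k }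
/-- Assign `u` to the vertex variable `x`. -/
def setI (σ : Store n) (x : ℕ) (u : Fin n) : Store n := { σ with i := Function.update σ.i x u }
/-- Replace the array `j` by `f`. -/
def setA (σ : Store n) (j : Fin 16) (f : Fin n → ℕ) : Store n :=
  { σ with a := Function.update σ.a j f }

@[simp] theorem setV_v (σ : Store n) (x k y) :
    (σ.setV x k).v y = if y = x then k else σ.v y := by simp [setV, Function.update_apply]
@[simp] theorem setV_i (σ : Store n) (x k) : (σ.setV x k).i = σ.i := rfl
@[simp] theorem setV_a (σ : Store n) (x k) : (σ.setV x k).a = σ.a := rfl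
@[simp] theorem setI_v (σ : Store n) (x u) : (σ.setI x u).v = σ.v := rfl
@[simp] theorem setI_i (σ : Store n) (x u y) :
    (σ.setI x u).i y = if y = x then u else σ.i y := by simp [setI, Function.update_apply]
@[simp] theorem setI_a (σ : Store n) (x u) : (σ.setI x u).a = σ.a := rfl
@[simp] theorem setA_v (σ : Store n) (j f) : (σ.setA j f).v = σ.v := rfl
@[simp] theorem setA_i (σ : Store n) (j f) : (σ.setA j f).i = σ.i := rfl
@[simp] theorem setA_a (σ : Store n) (j f j') :
    (σ.setA j f).a j' = if j' = j then f else σ.a j' := by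
  by_cases h : j' = j <;> simp [setA, h]

end Store

/-- Binary operations that never exceed their first argument and `1`. -/
inductive BOp
  | sub | div | mod | lt | eq

/-- The operation of the machine that implements the operation. -/
def BOp.toOp : BOp → Op
  | .sub => .sub | .div => .div | .mod => .mod | .lt => .lt | .eq => .eq

/-- The values of the operations; comparisons return `1` for true and `0` for false. -/
def BOp.eval : BOp → ℕ → ℕ → ℕ
  | .sub, a, b => a - b
  | .div, a, b => a / b
  | .mod, a, b => a % b
  | .lt, a, b => if a < b then 1 else 0
  | .eq, a, b => if a = b then 1 else 0

/-- Expressions of array programs: constants, read-only parameters `p b`, scalar variables, the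
number of a vertex variable, array entries, adjacency tests, successor, the operations `BOp`,
conditional expressions, and the number `cnt x e` of vertices `x` for which `e` is nonzero. Since
successor is the only operation by which values grow, no value exceeds the initial values by more
than the running time. -/
inductive AExpr
  | c (k : ℕ)
  | p (b : ℕ)
  | v (x : ℕ)
  | val (x : ℕ)
  | get (j : Fin 16) (x : ℕ)
  | adj (x y : ℕ)
  | succ (e : AExpr)
  | bin (o : BOp) (e f : AExpr)
  | ite (e f g : AExpr)
  | cnt (x : ℕ) (e : AExpr)

/-- Array programs. `par j x e` sets all entries `x` of the array `j` to `e` simultaneously,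
`pick x e` lets `x` be some vertex for which `e` is nonzero (the first vertex if there is none),
`loop x b p` runs `p` for `x = 0, 1, …` below the parameter `b`, `loopV x p` runs `p` for all
vertices `x`, and `draw x y` stores the random number with index `y` in `x`. -/
inductive AProg
  | skip
  | assign (x : ℕ) (e : AExpr)
  | par (j : Fin 16) (x : ℕ) (e : AExpr)
  | pick (x : ℕ) (e : AExpr)
  | draw (x y : ℕ)
  | seq (p q : AProg)
  | ite (e : AExpr) (p q : AProg)
  | loop (x b : ℕ) (p : AProg)
  | loopV (x : ℕ) (p : AProg)

section Semantics

variable {n : ℕ}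

open Classical in
/-- The value of an expression; `G` is the input graph, `π` holds the parameters. -/
noncomputable def AExpr.ev (G : SimpleGraph (Fin n)) (π : ℕ → ℕ) : AExpr → Store n → ℕ
  | .c k, _ => k
  | .p b, _ => π b
  | .v x, σ => σ.v x
  | .val x, σ => σ.i x
  | .get j x, σ => σ.a j (σ.i x)
  | .adj x y, σ => if G.Adj (σ.i x) (σ.i y) then 1 else 0
  | .succ e, σ => e.ev G π σ + 1
  | .bin o e f, σ => o.eval (e.ev G π σ) (f.ev G π σ)
  | .ite e f g, σ => if e.ev G π σ ≠ 0 then f.ev G π σ else g.ev G π σ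
  | .cnt x e, σ => (Finset.univ.filter fun u => e.ev G π (σ.setI x u) ≠ 0).card

open Classical in
/-- The last vertex below `m` with property `P`, the first vertex if there is none. -/
noncomputable def lastBelow [NeZero n] (P : Fin n → Prop) : ℕ → Fin n
  | 0 => 0
  | m + 1 => if h : m < n then if P ⟨m, h⟩ then ⟨m, h⟩ else lastBelow P m else lastBelow P m

/-- Some vertex with property `P`, the first vertex if there is none. -/
noncomputable def select [NeZero n] (P : Fin n → Prop) : Fin n := lastBelow P n

theorem select_spec [NeZero n] {P : Fin n → Prop} (h : ∃ u, P u) : P (select P) := by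
  obtain ⟨u, hu⟩ := h
  have H : ∀ m, (u : ℕ) < m → P (lastBelow P m) := by
    intro m
    induction m with
    | zero => intro h; omega
    | succ m ih =>
      intro h
      rw [lastBelow]
      split_ifs with h1 h2
      · exact h2
      · exact ih (by
          have : (u : ℕ) ≠ m := by rintro rfl; exact h2 hu
          omega)
      · exact ih (by omega)
  exact H n u.2

/-- Running `f 0`, …, `f (N - 1)` one after the other. -/
def iter {α : Type*} (f : ℕ → α → α) : ℕ → α → α
  | 0, s => s
  | N + 1, s => f N (iter f N s)

theorem iter_inv {α : Type*} {f : ℕ → α → α} (I : ℕ → α → Prop) {N : ℕ} {s : α} (h0 : I 0 s)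
    (hs : ∀ i < N, ∀ s, I i s → I (i + 1) (f i s)) : I N (iter f N s) := by
  induction N with
  | zero => exact h0
  | succ N ih => exact hs N (by omega) _ (ih fun i hi => hs i (by omega))

/-- Running `f u` for the vertices `u` in increasing order. -/
def iterV {α : Type*} (f : Fin n → α → α) (s : α) : α :=
  iter (fun i s => if h : i < n then f ⟨i, h⟩ s else s) n s

theorem iterV_inv {α : Type*} {f : Fin n → α → α} (I : ℕ → α → Prop) {s : α} (h0 : I 0 s)
    (hs : ∀ u : Fin n, ∀ s, I u s → I (u + 1) (f u s)) : I n (iterV f s) := by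
  refine iter_inv I h0 fun i hi s h => ?_
  simpa [hi] using hs ⟨i, hi⟩ s h

/-- The state after a program; `R` is the sequence of random numbers. -/
noncomputable def AProg.run [NeZero n] (G : SimpleGraph (Fin n)) (π R : ℕ → ℕ) :
    AProg → Store n → Store n
  | .skip, σ => σ
  | .assign x e, σ => σ.setV x (e.ev G π σ)
  | .par j x e, σ => σ.setA j fun u => e.ev G π (σ.setI x u)
  | .pick x e, σ => σ.setI x (select fun u => e.ev G π (σ.setI x u) ≠ 0)
  | .draw x y, σ => σ.setV x (R (σ.v y))
  | .seq p q, σ => q.run G π R (p.run G π R σ)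
  | .ite e p q, σ => if e.ev G π σ ≠ 0 then p.run G π R σ else q.run G π R σ
  | .loop x b p, σ => iter (fun i σ => p.run G π R (σ.setV x i)) (π b) σ
  | .loopV x p, σ => iterV (fun u σ => p.run G π R (σ.setI x u)) σ

end Semantics

/-- A bound for the running time of the compiled expression and for the growth of values. -/
def AExpr.cost (n : ℕ) : AExpr → ℕ
  | .c k => k + 2
  | .p _ | .v _ | .val _ => 2
  | .get _ _ | .adj _ _ => 10
  | .succ e => e.cost n + 5
  | .bin _ e f => e.cost n + f.cost n + 5
  | .ite e f g => e.cost n + f.cost n + g.cost n + 5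
  | .cnt _ e => n * (e.cost n + 20) + 20

/-- A bound for the running time of the compiled program and for the growth of values. -/
def AProg.cost (n : ℕ) (π : ℕ → ℕ) : AProg → ℕ
  | .skip => 1
  | .assign _ e => e.cost n + 5
  | .par _ _ e => n * (e.cost n + 60) + 60
  | .pick _ e => n * (e.cost n + 20) + 20
  | .draw _ _ => 20
  | .seq p q => p.cost n π + q.cost n π
  | .ite e p q => e.cost n + p.cost n π + q.cost n π + 5
  | .loop _ b p => π b * (p.cost n π + 20) + 20
  | .loopV _ p => n * (p.cost n π + 20) + 20

/-! ### Compilation of array programs -/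

/-! The machine variables are used as follows: `4 b` for the parameter `b` (parameter `0` is the
number of vertices), `4 x + 1` for the scalar `x`, `4 x + 2` for the vertex variable `x`, and
`4 d + 3` for temporary values at nesting depth `d`. The adjacency matrix is followed by the arrays,
by one auxiliary array, and by the random numbers. -/

/-- The address of entry `e` of the row with number `n + j` in the memory. -/
def cell (j : ℕ) (e : Expr) : Expr :=
  .op .add (.op .mul (.op .add (.var 0) (.const j)) (.var 0)) e

/-- Increase the variable `x` by one. -/
def incr (x : ℕ) : Cmd := .assign x (.op .add (.var x) (.const 1))

/-- The code for an expression at depth `d`; the value is left in the variable `4 d + 3`. -/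
def AExpr.comp : AExpr → ℕ → Cmd
  | .c k, d => .assign (4 * d + 3) (.const k)
  | .p b, d => .assign (4 * d + 3) (.var (4 * b))
  | .v x, d => .assign (4 * d + 3) (.var (4 * x + 1))
  | .val x, d => .assign (4 * d + 3) (.var (4 * x + 2))
  | .get j x, d => .assign (4 * d + 3) (.load (cell j (.var (4 * x + 2))))
  | .adj x y, d => .assign (4 * d + 3)
      (.load (.op .add (.op .mul (.var (4 * x + 2)) (.var 0)) (.var (4 * y + 2))))
  | .succ e, d => .seq (e.comp d) (incr (4 * d + 3))
  | .bin o e f, d => .seq (e.comp d) (.seq (f.comp (d + 1))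
      (.assign (4 * d + 3) (.op o.toOp (.var (4 * d + 3)) (.var (4 * (d + 1) + 3)))))
  | .ite e f g, d => .seq (e.comp d) (.ite (.var (4 * d + 3)) (f.comp d) (g.comp d))
  | .cnt x e, d =>
    .seq (.assign (4 * d + 3) (.const 0)) <|
    .seq (.assign (4 * (d + 1) + 3) (.var (4 * x + 2))) <|
    .seq (.assign (4 * x + 2) (.const 0)) <|
    .seq (.loop (.op .lt (.var (4 * x + 2)) (.var 0)) <|
      .seq (e.comp (d + 2)) <|
      .seq (.ite (.var (4 * (d + 2) + 3)) (incr (4 * d + 3)) .skip) <|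
      incr (4 * x + 2)) <|
    .assign (4 * x + 2) (.var (4 * (d + 1) + 3))

/-- The code for a program at depth `d`; temporary values at smaller depth are left unchanged. -/
def AProg.comp : AProg → ℕ → Cmd
  | .skip, _ => .skip
  | .assign x e, d => .seq (e.comp d) (.assign (4 * x + 1) (.var (4 * d + 3)))
  | .par j x e, d =>
    .seq (.assign (4 * d + 3) (.var (4 * x + 2))) <|
    .seq (.assign (4 * x + 2) (.const 0)) <|
    .seq (.loop (.op .lt (.var (4 * x + 2)) (.var 0)) <|
      .seq (e.comp (d + 1)) <|
      .seq (.store (cell 16 (.var (4 * x + 2))) (.var (4 * (d + 1) + 3))) <|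
      incr (4 * x + 2)) <|
    .seq (.assign (4 * x + 2) (.const 0)) <|
    .seq (.loop (.op .lt (.var (4 * x + 2)) (.var 0)) <|
      .seq (.store (cell j (.var (4 * x + 2))) (.load (cell 16 (.var (4 * x + 2))))) <|
      incr (4 * x + 2)) <|
    .assign (4 * x + 2) (.var (4 * d + 3))
  | .pick x e, d =>
    .seq (.assign (4 * d + 3) (.const 0)) <|
    .seq (.assign (4 * x + 2) (.const 0)) <|
    .seq (.loop (.op .lt (.var (4 * x + 2)) (.var 0)) <|
      .seq (e.comp (d + 1)) <|
      .seq (.ite (.var (4 * (d + 1) + 3)) (.assign (4 * d + 3) (.var (4 * x + 2))) .skip) <|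
      incr (4 * x + 2)) <|
    .assign (4 * x + 2) (.var (4 * d + 3))
  | .draw x y, _ => .assign (4 * x + 1) (.load (cell 17 (.var (4 * y + 1))))
  | .seq p q, d => .seq (p.comp d) (q.comp d)
  | .ite e p q, d => .seq (e.comp d) (.ite (.var (4 * d + 3)) (p.comp d) (q.comp d))
  | .loop x b p, d =>
    .seq (.assign (4 * d + 3) (.const 0)) <|
    .loop (.op .lt (.var (4 * d + 3)) (.var (4 * b))) <|
      .seq (.assign (4 * x + 1) (.var (4 * d + 3))) <|
      .seq (p.comp (d + 1)) <|
      incr (4 * d + 3)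
  | .loopV x p, d =>
    .seq (.assign (4 * d + 3) (.const 0)) <|
    .loop (.op .lt (.var (4 * d + 3)) (.var 0)) <|
      .seq (.assign (4 * x + 2) (.var (4 * d + 3))) <|
      .seq (p.comp (d + 1)) <|
      incr (4 * d + 3)

section Simulation

variable {n : ℕ}

open Classical in
/-- The machine state `s` represents the state `σ` of an array program. -/
structure Rep (G : SimpleGraph (Fin n)) (π R : ℕ → ℕ) (σ : Store n) (s : State) : Prop where
  par : ∀ b, s.var (4 * b) = π b
  v : ∀ x, s.var (4 * x + 1) = σ.v x
  i : ∀ x, s.var (4 * x + 2) = σ.i x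
  adj : ∀ u v : Fin n, s.mem (u * n + v) = if G.Adj u v then 1 else 0
  a : ∀ (j : Fin 16) (u : Fin n), s.mem ((n + j) * n + u) = σ.a j u
  rnd : ∀ r, s.mem ((n + 17) * n + r) = R r

/-- All values in the state `σ` are at most `M`. -/
structure Bounded (n : ℕ) (π R : ℕ → ℕ) (M : ℕ) (σ : Store n) : Prop where
  pos : 1 ≤ n
  n : n ≤ M
  par : ∀ b, π b ≤ M
  rnd : ∀ r, R r ≤ M
  v : ∀ x, σ.v x ≤ M
  a : ∀ j u, σ.a j u ≤ M

/-- The states `s` and `s'` agree except for temporary values at depth at least `d`. -/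
structure Same (d : ℕ) (s s' : State) : Prop where
  mem : s'.mem = s.mem
  var : ∀ y, (y % 4 = 3 → y < 4 * d + 3) → s'.var y = s.var y

theorem Same.refl (d : ℕ) (s : State) : Same d s s := ⟨rfl, fun _ _ => rfl⟩

theorem Same.trans {d d' : ℕ} {s₁ s₂ s₃ : State} (h : Same d s₁ s₂) (h' : Same d' s₂ s₃)
    (hd : d ≤ d') : Same d s₁ s₃ :=
  ⟨h'.mem.trans h.mem, fun y hy => (h'.var y (by omega)).trans (h.var y hy)⟩

theorem Same.tmp {d : ℕ} {s s' : State} (h : Same d s s') (k e : ℕ) (hd : d ≤ e) :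
    Same d s { s' with var := Function.update s'.var (4 * e + 3) k } := by
  refine ⟨h.mem, fun y hy => ?_⟩
  have : y ≠ 4 * e + 3 := by omega
  simpa [this] using h.var y hy

variable {G : SimpleGraph (Fin n)} {π R : ℕ → ℕ} {M : ℕ} {σ : Store n} {s s' : State} {w d : ℕ}

theorem Rep.same (h : Rep G π R σ s) (hs : Same d s s') : Rep G π R σ s' where
  par b := (hs.var _ (by omega)).trans (h.par b)
  v x := (hs.var _ (by omega)).trans (h.v x)
  i x := (hs.var _ (by omega)).trans (h.i x)
  adj u v := by rw [hs.mem]; exact h.adj u v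
  a j u := by rw [hs.mem]; exact h.a j u
  rnd r := by rw [hs.mem]; exact h.rnd r

theorem Bounded.mono (h : Bounded n π R M σ) {M' : ℕ} (hM : M ≤ M') : Bounded n π R M' σ :=
  ⟨h.pos, h.n.trans hM, fun b => (h.par b).trans hM, fun r => (h.rnd r).trans hM,
    fun x => (h.v x).trans hM, fun j u => (h.a j u).trans hM⟩

theorem Bounded.setI (h : Bounded n π R M σ) (x : ℕ) (u : Fin n) : Bounded n π R M (σ.setI x u) :=
  ⟨h.pos, h.n, h.par, h.rnd, h.v, h.a⟩

theorem Bounded.setV (h : Bounded n π R M σ) (x : ℕ) {k : ℕ} (hk : k ≤ M) :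
    Bounded n π R M (σ.setV x k) :=
  ⟨h.pos, h.n, h.par, h.rnd, fun y => by rw [Store.setV_v]; split_ifs; exacts [hk, h.v y], h.a⟩

theorem Bounded.setA (h : Bounded n π R M σ) (j : Fin 16) {f : Fin n → ℕ} (hf : ∀ u, f u ≤ M) :
    Bounded n π R M (σ.setA j f) :=
  ⟨h.pos, h.n, h.par, h.rnd, h.v, fun j' u => by
    rw [Store.setA_a]; split_ifs; exacts [hf u, h.a j' u]⟩

theorem AExpr.ev_le (h : Bounded n π R M σ) (e : AExpr) : e.ev G π σ ≤ M + e.cost n := by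
  induction e generalizing σ with
  | c k => simp [ev, cost]; omega
  | p b => have := h.par b; simp [ev]; omega
  | v x => have := h.v x; simp [ev]; omega
  | val x => have := (σ.i x).2; have := h.n; simp [ev]; omega
  | get j x => have := h.a j (σ.i x); simp [ev]; omega
  | adj x y => simp only [ev, cost]; split_ifs <;> omega
  | succ e ih => have := ih h; simp only [ev, cost]; omega
  | bin o e f ihe ihf =>
    have := ihe h
    have := Nat.div_le_self (e.ev G π σ) (f.ev G π σ)
    have := Nat.mod_le (e.ev G π σ) (f.ev G π σ)
    cases o <;> simp only [ev, cost, BOp.eval] <;> first | omega | (split_ifs <;> omega)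
  | ite e f g _ ihf ihg =>
    have := ihf h
    have := ihg h
    simp only [ev, cost]; split_ifs <;> omega
  | cnt x e ih =>
    clear ih
    have h1 := Finset.card_le_univ (Finset.univ.filter fun u => e.ev G π (σ.setI x u) ≠ 0)
    have := h.n
    simp only [Fintype.card_fin] at h1
    simp only [ev]; omega

theorem BOp.toOp_eval (o : BOp) (w a b : ℕ) : o.toOp.eval w a b = o.eval a b := by
  cases o <;> rfl

end Simulation

section Simulation

variable {n : ℕ} {G : SimpleGraph (Fin n)} {π R : ℕ → ℕ} {M : ℕ} {σ : Store n} {s s' : State}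
  {w d : ℕ}

theorem eval_cell {j : ℕ} {e : Expr} (hn : s.var 0 = n) (h1 : 1 ≤ n) (hj : j ≤ 17)
    (hw : (n + 17) * n + e.eval w s < 2 ^ w) :
    (cell j e).eval w s = (n + j) * n + e.eval w s := by
  have h2 : (n + j) * n ≤ (n + 17) * n := Nat.mul_le_mul_right _ (by omega)
  have h3 : n + j ≤ (n + j) * n := Nat.le_mul_of_pos_right _ h1
  simp only [cell, Expr.eval, Op.eval, hn]
  rw [Nat.mod_eq_of_lt (a := j) (by omega), Nat.mod_eq_of_lt (a := n + j) (by omega),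
    Nat.mod_eq_of_lt (a := (n + j) * n) (by omega), Nat.mod_eq_of_lt (by omega)]

theorem Ends.incr {x B : ℕ} {Q : State → Prop} (hB : 4 ≤ B) (hx : s.var x + 1 < 2 ^ w)
    (h : Q { s with var := Function.update s.var x (s.var x + 1) }) :
    Ends w (incr x) s B Q := by
  refine Ends.assign (by simpa [Expr.cost] using hB) ?_
  simp only [Expr.eval, Op.eval]
  rw [Nat.mod_eq_of_lt (a := 1) (by omega), Nat.mod_eq_of_lt hx]
  exact h

theorem Rep.var_zero (h : Rep G π R σ s) (h0 : π 0 = n) : s.var 0 = n := (h.par 0).trans h0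

/-- Assigning a temporary value does not affect anything that is represented. -/
theorem Ends.assign_tmp {e : Expr} {B k : ℕ} (hB : e.cost + 1 ≤ B) (hk : e.eval w s = k) :
    Ends w (.assign (4 * d + 3) e) s B (fun s' => Same d s s' ∧ s'.var (4 * d + 3) = k) :=
  Ends.assign hB ⟨(Same.refl d s).tmp _ _ le_rfl, by simp [hk]⟩

theorem lt_eval_ne_zero {x y : ℕ} :
    (Expr.op Op.lt (.var x) (.var y)).eval w s ≠ 0 ↔ s.var x < s.var y := by
  simp only [Expr.eval, Op.eval]
  split_ifs with h <;> simp [h]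

theorem lt_eval_eq_zero {x y : ℕ} :
    (Expr.op Op.lt (.var x) (.var y)).eval w s = 0 ↔ ¬ s.var x < s.var y := by
  simp only [Expr.eval, Op.eval]
  split_ifs with h <;> simp [h]

/-- The states `s` and `s'` agree except for temporary values at depth at least `d` and for the
vertex variable `x`. -/
structure SameBut (d x : ℕ) (s s' : State) : Prop where
  mem : s'.mem = s.mem
  var : ∀ y, (y % 4 = 3 → y < 4 * d + 3) → y ≠ 4 * x + 2 → s'.var y = s.var y

theorem SameBut.rep {x : ℕ} (h : SameBut d x s s') (hs : Rep G π R σ s) {u : Fin n}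
    (hu : s'.var (4 * x + 2) = u) : Rep G π R (σ.setI x u) s' where
  par b := (h.var _ (by omega) (by omega)).trans (hs.par b)
  v y := (h.var _ (by omega) (by omega)).trans (hs.v y)
  i y := by
    by_cases hy : y = x
    · subst hy; simpa using hu
    · simpa [hy] using (h.var (4 * y + 2) (by omega) (by omega)).trans (hs.i y)
  adj u v := by rw [h.mem]; exact hs.adj u v
  a j u := by rw [h.mem]; exact hs.a j u
  rnd r := by rw [h.mem]; exact hs.rnd r

open Classical in
theorem card_filter_lt_succ (P : Fin n → Prop) (u : Fin n) :
    (Finset.univ.filter fun v : Fin n => (v : ℕ) < u + 1 ∧ P v).card =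
      (Finset.univ.filter fun v : Fin n => (v : ℕ) < u ∧ P v).card + if P u then 1 else 0 := by
  have key : ∀ v : Fin n, ((v : ℕ) < u + 1 ∧ P v) ↔ ((v : ℕ) < u ∧ P v) ∨ (v = u ∧ P u) := by
    intro v
    constructor
    · rintro ⟨h1, h2⟩
      by_cases h : v = u
      · subst h; exact Or.inr ⟨rfl, h2⟩
      · exact Or.inl ⟨by have := Fin.val_ne_of_ne h; omega, h2⟩
    · rintro (⟨h1, h2⟩ | ⟨rfl, h2⟩)
      · exact ⟨by omega, h2⟩
      · exact ⟨by omega, h2⟩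
  simp_rw [key, Finset.filter_or]
  rw [Finset.card_union_of_disjoint]
  · congr 1
    split_ifs with h
    · rw [Finset.card_eq_one]; exact ⟨u, by ext; simp [h]⟩
    · simp [h]
  · rw [Finset.disjoint_filter]
    rintro v - ⟨h, -⟩ ⟨rfl, -⟩
    omega

/-- The code of an expression computes its value within its cost and changes nothing else. -/
theorem AExpr.comp_ends [NeZero n] (e : AExpr) : ∀ {d : ℕ} {σ : Store n} {s : State},
    Rep G π R σ s → Bounded n π R M σ → π 0 = n → (n + 17) * n + (M + e.cost n) < 2 ^ w →
    Ends w (e.comp d) s (e.cost n)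
      (fun s' => Same d s s' ∧ s'.var (4 * d + 3) = e.ev G π σ) := by
  induction e with
  | c k =>
    intro d σ s hs hb h0 hw
    simp only [cost] at hw
    exact Ends.assign_tmp (by simp [Expr.cost, cost])
      (by simp only [Expr.eval, ev]; exact Nat.mod_eq_of_lt (by omega))
  | p b =>
    intro d σ s hs hb h0 hw
    exact Ends.assign_tmp (by simp [Expr.cost, cost]) (hs.par b)
  | v x =>
    intro d σ s hs hb h0 hw
    exact Ends.assign_tmp (by simp [Expr.cost, cost]) (hs.v x)
  | val x =>
    intro d σ s hs hb h0 hw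
    exact Ends.assign_tmp (by simp [Expr.cost, cost]) (hs.i x)
  | get j x =>
    intro d σ s hs hb h0 hw
    have hx := (σ.i x).2
    refine Ends.assign_tmp (by simp [Expr.cost, cost, cell]) ?_
    have h2 := hb.n
    have h3 : (cell j (.var (4 * x + 2))).eval w s = (n + j) * n + σ.i x := by
      rw [eval_cell (hs.var_zero h0) hb.pos (by omega)]
      · simp only [Expr.eval, hs.i]
      · simp only [Expr.eval, hs.i]; omega
    rw [Expr.eval, h3, hs.a]; rfl
  | adj x y =>
    intro d σ s hs hb h0 hw
    have hx := (σ.i x).2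
    have hy := (σ.i y).2
    refine Ends.assign_tmp (by simp [Expr.cost, cost]) ?_
    have h2 := hb.n
    have h3 : (σ.i x : ℕ) * n ≤ (n + 17) * n := Nat.mul_le_mul_right _ (by omega)
    simp only [Expr.eval, Op.eval, hs.i, hs.var_zero h0]
    rw [Nat.mod_eq_of_lt (a := (σ.i x : ℕ) * n) (by omega), Nat.mod_eq_of_lt (by omega), hs.adj]
    rfl
  | succ e ih =>
    intro d σ s hs hb h0 hw
    simp only [cost] at hw
    have hle := e.ev_le (G := G) hb
    refine Ends.seq (B₁ := e.cost n) (B₂ := 4) (ih hs hb h0 (by omega)) ?_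
      (by simp only [cost]; omega)
    rintro s₁ ⟨h1, h2⟩
    refine Ends.incr le_rfl (by omega) ⟨h1.tmp _ _ le_rfl, by simp [h2, ev]⟩
  | bin o e f ihe ihf =>
    intro d σ s hs hb h0 hw
    simp only [cost] at hw
    refine Ends.seq (B₁ := e.cost n) (B₂ := f.cost n + 4) (ihe hs hb h0 (by omega)) ?_
      (by simp only [cost]; omega)
    rintro s₁ ⟨h1, h2⟩
    refine Ends.seq (B₁ := f.cost n) (B₂ := 4) (ihf (d := d + 1) (hs.same h1) hb h0 (by omega)) ?_
      (by omega)
    rintro s₂ ⟨h3, h4⟩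
    refine (Ends.assign_tmp (k := (AExpr.bin o e f).ev G π σ) (d := d) (by simp [Expr.cost]) ?_).mono
      le_rfl fun s₃ h5 => ⟨(h1.trans h3 (by omega)).trans h5.1 le_rfl, h5.2⟩
    simp only [Expr.eval, BOp.toOp_eval, h4, h3.var (4 * d + 3) (by omega), h2, ev]
  | ite e f g ihe ihf ihg =>
    intro d σ s hs hb h0 hw
    simp only [cost] at hw
    refine Ends.seq (B₁ := e.cost n) (B₂ := f.cost n + g.cost n + 2) (ihe hs hb h0 (by omega)) ?_
      (by simp only [cost]; omega)
    rintro s₁ ⟨h1, h2⟩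
    refine Ends.ite (B' := f.cost n + g.cost n) ?_ ?_ (by simp only [Expr.cost]; omega)
    · intro h
      refine (ihf (d := d) (hs.same h1) hb h0 (by omega)).mono (by omega) fun s₂ h3 =>
        ⟨h1.trans h3.1 le_rfl, ?_⟩
      rw [Expr.eval, h2] at h
      simp [h3.2, ev, h]
    · intro h
      refine (ihg (d := d) (hs.same h1) hb h0 (by omega)).mono (by omega) fun s₂ h3 =>
        ⟨h1.trans h3.1 le_rfl, ?_⟩
      rw [Expr.eval, h2] at h
      simp [h3.2, ev, h]
  | cnt x e ih =>
    intro d σ s hs hb h0 hw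
    simp only [cost] at hw
    have hn := hb.n
    have hc : e.cost n + 20 ≤ n * (e.cost n + 20) := Nat.le_mul_of_pos_left _ hb.pos
    refine Ends.seq (B₁ := 2) (B₂ := n * (e.cost n + 20) + 18)
      (Ends.assign_tmp (k := 0) (by simp [Expr.cost]) (by simp [Expr.eval])) ?_
      (by simp only [cost]; omega)
    rintro s₁ ⟨h1, h2⟩
    refine Ends.seq (B₁ := 2) (B₂ := n * (e.cost n + 20) + 16)
      (Ends.assign_tmp (d := d + 1) (k := σ.i x) (by simp [Expr.cost]) ?_) ?_ (by omega)
    · rw [Expr.eval, h1.var _ (by omega), hs.i]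
    rintro s₂ ⟨h3, h4⟩
    have h5 : Same d s s₂ := h1.trans h3 (by omega)
    have h6 : s₂.var (4 * d + 3) = 0 := (h3.var _ (by omega)).trans h2
    have hs₂ := hs.same h5
    -- The old value of the vertex variable `x` is kept at depth `d + 1`, the count at depth `d`.
    let I : ℕ → State → Prop := fun m s' => SameBut d x s s' ∧ s'.var (4 * x + 2) = m ∧
      s'.var (4 * (d + 1) + 3) = σ.i x ∧ s'.var (4 * d + 3) =
        (Finset.univ.filter fun u : Fin n => (u : ℕ) < m ∧ e.ev G π (σ.setI x u) ≠ 0).card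
    refine Ends.seq (B₁ := 2) (B₂ := n * (e.cost n + 20) + 14) (R := I 0)
      (Ends.assign (by simp [Expr.cost]) ?_) ?_ (by omega)
    · refine ⟨⟨h5.mem, fun y hy hyx => ?_⟩, ?_, ?_, ?_⟩
      · simpa [hyx] using h5.var y hy
      · simp [Expr.eval]
      · simp only [Function.update_apply]
        rw [if_neg (by omega)]; exact h4
      · simp only [Function.update_apply]
        rw [if_neg (by omega)]; simpa using h6
    intro s₃ h7
    refine Ends.seq (B₁ := n * (e.cost n + 20) + 10) (B₂ := 4) (R := I n)
      (Ends.loop (b := e.cost n + 10) n I ?_ ?_ ?_ h7) ?_ (by omega)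
    · rintro m hm s₄ ⟨h8, h9, h10, h11⟩
      have hs₄ : Rep G π R (σ.setI x ⟨m, hm⟩) s₄ := h8.rep hs h9
      refine ⟨by rw [lt_eval_ne_zero, h9, hs₄.var_zero h0]; exact hm, ?_⟩
      refine Ends.seq (B₁ := e.cost n) (B₂ := 10)
        (ih (d := d + 2) hs₄ (hb.setI x _) h0 (by omega)) ?_ (by omega)
      rintro s₅ ⟨h12, h13⟩
      have hcard : (Finset.univ.filter fun u : Fin n =>
          (u : ℕ) < m ∧ e.ev G π (σ.setI x u) ≠ 0).card ≤ n := by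
        simpa using Finset.card_le_univ (Finset.univ.filter fun u : Fin n =>
          (u : ℕ) < m ∧ e.ev G π (σ.setI x u) ≠ 0)
      have h14 : s₅.var (4 * d + 3) = (Finset.univ.filter fun u : Fin n =>
          (u : ℕ) < m ∧ e.ev G π (σ.setI x u) ≠ 0).card := (h12.var _ (by omega)).trans h11
      have hstep := card_filter_lt_succ (fun u => e.ev G π (σ.setI x u) ≠ 0) ⟨m, hm⟩
      simp only at hstep
      refine Ends.seq (B₁ := 6) (B₂ := 4)
        (R := fun s' => SameBut d x s s' ∧ s'.var (4 * x + 2) = m ∧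
          s'.var (4 * (d + 1) + 3) = σ.i x ∧ s'.var (4 * d + 3) =
            (Finset.univ.filter fun u : Fin n =>
              (u : ℕ) < m + 1 ∧ e.ev G π (σ.setI x u) ≠ 0).card) ?_ ?_ (by omega)
      · have h15 : SameBut d x s s₅ := ⟨h12.mem.trans h8.mem,
          fun y hy hyx => (h12.var y (by omega)).trans (h8.var y hy hyx)⟩
        refine Ends.ite (B' := 4) ?_ ?_ (by simp [Expr.cost])
        · intro hne
          rw [Expr.eval, h13] at hne
          refine Ends.incr le_rfl (by omega) ⟨⟨h15.mem, fun y hy hyx => ?_⟩, ?_, ?_, ?_⟩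
          · have : y ≠ 4 * d + 3 := by omega
            simpa [this] using h15.var y hy hyx
          · simp only [Function.update_apply]
            rw [if_neg (by omega), h12.var _ (by omega), h9]
          · simp only [Function.update_apply]
            rw [if_neg (by omega), h12.var _ (by omega), h10]
          · rw [hstep, if_pos hne]; simp [h14]
        · intro hz
          rw [Expr.eval, h13] at hz
          refine Ends.skip (by omega) ⟨h15, by rw [h12.var _ (by omega), h9],
            by rw [h12.var _ (by omega), h10], ?_⟩
          rw [hstep, if_neg (by simpa using hz), h14]; rfl
      · rintro s₆ ⟨h16, h17, h18, h19⟩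
        refine Ends.incr le_rfl (by omega) ⟨⟨h16.mem, fun y hy hyx => ?_⟩, ?_, ?_, ?_⟩
        · simpa [hyx] using h16.var y hy hyx
        · simp [h17]
        · simp only [Function.update_apply]
          rw [if_neg (by omega), h18]
        · simp only [Function.update_apply]
          rw [if_neg (by omega), h19]
    · rintro s₄ ⟨h8, h9, -, -⟩
      rw [lt_eval_eq_zero, h9, h8.var 0 (by omega) (by omega), hs.var_zero h0]
      exact lt_irrefl _
    · simp only [Expr.cost]
      have : n * (e.cost n + 20) = n * (e.cost n + 10 + (1 + 1 + 1) + 1) + n * 6 := by ring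
      omega
    · rintro s₄ ⟨h8, h9, h10, h11⟩
      refine Ends.assign (by simp [Expr.cost]) ⟨⟨h8.mem, fun y hy => ?_⟩, ?_⟩
      · by_cases hyx : y = 4 * x + 2
        · subst hyx
          simp only [Expr.eval, Function.update_self, h10, hs.i]
        · simpa [hyx] using h8.var y hy hyx
      · simp only [Function.update_apply]
        rw [if_neg (by omega), h11]
        simp [ev]

end Simulation

section Simulation

variable {n : ℕ} {G : SimpleGraph (Fin n)} {π R : ℕ → ℕ} {M : ℕ} {σ : Store n} {s s' : State}
  {w d : ℕ}

theorem AProg.run_bounded [NeZero n] (p : AProg) : ∀ {M : ℕ} {σ : Store n}, Bounded n π R M σ →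
    Bounded n π R (M + p.cost n π) (p.run G π R σ) := by
  induction p with
  | skip => exact fun h => h.mono (by omega)
  | assign x e =>
    exact fun h => (h.mono (by omega)).setV x ((e.ev_le h).trans (by simp only [cost]; omega))
  | par j x e =>
    intro M σ h
    have hc : e.cost n + 60 ≤ n * (e.cost n + 60) := Nat.le_mul_of_pos_left _ h.pos
    exact (h.mono (by omega)).setA j fun u =>
      (e.ev_le (h.setI x u)).trans (by simp only [cost]; omega)
  | pick x e => exact fun h => (h.mono (by omega)).setI x _
  | draw x y => exact fun h => (h.mono (by omega)).setV x ((h.rnd _).trans (by omega))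
  | seq p q ihp ihq =>
    intro M σ h
    have := ihq (ihp h)
    simpa [run, cost, add_assoc] using this
  | ite e p q ihp ihq =>
    intro M σ h
    simp only [run]
    split_ifs
    · exact (ihp h).mono (by simp only [cost]; omega)
    · exact (ihq h).mono (by simp only [cost]; omega)
  | loop x b p ih =>
    intro M σ h
    have hb := h.par b
    refine (iter_inv (fun i σ => Bounded n π R (M + i * (p.cost n π + 20)) σ) (by simpa using h)
      fun i hi σ hσ => ?_).mono (M := M + π b * (p.cost n π + 20)) (by simp only [cost]; omega)
    refine (ih (hσ.setV x (k := i) (by omega))).mono ?_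
    rw [add_mul]; omega
  | loopV x p ih =>
    intro M σ h
    refine (iterV_inv (fun i σ => Bounded n π R (M + i * (p.cost n π + 20)) σ) (by simpa using h)
      fun i σ hσ => ?_).mono (M := M + n * (p.cost n π + 20)) (by simp only [cost]; omega)
    refine (ih (hσ.setI x i)).mono ?_
    rw [add_mul]; omega

/-- The states `s` and `s'` agree on the temporary values at depth less than `d`. -/
def Keeps (d : ℕ) (s s' : State) : Prop := ∀ y, y % 4 = 3 → y < 4 * d + 3 → s'.var y = s.var y

theorem Same.keeps (h : Same d s s') : Keeps d s s' := fun y _ hy => h.var y fun _ => hy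

theorem Rep.setV (h : Rep G π R σ s) (x k : ℕ) :
    Rep G π R (σ.setV x k) { s with var := Function.update s.var (4 * x + 1) k } where
  par b := by simp only [Function.update_apply]; rw [if_neg (by omega), h.par]
  v y := by
    simp only [Function.update_apply, Store.setV_v, h.v]
    by_cases hy : y = x
    · simp [hy]
    · rw [if_neg (by omega), if_neg hy]
  i y := by simp only [Function.update_apply]; rw [if_neg (by omega), h.i]; rfl
  adj := h.adj
  a := h.a
  rnd := h.rnd

theorem Rep.setI (h : Rep G π R σ s) (x : ℕ) (u : Fin n) :
    Rep G π R (σ.setI x u) { s with var := Function.update s.var (4 * x + 2) (u : ℕ) } where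
  par b := by simp only [Function.update_apply]; rw [if_neg (by omega), h.par]
  v y := by simp only [Function.update_apply]; rw [if_neg (by omega), h.v]; rfl
  i y := by
    simp only [Function.update_apply, Store.setI_i, h.i]
    by_cases hy : y = x
    · simp [hy]
    · rw [if_neg (by omega), if_neg hy]
  adj := h.adj
  a := h.a
  rnd := h.rnd

/-- The states agree on all variables except for the vertex variable `x` and the temporary values at
depth at least `d`, and on the part of the memory that satisfies `S`. -/
structure SameOn (d x : ℕ) (S : ℕ → Prop) (s s' : State) : Prop where
  mem : ∀ m, S m → s'.mem m = s.mem m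
  var : ∀ y, (y % 4 = 3 → y < 4 * d + 3) → y ≠ 4 * x + 2 → s'.var y = s.var y

theorem row_le {j j' : ℕ} (h : j ≤ j') : (n + j) * n ≤ (n + j') * n :=
  Nat.mul_le_mul_right _ (by omega)

theorem row_lt {j j' : ℕ} (h : j < j') (u : Fin n) : (n + j) * n + u < (n + j') * n := by
  have := row_le (n := n) (j := j + 1) (j' := j') h
  have := u.2
  have : (n + (j + 1)) * n = (n + j) * n + n := by ring
  omega

theorem adj_lt (u v : Fin n) (j : ℕ) : (u : ℕ) * n + v < (n + j) * n := by
  have h1 : ((u : ℕ) + 1) * n ≤ (n + j) * n := Nat.mul_le_mul_right _ (by omega)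
  have := v.2
  rw [add_mul] at h1
  omega

theorem SameOn.rep {x : ℕ} (h : SameOn d x (fun m => m < (n + 16) * n ∨ (n + 17) * n ≤ m) s s')
    (hs : Rep G π R σ s) {u : Fin n} (hu : s'.var (4 * x + 2) = u) :
    Rep G π R (σ.setI x u) s' where
  par b := (h.var _ (by omega) (by omega)).trans (hs.par b)
  v y := (h.var _ (by omega) (by omega)).trans (hs.v y)
  i y := by
    by_cases hy : y = x
    · subst hy; simpa using hu
    · simpa [hy] using (h.var (4 * y + 2) (by omega) (by omega)).trans (hs.i y)
  adj u v := (h.mem _ (Or.inl (adj_lt u v _))).trans (hs.adj u v)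
  a j u := (h.mem _ (Or.inl (row_lt j.2 u))).trans (hs.a j u)
  rnd r := (h.mem _ (Or.inr (by omega))).trans (hs.rnd r)

/-- What has to be proved for each part of a program: its code ends in time in a state that
represents the result of the program. -/
def Simulates (G : SimpleGraph (Fin n)) (π R : ℕ → ℕ) (w d : ℕ) (p : Cmd) (s : State) (B : ℕ)
    (σ : Store n) : Prop :=
  Ends w p s B fun s' => Rep G π R σ s' ∧ Keeps d s s'

/-- The simulation of `par`: a first loop computes the new entries into the auxiliary array, because
the expression may refer to the array `j`; a second loop copies them. -/
theorem comp_par_ends [NeZero n] {j : Fin 16} {x : ℕ} {e : AExpr} (hs : Rep G π R σ s)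
    (hb : Bounded n π R M σ) (h0 : π 0 = n)
    (hw : (n + 17) * n + (M + (AProg.par j x e).cost n π) < 2 ^ w) :
    Simulates G π R w d ((AProg.par j x e).comp d) s ((AProg.par j x e).cost n π)
      ((AProg.par j x e).run G π R σ) := by
  simp only [AProg.cost] at hw
  have hn := hb.n
  have hc : e.cost n + 60 ≤ n * (e.cost n + 60) := Nat.le_mul_of_pos_left _ hb.pos
  set f : Fin n → ℕ := fun u => e.ev G π (σ.setI x u) with hf
  refine Ends.seq (B₁ := 2) (B₂ := n * (e.cost n + 60) + 50)
    (Ends.assign_tmp (k := σ.i x) (by simp [Expr.cost]) (by simp [Expr.eval, hs.i])) ?_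
    (by simp only [AProg.cost]; omega)
  rintro s₁ ⟨h1, h2⟩
  -- `S` is the memory except for the auxiliary array, `I` the invariant of the first loop.
  let S : ℕ → Prop := fun m => m < (n + 16) * n ∨ (n + 17) * n ≤ m
  let I : ℕ → State → Prop := fun m s' => SameOn d x S s s' ∧ s'.var (4 * x + 2) = m ∧
      s'.var (4 * d + 3) = σ.i x ∧ ∀ u : Fin n, (u : ℕ) < m → s'.mem ((n + 16) * n + u) = f u
  refine Ends.seq (B₁ := 2) (B₂ := n * (e.cost n + 60) + 40) (R := I 0)
    (Ends.assign (by simp [Expr.cost]) ?_) ?_ (by omega)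
  · refine ⟨⟨fun m _ => congrFun h1.mem m, fun y hy hyx => ?_⟩, ?_, ?_, ?_⟩
    · simpa [hyx] using h1.var y hy
    · simp [Expr.eval]
    · simp only [Function.update_apply]
      rw [if_neg (by omega)]; exact h2
    · intro u hu; omega
  intro s₂ h3
  refine Ends.seq (B₁ := n * (e.cost n + 20) + 10) (B₂ := n * 40 + 30) (R := I n)
    (Ends.loop (b := e.cost n + 13) n I ?_ ?_ ?_ h3) ?_
    (by have : n * (e.cost n + 60) = n * (e.cost n + 20) + n * 40 := by ring
        omega)
  · rintro m hm s₃ ⟨h4, h5, h6, h7⟩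
    have hs₃ : Rep G π R (σ.setI x ⟨m, hm⟩) s₃ := h4.rep hs h5
    refine ⟨by rw [lt_eval_ne_zero, h5, hs₃.var_zero h0]; exact hm, ?_⟩
    refine Ends.seq (B₁ := e.cost n) (B₂ := 13)
      (e.comp_ends (d := d + 1) hs₃ (hb.setI x _) h0 (by omega)) ?_ (by omega)
    rintro s₄ ⟨h8, h9⟩
    have h10 : s₄.var (4 * x + 2) = m := (h8.var _ (by omega)).trans h5
    have hcell : (cell 16 (.var (4 * x + 2))).eval w s₄ = (n + 16) * n + m := by
      rw [eval_cell ((hs₃.same h8).var_zero h0) hb.pos (by omega)]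
      · simp only [Expr.eval, h10]
      · simp only [Expr.eval, h10]; omega
    refine Ends.seq (B₁ := 9) (B₂ := 4) (R := fun s' => SameOn d x S s s' ∧
      s'.var (4 * x + 2) = m ∧ s'.var (4 * d + 3) = σ.i x ∧
      ∀ u : Fin n, (u : ℕ) < m + 1 → s'.mem ((n + 16) * n + u) = f u)
      (Ends.store (by simp [Expr.cost, cell]) ?_) ?_ (by omega)
    · refine ⟨⟨fun y hy => ?_, fun y hy hyx => ?_⟩, h10, ?_, fun u hu => ?_⟩
      · have hne : y ≠ (n + 16) * n + m := by
          rintro rfl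
          have := row_lt (j := 16) (j' := 17) (by omega) (⟨m, hm⟩ : Fin n)
          simp only at this
          rcases hy with hy | hy <;> omega
        simpa [hcell, hne, h8.mem] using h4.mem y hy
      · exact (h8.var y (by omega)).trans (h4.var y hy hyx)
      · exact (h8.var _ (by omega)).trans h6
      · simp only [hcell, Function.update_apply]
        split_ifs with h
        · have : u = ⟨m, hm⟩ := Fin.ext (by simpa using h)
          rw [Expr.eval, h9, this]
        · rw [h8.mem]
          exact h7 u (by omega)
    · rintro s₅ ⟨h11, h12, h13, h14⟩
      refine Ends.incr le_rfl (by omega) ⟨⟨h11.mem, fun y hy hyx => ?_⟩, ?_, ?_, h14⟩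
      · simpa [hyx] using h11.var y hy hyx
      · simp [h12]
      · simp only [Function.update_apply]
        rw [if_neg (by omega), h13]
  · rintro s₃ ⟨h4, h5, -, -⟩
    rw [lt_eval_eq_zero, h5, h4.var 0 (by omega) (by omega), hs.var_zero h0]
    exact lt_irrefl _
  · simp only [Expr.cost]
    have : n * (e.cost n + 20) = n * (e.cost n + 13 + (1 + 1 + 1) + 1) + n * 3 := by ring
    omega
  rintro s₃ ⟨h4, h5, h6, h7⟩
  -- `S'` excludes also the array `j`, and `I'` is the invariant of the second loop.
  let S' : ℕ → Prop := fun m =>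
    (m < (n + 16) * n ∨ (n + 17) * n ≤ m) ∧ ∀ u : Fin n, m ≠ (n + j) * n + u
  let I' : ℕ → State → Prop := fun m s' => SameOn d x S' s s' ∧ s'.var (4 * x + 2) = m ∧
      s'.var (4 * d + 3) = σ.i x ∧ (∀ u : Fin n, s'.mem ((n + 16) * n + u) = f u) ∧
      ∀ u : Fin n, (u : ℕ) < m → s'.mem ((n + j) * n + u) = f u
  refine Ends.seq (B₁ := 2) (B₂ := n * 40 + 20) (R := I' 0)
    (Ends.assign (by simp [Expr.cost]) ?_) ?_ (by omega)
  · refine ⟨⟨fun m hm => h4.mem m hm.1, fun y hy hyx => ?_⟩, ?_, ?_, fun u => h7 u u.2, ?_⟩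
    · simpa [hyx] using h4.var y hy hyx
    · simp [Expr.eval]
    · simp only [Function.update_apply]
      rw [if_neg (by omega)]; exact h6
    · intro u hu; omega
  intro s₄ h8
  refine Ends.seq (B₁ := n * 40 + 10) (B₂ := 4) (R := I' n)
    (Ends.loop (b := 20) n I' ?_ ?_ ?_ h8) ?_ (by omega)
  · rintro m hm s₅ ⟨h9, h10, h11, h12, h13⟩
    have hv0 : s₅.var 0 = n := (h9.var 0 (by omega) (by omega)).trans (hs.var_zero h0)
    refine ⟨by rw [lt_eval_ne_zero, h10, hv0]; exact hm, ?_⟩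
    have hcell : ∀ i ≤ 17, (cell i (.var (4 * x + 2))).eval w s₅ = (n + i) * n + m := by
      intro i hi
      rw [eval_cell hv0 hb.pos (by omega)]
      · simp only [Expr.eval, h10]
      · simp only [Expr.eval, h10]; omega
    refine Ends.seq (B₁ := 16) (B₂ := 4) (R := fun s' => SameOn d x S' s s' ∧
      s'.var (4 * x + 2) = m ∧ s'.var (4 * d + 3) = σ.i x ∧
      (∀ u : Fin n, s'.mem ((n + 16) * n + u) = f u) ∧
      ∀ u : Fin n, (u : ℕ) < m + 1 → s'.mem ((n + j) * n + u) = f u)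
      (Ends.store (by simp [Expr.cost, cell]) ?_) ?_ (by omega)
    · rw [hcell j (by omega), Expr.eval, hcell 16 (by omega), h12 ⟨m, hm⟩]
      refine ⟨⟨fun y hy => ?_, fun y hy hyx => ?_⟩, h10, h11, fun u => ?_, fun u hu => ?_⟩
      · have hne : y ≠ (n + j) * n + m := hy.2 ⟨m, hm⟩
        simpa [hne] using h9.mem y hy
      · exact h9.var y hy hyx
      · have := row_lt j.2 (⟨m, hm⟩ : Fin n)
        simp only at this
        have hne : (n + 16) * n + (u : ℕ) ≠ (n + j) * n + m := by omega
        simpa [hne] using h12 u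
      · simp only [Function.update_apply]
        split_ifs with h
        · exact congrArg f (Fin.ext (by simpa using h.symm))
        · exact h13 u (by omega)
    · rintro s₆ ⟨h14, h15, h16, h17, h18⟩
      refine Ends.incr le_rfl (by omega) ⟨⟨h14.mem, fun y hy hyx => ?_⟩, ?_, ?_, h17, h18⟩
      · simpa [hyx] using h14.var y hy hyx
      · simp [h15]
      · simp only [Function.update_apply]
        rw [if_neg (by omega), h16]
  · rintro s₅ ⟨h9, h10, -, -⟩
    rw [lt_eval_eq_zero, h10, h9.var 0 (by omega) (by omega), hs.var_zero h0]
    exact lt_irrefl _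
  · simp only [Expr.cost]; omega
  · rintro s₅ ⟨h9, h10, h11, h12, h13⟩
    have hv : ∀ y, (y % 4 = 3 → y < 4 * d + 3) →
        Function.update s₅.var (4 * x + 2) (s₅.var (4 * d + 3)) y = s.var y := by
      intro y hy
      by_cases hyx : y = 4 * x + 2
      · subst hyx; simp [h11, hs.i]
      · simpa [hyx] using h9.var y hy hyx
    refine Ends.assign (by simp [Expr.cost]) ⟨⟨fun b => ?_, fun y => ?_, fun y => ?_,
      fun u v => ?_, fun j' u => ?_, fun r => ?_⟩, fun y _ hy => hv y fun _ => hy⟩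
    · exact (hv _ (by omega)).trans (hs.par b)
    · exact (hv _ (by omega)).trans (hs.v y)
    · exact (hv _ (by omega)).trans (hs.i y)
    · exact (h9.mem _ ⟨Or.inl (adj_lt u v _), fun v' h => by
        have := adj_lt u v j; omega⟩).trans (hs.adj u v)
    · simp only [AProg.run, Store.setA_a]
      split_ifs with hj
      · subst hj; exact h13 u u.2
      · refine (h9.mem _ ⟨Or.inl (row_lt j'.2 u), fun v h => ?_⟩).trans (hs.a j' u)
        rcases lt_or_gt_of_ne (fun h => hj (Fin.ext h) : (j' : ℕ) ≠ j) with h' | h'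
        · have := row_lt h' u; omega
        · have := row_lt h' v; omega
    · exact (h9.mem _ ⟨Or.inr (by omega), fun v h => by
        have := row_lt (j := j) (j' := 17) (by omega) v; omega⟩).trans (hs.rnd r)

/-- The simulation of `pick`: the loop remembers the last vertex with the property so far. -/
theorem comp_pick_ends [NeZero n] {x : ℕ} {e : AExpr} (hs : Rep G π R σ s)
    (hb : Bounded n π R M σ) (h0 : π 0 = n)
    (hw : (n + 17) * n + (M + (AProg.pick x e).cost n π) < 2 ^ w) :
    Simulates G π R w d ((AProg.pick x e).comp d) s ((AProg.pick x e).cost n π)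
      ((AProg.pick x e).run G π R σ) := by
  simp only [AProg.cost] at hw
  have hn := hb.n
  have hc : e.cost n + 20 ≤ n * (e.cost n + 20) := Nat.le_mul_of_pos_left _ hb.pos
  set P : Fin n → Prop := fun u => e.ev G π (σ.setI x u) ≠ 0 with hP
  refine Ends.seq (B₁ := 2) (B₂ := n * (e.cost n + 20) + 18)
    (Ends.assign_tmp (k := 0) (by simp [Expr.cost]) (by simp [Expr.eval])) ?_
    (by simp only [AProg.cost]; omega)
  rintro s₁ ⟨h1, h2⟩
  let I : ℕ → State → Prop := fun m s' => SameBut d x s s' ∧ s'.var (4 * x + 2) = m ∧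
      s'.var (4 * d + 3) = lastBelow P m
  refine Ends.seq (B₁ := 2) (B₂ := n * (e.cost n + 20) + 14) (R := I 0)
    (Ends.assign (by simp [Expr.cost]) ?_) ?_ (by omega)
  · refine ⟨⟨h1.mem, fun y hy hyx => ?_⟩, ?_, ?_⟩
    · simpa [hyx] using h1.var y hy
    · simp [Expr.eval]
    · simp only [Function.update_apply]
      rw [if_neg (by omega), h2]; simp [lastBelow]
  intro s₂ h3
  refine Ends.seq (B₁ := n * (e.cost n + 20) + 10) (B₂ := 4) (R := I n)
    (Ends.loop (b := e.cost n + 10) n I ?_ ?_ ?_ h3) ?_ (by omega)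
  · rintro m hm s₃ ⟨h4, h5, h6⟩
    have hs₃ : Rep G π R (σ.setI x ⟨m, hm⟩) s₃ := h4.rep hs h5
    refine ⟨by rw [lt_eval_ne_zero, h5, hs₃.var_zero h0]; exact hm, ?_⟩
    refine Ends.seq (B₁ := e.cost n) (B₂ := 10)
      (e.comp_ends (d := d + 1) hs₃ (hb.setI x _) h0 (by omega)) ?_ (by omega)
    rintro s₄ ⟨h8, h9⟩
    have h10 : s₄.var (4 * x + 2) = m := (h8.var _ (by omega)).trans h5
    have h11 : SameBut d x s s₄ := ⟨h8.mem.trans h4.mem,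
      fun y hy hyx => (h8.var y (by omega)).trans (h4.var y hy hyx)⟩
    refine Ends.seq (B₁ := 6) (B₂ := 4) (R := fun s' => SameBut d x s s' ∧
      s'.var (4 * x + 2) = m ∧ s'.var (4 * d + 3) = lastBelow P (m + 1))
      ?_ ?_ (by omega)
    · refine Ends.ite (B' := 4) ?_ ?_ (by simp [Expr.cost])
      · intro hne
        rw [Expr.eval, h9] at hne
        refine Ends.assign (by simp [Expr.cost]) ⟨⟨h11.mem, fun y hy hyx => ?_⟩, ?_, ?_⟩
        · have : y ≠ 4 * d + 3 := by omega
          simpa [this] using h11.var y hy hyx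
        · simp only [Function.update_apply]
          rw [if_neg (by omega), h10]
        · rw [lastBelow, dif_pos hm, if_pos hne]; simp [Expr.eval, h10]
      · intro hz
        rw [Expr.eval, h9] at hz
        refine Ends.skip (by omega) ⟨h11, h10, ?_⟩
        rw [lastBelow, dif_pos hm, if_neg (by simpa [hP] using hz), h8.var _ (by omega), h6]
    · rintro s₅ ⟨h12, h13, h14⟩
      refine Ends.incr le_rfl (by omega) ⟨⟨h12.mem, fun y hy hyx => ?_⟩, ?_, ?_⟩
      · simpa [hyx] using h12.var y hy hyx
      · simp [h13]
      · simp only [Function.update_apply]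
        rw [if_neg (by omega), h14]
  · rintro s₃ ⟨h4, h5, -⟩
    rw [lt_eval_eq_zero, h5, h4.var 0 (by omega) (by omega), hs.var_zero h0]
    exact lt_irrefl _
  · simp only [Expr.cost]
    have : n * (e.cost n + 20) = n * (e.cost n + 10 + (1 + 1 + 1) + 1) + n * 6 := by ring
    omega
  · rintro s₃ ⟨h4, h5, h6⟩
    refine Ends.assign (by simp [Expr.cost]) ⟨?_, fun y hy1 hy => ?_⟩
    · have h7 : SameBut d x s { s₃ with
          var := Function.update s₃.var (4 * x + 2) (Expr.eval w s₃ (.var (4 * d + 3))) } :=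
        ⟨h4.mem, fun y hy hyx => by simpa [hyx] using h4.var y hy hyx⟩
      exact h7.rep hs (by simp [Expr.eval, h6, select, hP])
    · have : y ≠ 4 * x + 2 := by omega
      simpa [this] using h4.var y (fun _ => hy) this

/-- The code of a program computes the result of the program, within its cost. -/
theorem AProg.comp_ends [NeZero n] (p : AProg) : ∀ {d M : ℕ} {σ : Store n} {s : State},
    Rep G π R σ s → Bounded n π R M σ → π 0 = n → (n + 17) * n + (M + p.cost n π) < 2 ^ w →
    Simulates G π R w d (p.comp d) s (p.cost n π) (p.run G π R σ) := by
  induction p with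
  | skip => exact fun hs _ _ _ => Ends.skip le_rfl ⟨hs, fun _ _ _ => rfl⟩
  | assign x e =>
    intro d M σ s hs hb h0 hw
    simp only [cost] at hw
    refine Ends.seq (B₁ := e.cost n) (B₂ := 2) (e.comp_ends hs hb h0 (by omega)) ?_
      (by simp only [cost]; omega)
    rintro s₁ ⟨h1, h2⟩
    refine Ends.assign (by simp [Expr.cost]) ⟨?_, fun y hy1 hy => ?_⟩
    · rw [Expr.eval, h2]; exact (hs.same h1).setV x _
    · have : y ≠ 4 * x + 1 := by omega
      simpa [this] using h1.keeps y hy1 hy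
  | par j x e => exact fun hs hb h0 hw => comp_par_ends hs hb h0 hw
  | pick x e => exact fun hs hb h0 hw => comp_pick_ends hs hb h0 hw
  | draw x y =>
    intro d M σ s hs hb h0 hw
    have := hb.v y
    refine Ends.assign (by simp [Expr.cost, cell, cost]) ⟨?_, fun z hz1 hz => ?_⟩
    · have h3 : (cell 17 (.var (4 * y + 1))).eval w s = (n + 17) * n + σ.v y := by
        rw [eval_cell (hs.var_zero h0) hb.pos le_rfl]
        · simp only [Expr.eval, hs.v]
        · simp only [Expr.eval, hs.v]; omega
      rw [Expr.eval, h3, hs.rnd]; exact hs.setV x _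
    · have : z ≠ 4 * x + 1 := by omega
      simp [this]
  | seq p q ihp ihq =>
    intro d M σ s hs hb h0 hw
    simp only [cost] at hw
    refine Ends.seq (ihp hs hb h0 (by omega)) ?_ le_rfl
    rintro s₁ ⟨h1, h2⟩
    refine (ihq h1 (p.run_bounded hb) h0 (by omega)).mono le_rfl ?_
    rintro s₂ ⟨h3, h4⟩
    exact ⟨h3, fun y hy1 hy => (h4 y hy1 hy).trans (h2 y hy1 hy)⟩
  | ite e p q ihp ihq =>
    intro d M σ s hs hb h0 hw
    simp only [cost] at hw
    refine Ends.seq (B₁ := e.cost n) (B₂ := p.cost n π + q.cost n π + 2)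
      (e.comp_ends (d := d) hs hb h0 (by omega)) ?_ (by simp only [cost]; omega)
    rintro s₁ ⟨h1, h2⟩
    refine Ends.ite (B' := p.cost n π + q.cost n π) ?_ ?_ (by simp only [Expr.cost]; omega)
    · intro h
      rw [Expr.eval, h2] at h
      refine (ihp (d := d) (hs.same h1) hb h0 (by omega)).mono (by omega) ?_
      rintro s₂ ⟨h3, h4⟩
      rw [run, if_pos h]
      exact ⟨h3, fun y hy1 hy => (h4 y hy1 hy).trans (h1.keeps y hy1 hy)⟩
    · intro h
      rw [Expr.eval, h2] at h
      refine (ihq (d := d) (hs.same h1) hb h0 (by omega)).mono (by omega) ?_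
      rintro s₂ ⟨h3, h4⟩
      rw [run, if_neg (by simpa using h)]
      exact ⟨h3, fun y hy1 hy => (h4 y hy1 hy).trans (h1.keeps y hy1 hy)⟩
  | loop x b p ih =>
    intro d M σ s hs hb h0 hw
    simp only [cost] at hw
    let f := fun i σ => p.run G π R (Store.setV σ x i)
    have hbd : ∀ i ≤ π b, Bounded n π R (M + i * (p.cost n π + 20)) (iter f i σ) := by
      intro i hi
      refine iter_inv (fun i σ => Bounded n π R (M + i * (p.cost n π + 20)) σ) (by simpa using hb)
        fun i' hi' σ hσ => ?_
      have := hb.par b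
      refine (p.run_bounded (hσ.setV x (k := i') (by omega))).mono ?_
      rw [add_mul]; omega
    let I : ℕ → State → Prop := fun m s' => Rep G π R (iter f m σ) s' ∧ Keeps d s s' ∧
      s'.var (4 * d + 3) = m
    refine Ends.seq (B₁ := 2) (B₂ := π b * (p.cost n π + 20) + 10) (R := I 0)
      (Ends.assign (by simp [Expr.cost]) ?_) ?_ (by simp only [cost]; omega)
    · have := (Same.refl d s).tmp ((Expr.const 0).eval w s) d le_rfl
      exact ⟨hs.same this, this.keeps, by simp [Expr.eval]⟩
    intro s₁ h1
    refine (Ends.loop (b := p.cost n π + 10) (π b) I ?_ ?_ ?_ h1).mono le_rfl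
      fun s' h => ⟨h.1, h.2.1⟩
    · rintro m hm s₂ ⟨h2, h3, h4⟩
      refine ⟨by rw [lt_eval_ne_zero, h4, h2.par]; exact hm, ?_⟩
      have hm' : (m + 1) * (p.cost n π + 20) ≤ π b * (p.cost n π + 20) :=
        Nat.mul_le_mul_right _ hm
      rw [add_mul] at hm'
      have := hb.par b
      refine Ends.seq (B₁ := 2) (B₂ := p.cost n π + 4)
        (R := fun s' => Rep G π R ((iter f m σ).setV x m) s' ∧ Keeps d s s' ∧
          s'.var (4 * d + 3) = m)
        (Ends.assign (by simp [Expr.cost]) ⟨?_, fun y hy1 hy => ?_, ?_⟩) ?_ (by omega)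
      · rw [Expr.eval, h4]; exact h2.setV x m
      · have : y ≠ 4 * x + 1 := by omega
        simpa [this] using h3 y hy1 hy
      · simp only [Function.update_apply]
        rw [if_neg (by omega), h4]
      · rintro s₃ ⟨h5, h6, h7⟩
        refine Ends.seq (B₁ := p.cost n π) (B₂ := 4)
          (ih (d := d + 1) h5 ((hbd m hm.le).setV x (by omega)) h0 (by omega)) ?_ le_rfl
        rintro s₄ ⟨h8, h9⟩
        have h10 : s₄.var (4 * d + 3) = m := (h9 _ (by omega) (by omega)).trans h7
        have h11 : Same d s₄ { s₄ with var := Function.update s₄.var (4 * d + 3) (m + 1) } :=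
          (Same.refl d s₄).tmp _ d le_rfl
        refine Ends.incr le_rfl (by rw [h10]; omega) ?_
        rw [h10]
        exact ⟨h8.same h11, fun y hy1 hy => (h11.keeps y hy1 hy).trans
          ((h9 y hy1 (by omega)).trans (h6 y hy1 hy)), by simp⟩
    · rintro s₂ ⟨h2, h3, h4⟩
      rw [lt_eval_eq_zero, h4, h2.par]; exact lt_irrefl _
    · simp only [Expr.cost]
      have : π b * (p.cost n π + 20) = π b * (p.cost n π + 10 + (1 + 1 + 1) + 1) + π b * 6 := by
        ring
      omega
  | loopV x p ih =>
    intro d M σ s hs hb h0 hw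
    simp only [cost] at hw
    let f := fun i (σ : Store n) =>
      if h : i < n then p.run G π R (Store.setI σ x ⟨i, h⟩) else σ
    have hbd : ∀ i ≤ n, Bounded n π R (M + i * (p.cost n π + 20)) (iter f i σ) := by
      intro i hi
      refine iter_inv (fun i σ => Bounded n π R (M + i * (p.cost n π + 20)) σ) (by simpa using hb)
        fun i' hi' σ hσ => ?_
      simp only [f, dif_pos (hi'.trans_le hi)]
      refine (p.run_bounded (hσ.setI x _)).mono ?_
      rw [add_mul]; omega
    let I : ℕ → State → Prop := fun m s' => Rep G π R (iter f m σ) s' ∧ Keeps d s s' ∧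
      s'.var (4 * d + 3) = m
    refine Ends.seq (B₁ := 2) (B₂ := n * (p.cost n π + 20) + 10) (R := I 0)
      (Ends.assign (by simp [Expr.cost]) ?_) ?_ (by simp only [cost]; omega)
    · have := (Same.refl d s).tmp ((Expr.const 0).eval w s) d le_rfl
      exact ⟨hs.same this, this.keeps, by simp [Expr.eval]⟩
    intro s₁ h1
    refine (Ends.loop (b := p.cost n π + 10) n I ?_ ?_ ?_ h1).mono le_rfl
      fun s' h => ⟨h.1, h.2.1⟩
    · rintro m hm s₂ ⟨h2, h3, h4⟩
      refine ⟨by rw [lt_eval_ne_zero, h4, h2.var_zero h0]; exact hm, ?_⟩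
      have hm' : (m + 1) * (p.cost n π + 20) ≤ n * (p.cost n π + 20) :=
        Nat.mul_le_mul_right _ hm
      rw [add_mul] at hm'
      have := hb.n
      refine Ends.seq (B₁ := 2) (B₂ := p.cost n π + 4)
        (R := fun s' => Rep G π R ((iter f m σ).setI x ⟨m, hm⟩) s' ∧ Keeps d s s' ∧
          s'.var (4 * d + 3) = m)
        (Ends.assign (by simp [Expr.cost]) ⟨?_, fun y hy1 hy => ?_, ?_⟩) ?_ (by omega)
      · rw [Expr.eval, h4]; exact h2.setI x ⟨m, hm⟩
      · have : y ≠ 4 * x + 2 := by omega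
        simpa [this] using h3 y hy1 hy
      · simp only [Function.update_apply]
        rw [if_neg (by omega), h4]
      · rintro s₃ ⟨h5, h6, h7⟩
        refine Ends.seq (B₁ := p.cost n π) (B₂ := 4)
          (ih (d := d + 1) h5 ((hbd m hm.le).setI x _) h0 (by omega)) ?_ le_rfl
        rintro s₄ ⟨h8, h9⟩
        have h10 : s₄.var (4 * d + 3) = m := (h9 _ (by omega) (by omega)).trans h7
        have h11 : Same d s₄ { s₄ with var := Function.update s₄.var (4 * d + 3) (m + 1) } :=
          (Same.refl d s₄).tmp _ d le_rfl
        refine Ends.incr le_rfl (by rw [h10]; omega) ?_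
        rw [h10]
        refine ⟨?_, fun y hy1 hy => (h11.keeps y hy1 hy).trans
          ((h9 y hy1 (by omega)).trans (h6 y hy1 hy)), by simp⟩
        have h12 : iter f (m + 1) σ = p.run G π R ((iter f m σ).setI x ⟨m, hm⟩) := by
          simp only [iter, f, dif_pos hm]
        rw [h12]
        exact h8.same h11
    · rintro s₂ ⟨h2, h3, h4⟩
      rw [lt_eval_eq_zero, h4, h2.var_zero h0]; exact lt_irrefl _
    · simp only [Expr.cost]
      have : n * (p.cost n π + 20) = n * (p.cost n π + 10 + (1 + 1 + 1) + 1) + n * 6 := by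
        ring
      omega

end Simulation

end WordRAM

namespace SimpleGraph

/-! ### Walks of given length and induced odd cycles -/

variable {V : Type*}

/-- The subgraph of `G` induced by `X`, as a graph on all vertices. -/
def within (G : SimpleGraph V) (X : Set V) : SimpleGraph V where
  Adj a b := G.Adj a b ∧ a ∈ X ∧ b ∈ X
  symm := ⟨fun _ _ h => ⟨h.1.symm, h.2.2, h.2.1⟩⟩
  loopless := ⟨fun _ h => G.loopless.irrefl _ h.1⟩

/-- There is a walk of length `q` from `x` to `y`. -/
def HasWalk (H : SimpleGraph V) (q : ℕ) (x y : V) : Prop := ∃ p : H.Walk x y, p.length = q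

variable {H : SimpleGraph V} {x y z : V} {q r : ℕ}

theorem HasWalk.refl (x : V) : H.HasWalk 0 x x := ⟨.nil, rfl⟩

theorem HasWalk.eq (h : H.HasWalk 0 x y) : x = y := by
  obtain ⟨p, hp⟩ := h
  exact p.eq_of_length_eq_zero hp

theorem HasWalk.of_adj (h : H.Adj x y) : H.HasWalk 1 x y := ⟨.cons h .nil, rfl⟩

theorem HasWalk.trans (h : H.HasWalk q x y) (h' : H.HasWalk r y z) : H.HasWalk (q + r) x z := by
  obtain ⟨p, rfl⟩ := h
  obtain ⟨p', rfl⟩ := h'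
  exact ⟨p.append p', by simp⟩

theorem HasWalk.symm (h : H.HasWalk q x y) : H.HasWalk q y x := by
  obtain ⟨p, rfl⟩ := h
  exact ⟨p.reverse, by simp⟩

theorem HasWalk.last (h : H.HasWalk (q + 1) x z) : ∃ y, H.HasWalk q x y ∧ H.Adj y z := by
  obtain ⟨p, hp⟩ := h.symm
  cases p with
  | nil => simp at hp
  | cons h p => exact ⟨_, ⟨p.reverse, by simpa using hp⟩, h.symm⟩

theorem HasWalk.lt_card [Fintype V] (h : H.HasWalk q x y) :
    ∃ r ≤ q, r < Fintype.card V ∧ H.HasWalk r x y := by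
  classical
  obtain ⟨p, rfl⟩ := h
  exact ⟨p.bypass.length, p.length_bypass_le_length, p.bypass_isPath.length_lt, _, rfl⟩

theorem HasWalk.mono {H' : SimpleGraph V} (h : H.HasWalk q x y) (hle : H ≤ H') :
    H'.HasWalk q x y := by
  obtain ⟨p, rfl⟩ := h
  exact ⟨p.mapLe hle, by simp⟩

theorem within_mono (G : SimpleGraph V) {X Y : Set V} (h : X ⊆ Y) : G.within X ≤ G.within Y :=
  fun _ _ h' => ⟨h'.1, h h'.2.1, h h'.2.2⟩

/-- A function on a set `S` that is closed under adjacency, whose parity changes along every edge,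
determines the parity of walks. -/
theorem HasWalk.parity {S : V → Prop} {f : V → ℕ} (hS : ∀ x y, H.Adj x y → S x → S y)
    (hf : ∀ x y, H.Adj x y → S x → S y → Odd (f x + f y)) (h : H.HasWalk q x y) (hx : S x) :
    S y ∧ Even (q + f x + f y) := by
  obtain ⟨p, rfl⟩ := h
  induction p with
  | nil => exact ⟨hx, by simp [← two_mul]⟩
  | cons h p ih =>
    obtain ⟨h1, h2⟩ := ih (hS _ _ h hx)
    have h3 := hf _ _ h hx (hS _ _ h hx)
    refine ⟨h1, ?_⟩
    simp only [Walk.length_cons]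
    grind

/-- There is no closed walk of odd length. -/
def NoOddWalk (H : SimpleGraph V) : Prop := ∀ u q, H.HasWalk q u u → Even q

/-- The vertices `c 0, …, c (2 m + 1) = c 0` form an odd cycle that is as short as any closed walk
of odd length. -/
structure ShortestOddCycle (H : SimpleGraph V) (m : ℕ) (c : ℕ → V) : Prop where
  closed : c (2 * m + 1) = c 0
  adj : ∀ x < 2 * m + 1, H.Adj (c x) (c (x + 1))
  min : ∀ u q, Odd q → H.HasWalk q u u → 2 * m + 1 ≤ q

/-- The set `C` is the vertex set of an induced odd cycle. -/
def IsInducedOddCycle (H : SimpleGraph V) (C : Set V) : Prop :=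
  ∃ g, 3 ≤ g ∧ Odd g ∧ ∃ f : cycleGraph g ↪g H, Set.range f = C

namespace ShortestOddCycle

variable {m : ℕ} {c : ℕ → V}

theorem arc (h : H.ShortestOddCycle m c) {a b : ℕ} (hab : a ≤ b) (hb : b ≤ 2 * m + 1) :
    H.HasWalk (b - a) (c a) (c b) := by
  induction b, hab using Nat.le_induction with
  | base => simpa using HasWalk.refl (c a)
  | succ b hab ih =>
    have := (ih (by omega)).trans (HasWalk.of_adj (h.adj b (by omega)))
    rwa [show b + 1 - a = b - a + 1 by omega]

/-- A walk between two vertices of a shortest odd cycle is at least as long as the arc between them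
whose length has the same parity: together with the other arc it is a closed walk of odd length. -/
theorem walk_bound (h : H.ShortestOddCycle m c) {a b q : ℕ} (hab : a ≤ b) (hb : b < 2 * m + 1)
    (hq : H.HasWalk q (c a) (c b)) :
    (Even (q + (b - a)) → b - a ≤ q) ∧ (Odd (q + (b - a)) → 2 * m + 1 - (b - a) ≤ q) := by
  constructor
  · intro he
    have h1 : H.HasWalk (2 * m + 1 - b) (c b) (c 0) := h.closed ▸ h.arc hb.le le_rfl
    have h2 : H.HasWalk a (c 0) (c a) := by simpa using h.arc (Nat.zero_le a) (by omega)
    have h3 := h.min _ _ (by grind) ((hq.trans h1).trans h2)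
    omega
  · intro ho
    have h3 := h.min _ _ ho (hq.trans (h.arc hab hb.le).symm)
    omega

theorem one_le (h : H.ShortestOddCycle m c) : 1 ≤ m := by
  rcases Nat.eq_zero_or_pos m with rfl | hm
  · have h1 := h.adj 0 (by omega)
    have h2 := h.closed
    simp only [mul_zero, zero_add] at h1 h2
    rw [h2] at h1
    exact absurd h1 (H.loopless.irrefl _)
  · exact hm

theorem inj (h : H.ShortestOddCycle m c) {a b : ℕ} (ha : a < 2 * m + 1) (hb : b < 2 * m + 1)
    (hab : c a = c b) : a = b := by
  wlog hle : a ≤ b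
  · exact (this h hb ha hab.symm (by omega)).symm
  have h1 := h.walk_bound (q := 0) hle hb (by rw [hab]; exact HasWalk.refl _)
  rcases Nat.even_or_odd (0 + (b - a)) with h2 | h2
  · have := h1.1 h2; omega
  · have := h1.2 h2; omega

theorem adj_iff (h : H.ShortestOddCycle m c) {a b : ℕ} (hab : a < b) (hb : b < 2 * m + 1) :
    H.Adj (c a) (c b) ↔ b - a = 1 ∨ b - a = 2 * m := by
  constructor
  · intro hadj
    have h1 := h.walk_bound hab.le hb (HasWalk.of_adj hadj)
    rcases Nat.even_or_odd (1 + (b - a)) with h2 | h2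
    · have := h1.1 h2; omega
    · have := h1.2 h2; omega
  · rintro (h1 | h1)
    · have := h.adj a (by omega)
      rwa [show a + 1 = b by omega] at this
    · obtain rfl : a = 0 := by omega
      have := h.adj b hb
      rw [show b + 1 = 2 * m + 1 by omega, h.closed] at this
      exact this.symm

theorem isInducedOddCycle (h : H.ShortestOddCycle m c) :
    H.IsInducedOddCycle {v | ∃ a < 2 * m + 1, v = c a} := by
  have hm := h.one_le
  refine ⟨2 * m + 1, by omega, by simp, ⟨⟨fun i => c i, fun i j hij => ?_⟩, ?_⟩, ?_⟩
  · exact Fin.ext (h.inj i.2 j.2 hij)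
  · intro i j
    change H.Adj (c i) (c j) ↔ (cycleGraph (2 * m + 1)).Adj i j
    rw [cycleGraph_adj']
    wlog hij : i < j
    · rcases lt_or_eq_of_le (not_lt.1 hij) with h1 | rfl
      · rw [H.adj_comm, or_comm]
        exact this h hm h1
      · simp
    rw [h.adj_iff hij j.2, Fin.sub_val_of_le hij.le, Fin.val_sub]
    have h1 : (i : ℕ) < j := hij
    have h2 := j.2
    rw [Nat.mod_eq_of_lt (by omega)]
    omega
  · ext v
    constructor
    · rintro ⟨i, rfl⟩
      exact ⟨i, i.2, rfl⟩
    · rintro ⟨a, ha, rfl⟩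
      exact ⟨⟨a, ha⟩, rfl⟩

end ShortestOddCycle

theorem exists_shortestOddCycle (h : ¬ H.NoOddWalk) : ∃ m c, H.ShortestOddCycle m c := by
  classical
  have h1 : ∃ q, Odd q ∧ ∃ u, H.HasWalk q u u := by
    simp only [NoOddWalk, not_forall] at h
    obtain ⟨u, q, hq, ho⟩ := h
    exact ⟨q, Nat.not_even_iff_odd.1 ho, u, hq⟩
  obtain ⟨⟨m, hm⟩, u, p, hp⟩ := Nat.find_spec h1
  refine ⟨m, p.getVert, ?_, fun x hx => p.adj_getVert_succ (by omega), fun v q hq hv => ?_⟩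
  · rw [← hm, ← hp]; simp
  · rw [← hm]; exact Nat.find_min' h1 ⟨hq, v, hv⟩

namespace IsInducedOddCycle

variable {C : Set V}

theorem exists_adj (h : H.IsInducedOddCycle C) {d : V} (hd : d ∈ C) : ∃ e ∈ C, H.Adj d e := by
  obtain ⟨g, hg, -, f, rfl⟩ := h
  obtain ⟨i, rfl⟩ := hd
  obtain ⟨g, rfl⟩ : ∃ g', g = g' + 3 := ⟨g - 3, by omega⟩
  refine ⟨f (i + 1), ⟨_, rfl⟩, f.map_adj_iff.2 ?_⟩
  rw [cycleGraph_adj]; simp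

theorem hasWalk (h : H.IsInducedOddCycle C) {d : V} (hd : d ∈ C) : ∃ q, Odd q ∧ H.HasWalk q d d := by
  obtain ⟨g, hg, ho, f, rfl⟩ := h
  obtain ⟨i, rfl⟩ := hd
  obtain ⟨g, rfl⟩ : ∃ g', g = g' + 3 := ⟨g - 3, by omega⟩
  obtain ⟨p⟩ := cycleGraph_preconnected (n := g + 3) i 0
  refine ⟨_, ?_, ((p.append (cycleGraph.cycle g)).append p.reverse).map f.toHom, rfl⟩
  simp only [Walk.length_map, Walk.length_append, Walk.length_reverse, cycleGraph.length_cycle]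
  grind

theorem nonempty (h : H.IsInducedOddCycle C) : C.Nonempty := by
  obtain ⟨g, hg, -, f, rfl⟩ := h
  exact ⟨f ⟨0, by omega⟩, _, rfl⟩

variable {G : SimpleGraph V} {X Y : Set V}

theorem subset (h : (G.within X).IsInducedOddCycle C) : C ⊆ X := fun _ hd =>
  have ⟨_, _, he⟩ := h.exists_adj hd
  he.2.1

theorem mono (h : (G.within Y).IsInducedOddCycle C) (hYX : Y ⊆ X) :
    (G.within X).IsInducedOddCycle C := by
  have hC := h.subset
  obtain ⟨g, hg, ho, f, rfl⟩ := h
  refine ⟨g, hg, ho, ⟨f.toEmbedding, fun {a b} => ?_⟩, rfl⟩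
  rw [← f.map_adj_iff]
  exact ⟨fun h => ⟨h.1, hC ⟨_, rfl⟩, hC ⟨_, rfl⟩⟩, fun h => ⟨h.1, hYX h.2.1, hYX h.2.2⟩⟩

end IsInducedOddCycle

theorem NoOddWalk.not_isInducedOddCycle (h : H.NoOddWalk) (C : Set V) :
    ¬ H.IsInducedOddCycle C := by
  intro hC
  obtain ⟨d, hd⟩ := hC.nonempty
  obtain ⟨q, hq, hw⟩ := hC.hasWalk hd
  exact Nat.not_even_iff_odd.2 hq (h _ _ hw)

theorem NoOddWalk.not_hasInducedOddCyclePacking (h : H.NoOddWalk) {j : ℕ} (hj : 1 ≤ j) :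
    ¬ H.HasInducedOddCyclePacking j := by
  rintro ⟨len, f, h1, -⟩
  exact h.not_isInducedOddCycle _ ⟨_, (h1 ⟨0, hj⟩).1, (h1 ⟨0, hj⟩).2, f ⟨0, hj⟩, rfl⟩

theorem noOddWalk_of_not_hasInducedOddCyclePacking (h : ¬ H.HasInducedOddCyclePacking 1) :
    H.NoOddWalk := by
  by_contra h1
  obtain ⟨m, c, hc⟩ := exists_shortestOddCycle h1
  obtain ⟨g, hg, ho, f, -⟩ := hc.isInducedOddCycle
  exact h ⟨fun _ => g, fun _ => f, fun _ => ⟨hg, ho⟩,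
    fun i j hij => absurd (Subsingleton.elim i j) hij⟩

/-- An induced odd cycle `C` of `G[X]` extends every packing of `G[X']` for `X' ⊆ X`, provided that
no odd cycle of `G[X']` meets `C` or is joined to it by an edge. -/
theorem HasInducedOddCyclePacking.succ {G : SimpleGraph V} {X X' C : Set V} {j : ℕ}
    (h : (G.within X').HasInducedOddCyclePacking j) (hX : X' ⊆ X)
    (hC : (G.within X).IsInducedOddCycle C)
    (hsep : ∀ D, (G.within X').IsInducedOddCycle D → ∀ d ∈ D, ∀ c ∈ C, d ≠ c ∧ ¬ G.Adj d c) :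
    (G.within X).HasInducedOddCyclePacking (j + 1) := by
  obtain ⟨len, f, h1, h2⟩ := h
  obtain ⟨g, hg, ho, f₀, rfl⟩ := hC
  have hD : ∀ i, (G.within X').IsInducedOddCycle (Set.range (f i)) :=
    fun i => ⟨_, (h1 i).1, (h1 i).2, f i, rfl⟩
  have hf : ∀ i, ∃ f' : cycleGraph (len i) ↪g G.within X, ∀ a, f' a = f i a := fun i =>
    ⟨⟨(f i).toEmbedding, fun {a b} => by
      rw [← (f i).map_adj_iff]
      exact ⟨fun h => ⟨h.1, (hD i).subset ⟨_, rfl⟩, (hD i).subset ⟨_, rfl⟩⟩,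
        fun h => ⟨h.1, hX h.2.1, hX h.2.2⟩⟩⟩, fun _ => rfl⟩
  choose f' hf' using hf
  refine ⟨Fin.cons g len, Fin.cases f₀ f', Fin.cases ⟨hg, ho⟩ h1, ?_⟩
  intro i j'
  refine Fin.cases ?_ (fun i => ?_) i <;> refine Fin.cases ?_ (fun j' => ?_) j'
  · exact fun h => absurd rfl h
  · intro _ (a : Fin g) (b : Fin (len j'))
    have h3 := hsep _ (hD j') _ ⟨b, rfl⟩ _ ⟨a, rfl⟩
    change f₀ a ≠ f' j' b ∧ ¬ (G.within X).Adj (f₀ a) (f' j' b)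
    rw [hf']
    exact ⟨h3.1.symm, fun h => h3.2 h.1.symm⟩
  · intro _ (a : Fin (len i)) (b : Fin g)
    have h3 := hsep _ (hD i) _ ⟨a, rfl⟩ _ ⟨b, rfl⟩
    change f' i a ≠ f₀ b ∧ ¬ (G.within X).Adj (f' i a) (f₀ b)
    rw [hf']
    exact ⟨h3.1, fun h => h3.2 h.1⟩
  · intro hij (a : Fin (len i)) (b : Fin (len j'))
    have h3 := h2 i j' (fun h => hij (h ▸ rfl)) a b
    change f' i a ≠ f' j' b ∧ ¬ (G.within X).Adj (f' i a) (f' j' b)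
    rw [hf', hf']
    exact ⟨h3.1, fun h => h3.2 ⟨h.1, (hD i).subset ⟨_, rfl⟩, (hD j').subset ⟨_, rfl⟩⟩⟩

theorem HasInducedOddCyclePacking.le_card [Fintype V] {j : ℕ}
    (h : H.HasInducedOddCyclePacking j) : j ≤ Fintype.card V := by
  obtain ⟨len, f, h1, h2⟩ := h
  have : Function.Injective fun i : Fin j =>
      f i ⟨0, by have := (h1 i).1; omega⟩ := by
    intro i i' h
    by_contra hne
    exact (h2 i i' hne _ _).1 h
  simpa using Fintype.card_le_of_injective _ this

theorem not_hasInducedOddCyclePacking_of_iocp_le [Fintype V] {k : ℕ} (h : H.iocp ≤ k) :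
    ¬ H.HasInducedOddCyclePacking (k + 1) := by
  intro h1
  have : k + 1 ≤ H.iocp :=
    le_csSup ⟨Fintype.card V, fun _ h => HasInducedOddCyclePacking.le_card h⟩ h1
  omega

/-! ### Breadth-first layers -/

variable {V : Type*} {H : SimpleGraph V}

/-- The function `d` is the distance from the set `S` plus one, and `0` on vertices that cannot be
reached from `S`. -/
structure IsLayering (H : SimpleGraph V) (S : Set V) (d : V → ℕ) : Prop where
  sound : ∀ u j, d u = j + 1 → ∃ x ∈ S, H.HasWalk j x u
  complete : ∀ x ∈ S, ∀ u q, H.HasWalk q x u → d u ≠ 0 ∧ d u ≤ q + 1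

namespace IsLayering

variable {S : Set V} {d : V → ℕ} {u v : V}

theorem adj_le (h : H.IsLayering S d) (hadj : H.Adj u v) (hu : d u ≠ 0) :
    d v ≠ 0 ∧ d v ≤ d u + 1 := by
  obtain ⟨j, hj⟩ := Nat.exists_eq_succ_of_ne_zero hu
  obtain ⟨x, hx, hw⟩ := h.sound u j hj
  have := h.complete x hx v _ (hw.trans (HasWalk.of_adj hadj))
  omega

theorem eq_one_of_mem (h : H.IsLayering S d) (hu : u ∈ S) : d u = 1 := by
  have := h.complete u hu u 0 (HasWalk.refl u)
  omega

theorem mem_of_eq_one (h : H.IsLayering S d) (hu : d u = 1) : u ∈ S := by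
  obtain ⟨x, hx, hw⟩ := h.sound u 0 hu
  rwa [← hw.eq]

theorem hasWalk (h : H.IsLayering {v} d) {j : ℕ} (hu : d u = j + 1) : H.HasWalk j v u := by
  obtain ⟨x, rfl, hw⟩ := h.sound u j hu
  exact hw

/-- An edge inside a layer around a single vertex closes a walk of odd length. -/
theorem closed_walk (h : H.IsLayering {v} d) {j : ℕ} {x y : V} (hx : d x = j + 1) (hy : d y = j + 1)
    (hadj : H.Adj x y) : H.HasWalk (2 * j + 1) v v := by
  have := ((h.hasWalk hx).trans (HasWalk.of_adj hadj)).trans (h.hasWalk hy).symm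
  rwa [show j + 1 + j = 2 * j + 1 by ring] at this

/-- A closed walk of odd length from `v` has an edge inside a layer around `v`, since otherwise the
parity of the distance from `v` would change in every step. -/
theorem exists_adj_same_layer (h : H.IsLayering {v} d) {q : ℕ} (hq : Odd q) (hw : H.HasWalk q v v) :
    ∃ j x y, 2 * j + 1 ≤ q ∧ H.Adj x y ∧ d x = j + 1 ∧ d y = j + 1 := by
  by_contra hno
  push Not at hno
  -- `x` is a vertex of the walk, `r` and `p.length` are the distances along it to its two ends;
  -- the shorter of the two parts shows that an edge inside the layer of `x` would be close enough
  -- to `v`.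
  suffices key : ∀ {x y : V} (p : H.Walk x y), y = v → ∀ r, H.HasWalk r v x → r + p.length = q →
      Even (d x + 1 + r) → Even (d v + 1 + q) by
    obtain ⟨p, hp⟩ := hw
    have hv := h.eq_one_of_mem (u := v) rfl
    have := key p rfl 0 (HasWalk.refl v) (by omega) (by rw [hv]; decide)
    rw [hv] at this
    grind
  intro x y p
  induction p with
  | nil =>
    rintro rfl r - hr he
    simpa [← hr] using he
  | @cons x z y hadj p ih =>
    rintro rfl r hr hlen he
    rw [Walk.length_cons] at hlen
    have hz := hr.trans (HasWalk.of_adj hadj)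
    refine ih rfl (r + 1) hz (by omega) ?_
    have h1 := h.complete _ rfl x _ hr
    have h2 := h.complete _ rfl z _ (HasWalk.symm ⟨p, rfl⟩)
    have h3 := h.adj_le hadj h1.1
    have h4 := h.adj_le hadj.symm h2.1
    have h5 : d x ≠ d z := by
      intro h5
      exact hno (d x - 1) x z (by omega) hadj (by omega) (by omega)
    grind

/-- Two shortest paths to the ends of an edge inside a layer form a shortest odd cycle, provided
that there are no shorter closed walks of odd length. -/
theorem shortestOddCycle (h : H.IsLayering {v} d) {m : ℕ} {p p' : ℕ → V}
    (hp : ∀ j ≤ m, d (p j) = m + 1 - j) (hp' : ∀ j ≤ m, d (p' j) = m + 1 - j)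
    (ha : ∀ j < m, H.Adj (p j) (p (j + 1))) (ha' : ∀ j < m, H.Adj (p' j) (p' (j + 1)))
    (h0 : H.Adj (p 0) (p' 0)) (hmin : ∀ u q, Odd q → H.HasWalk q u u → 2 * m + 1 ≤ q) :
    ∃ c, H.ShortestOddCycle m c ∧ c 0 = v ∧
      ∀ u, (∃ a < 2 * m + 1, u = c a) ↔ ∃ j ≤ m, u = p j ∨ u = p' j := by
  have hv : p m = v := h.mem_of_eq_one (by rw [hp m le_rfl]; omega)
  have hv' : p' m = v := h.mem_of_eq_one (by rw [hp' m le_rfl]; omega)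
  -- Down the first path from `v`, across the edge, and back to `v` along the second path.
  refine ⟨fun x => if x ≤ m then p (m - x) else p' (x - (m + 1)), ⟨?_, fun x hx => ?_, hmin⟩, ?_,
    fun u => ⟨?_, ?_⟩⟩
  · simp only [Nat.zero_le, if_true]
    rw [if_neg (by omega), show 2 * m + 1 - (m + 1) = m by omega, Nat.sub_zero, hv, hv']
  · rcases lt_trichotomy x m with h1 | rfl | h1
    · rw [if_pos (by omega), if_pos (by omega)]
      have := ha (m - (x + 1)) (by omega)
      rw [show m - (x + 1) + 1 = m - x by omega] at this
      exact this.symm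
    · simpa using h0
    · rw [if_neg (by omega), if_neg (by omega)]
      have := ha' (x - (m + 1)) (by omega)
      rwa [show x - (m + 1) + 1 = x + 1 - (m + 1) by omega] at this
  · simpa using hv
  · rintro ⟨a, ha, rfl⟩
    simp only
    split_ifs
    · exact ⟨m - a, by omega, Or.inl rfl⟩
    · exact ⟨a - (m + 1), by omega, Or.inr rfl⟩
  · rintro ⟨j, hj, rfl | rfl⟩
    · exact ⟨m - j, by omega, by
        beta_reduce; rw [if_pos (by omega), show m - (m - j) = j by omega]⟩
    · rcases hj.eq_or_lt with rfl | hj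
      · exact ⟨0, by omega, by simp [hv, hv']⟩
      · exact ⟨j + m + 1, by omega, by
          beta_reduce; rw [if_neg (by omega), show j + m + 1 - (m + 1) = j by omega]⟩

end IsLayering

variable {G : SimpleGraph V}

/-- Let `c` be a shortest odd cycle of `G[Y]` with more than `4 R` vertices. If the vertices at
distance `i ≤ R` from the cycle and those at distance `R + i` from `c 0` are deleted, then the
vertices that are close to the cycle induce a bipartite graph that is separated from the rest: those
close to `c 0` are coloured by the parity of their distance from `c 0`, the others by projecting
them to the cycle, of which only a path is left. Hence the remaining odd cycles are far from the
cycle `c`. -/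
theorem ShortestOddCycle.separated {Y X' : Set V} {m i R : ℕ} {c : ℕ → V} {dC dv : V → ℕ}
    (hc : (G.within Y).ShortestOddCycle m c)
    (hC : (G.within Y).IsLayering {v | ∃ a < 2 * m + 1, v = c a} dC)
    (hv : (G.within Y).IsLayering {c 0} dv) (hi : 1 ≤ i) (hiR : i ≤ R) (hR : 2 * R ≤ m)
    (hX : X' ⊆ Y) (hX' : ∀ u ∈ X', dC u ≠ i + 1 ∧ dv u ≠ R + i + 1) {D : Set V}
    (hD : (G.within X').IsInducedOddCycle D) {d e : V} (hd : d ∈ D)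
    (he : ∃ a < 2 * m + 1, e = c a) : d ≠ e ∧ ¬ G.Adj d e := by
  have hle : ∀ x y, (G.within X').Adj x y → (G.within Y).Adj x y :=
    fun x y h => ⟨h.1, hX h.2.1, hX h.2.2⟩
  have hdX : d ∈ X' := hD.subset hd
  obtain ⟨q, hq, hw⟩ := hD.hasWalk hd
  -- The vertices inside of the deleted layer around the cycle; no edge leaves this set.
  let near : V → Prop := fun u => dC u ≠ 0 ∧ dC u < i + 1
  have hnear : ∀ x y, (G.within X').Adj x y → near x → near y := by
    intro x y hxy hx
    have h1 := hC.adj_le (hle x y hxy) hx.1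
    have h2 := hX' y hxy.2.2
    have h3 := hx.2
    exact ⟨h1.1, by omega⟩
  have hfar : ¬ near d := by
    intro hn
    refine Nat.not_even_iff_odd.2 hq ?_
    by_cases hdv : dv d ≠ 0 ∧ dv d < R + i + 1
    -- Close to `c 0`, the parity of the distance from `c 0` is a proper colouring, since an edge
    -- inside a layer would close an odd walk that is shorter than the cycle `c`.
    · have h := hw.parity (S := fun u => near u ∧ dv u ≠ 0 ∧ dv u < R + i + 1) (f := dv) ?_ ?_
        ⟨hn, hdv⟩
      · grind
      · rintro x y hxy ⟨h1, h2, h3⟩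
        have h4 := hv.adj_le (hle x y hxy) h2
        have h5 := hX' y hxy.2.2
        exact ⟨hnear x y hxy h1, h4.1, by omega⟩
      · rintro x y hxy ⟨-, h2, h3⟩ ⟨-, h4, h5⟩
        have h6 := hv.adj_le (hle x y hxy) h2
        have h7 := hv.adj_le (hle x y hxy).symm h4
        have h8 : dv x ≠ dv y := by
          intro h8
          have := hc.min _ _ (by simp) (hv.closed_walk (j := dv x - 1) (by omega) (by omega)
            (hle x y hxy))
          omega
        grind
    -- Far from `c 0`, a vertex `u` is projected to a nearest vertex `c (a u)` of the cycle. It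
    -- is far from `c 0` on both arcs, so the projections of adjacent vertices are joined by a short
    -- walk that must be consistent with the arc avoiding `c 0`; hence `a u` plus the distance from
    -- the cycle changes its parity along every edge.
    · have hproj : ∀ u, ∃ a, near u → a < 2 * m + 1 ∧ (G.within Y).HasWalk (dC u - 1) (c a) u := by
        intro u
        by_cases hu : near u
        · obtain ⟨x, ⟨a, ha, rfl⟩, hx⟩ := hC.sound u (dC u - 1) (by have := hu.1; omega)
          exact ⟨a, fun _ => ⟨ha, hx⟩⟩
        · exact ⟨0, fun h => absurd h hu⟩
      choose a ha using hproj
      have hlong : ∀ u, near u → ¬ (dv u ≠ 0 ∧ dv u < R + i + 1) → dv u ≠ R + i + 1 →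
          R + 2 ≤ a u ∧ a u + R + 2 ≤ 2 * m + 1 := by
        intro u hu h1 h2
        obtain ⟨h3, h4⟩ := ha u hu
        have h5 : (G.within Y).HasWalk (a u) (c 0) (c (a u)) := by
          simpa using hc.arc (Nat.zero_le (a u)) h3.le
        have h6 : (G.within Y).HasWalk (2 * m + 1 - a u) (c 0) (c (a u)) := by
          simpa [hc.closed] using (hc.arc h3.le le_rfl).symm
        have h7 := hv.complete _ rfl _ _ (h5.trans h4)
        have h8 := hv.complete _ rfl _ _ (h6.trans h4)
        have h9 := hu.1
        have h10 := hu.2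
        omega
      have h := hw.parity (S := fun u => u ∈ X' ∧ near u ∧ ¬ (dv u ≠ 0 ∧ dv u < R + i + 1))
        (f := fun u => a u + (dC u - 1)) ?_ ?_ ⟨hdX, hn, hdv⟩
      · grind
      · rintro x y hxy ⟨-, h1, h2⟩
        refine ⟨hxy.2.2, hnear x y hxy h1, fun h3 => h2 ?_⟩
        have h4 := hv.adj_le (hle x y hxy).symm h3.1
        have h5 := hX' x hxy.2.1
        exact ⟨h4.1, by omega⟩
      · rintro x y hxy ⟨hx1, hx2, hx3⟩ ⟨hy1, hy2, hy3⟩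
        have hx4 := hlong x hx2 hx3 (hX' x hx1).2
        have hy4 := hlong y hy2 hy3 (hX' y hy1).2
        obtain ⟨hx5, hx6⟩ := ha x hx2
        obtain ⟨hy5, hy6⟩ := ha y hy2
        have hx7 := hx2.1
        have hx8 := hx2.2
        have hy7 := hy2.1
        have hy8 := hy2.2
        have hwalk := (hx6.trans (HasWalk.of_adj (hle x y hxy))).trans hy6.symm
        rcases le_total (a x) (a y) with hle' | hle'
        · have hb := hc.walk_bound hle' hy5 hwalk
          rcases Nat.even_or_odd (dC x - 1 + 1 + (dC y - 1) + (a y - a x)) with h9 | h9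
          · grind
          · have := hb.2 h9; omega
        · have hb := hc.walk_bound hle' hx5 hwalk.symm
          rcases Nat.even_or_odd (dC x - 1 + 1 + (dC y - 1) + (a x - a y)) with h9 | h9
          · grind
          · have := hb.2 h9; omega
  refine ⟨?_, fun hadj => ?_⟩
  · rintro rfl
    have := hC.eq_one_of_mem he
    exact hfar ⟨by omega, by omega⟩
  · have h1 := hC.eq_one_of_mem he
    obtain ⟨a, ha, rfl⟩ := he
    have hadj' : (G.within Y).Adj (c a) d := ⟨hadj.symm, (hc.adj a ha).2.1, hX hdX⟩
    have h2 := hC.adj_le hadj' (by omega)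
    have h3 := hX' d hdX
    exact hfar ⟨h2.1, by omega⟩

end SimpleGraph

namespace WordRAM

/-! ### Reasoning about array programs -/

namespace AExpr

/-- Conjunction. -/
def and (e f : AExpr) : AExpr := .ite e f (.c 0)
/-- Disjunction. -/
def or (e f : AExpr) : AExpr := .ite e (.c 1) f
/-- Negation. -/
def not (e : AExpr) : AExpr := .ite e (.c 0) (.c 1)
/-- Equality test. -/
def eq (e f : AExpr) : AExpr := .bin .eq e f
/-- Comparison. -/
def lt (e f : AExpr) : AExpr := .bin .lt e f
/-- The indicator of a condition. -/
def ind (e : AExpr) : AExpr := .ite e (.c 1) (.c 0)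

variable {n : ℕ}

/-- The expression is true, that is, nonzero. -/
def Holds (G : SimpleGraph (Fin n)) (π : ℕ → ℕ) (e : AExpr) (σ : Store n) : Prop := e.ev G π σ ≠ 0

variable {G : SimpleGraph (Fin n)} {π : ℕ → ℕ} {σ : Store n} {e f g : AExpr}

@[simp] theorem holds_and : (e.and f).Holds G π σ ↔ e.Holds G π σ ∧ f.Holds G π σ := by
  by_cases h : e.ev G π σ = 0 <;> simp [Holds, and, ev, h]
@[simp] theorem holds_or : (e.or f).Holds G π σ ↔ e.Holds G π σ ∨ f.Holds G π σ := by
  by_cases h : e.ev G π σ = 0 <;> simp [Holds, or, ev, h]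
@[simp] theorem holds_not : e.not.Holds G π σ ↔ ¬ e.Holds G π σ := by
  by_cases h : e.ev G π σ = 0 <;> simp [Holds, not, ev, h]
@[simp] theorem holds_eq : (e.eq f).Holds G π σ ↔ e.ev G π σ = f.ev G π σ := by
  by_cases h : e.ev G π σ = f.ev G π σ <;> simp [Holds, eq, ev, BOp.eval, h]
@[simp] theorem holds_lt : (e.lt f).Holds G π σ ↔ e.ev G π σ < f.ev G π σ := by
  by_cases h : e.ev G π σ < f.ev G π σ <;> simp [Holds, lt, ev, BOp.eval, h]
@[simp] theorem holds_adj {x y : ℕ} : (adj x y).Holds G π σ ↔ G.Adj (σ.i x) (σ.i y) := by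
  simp [Holds, ev]
@[simp] theorem holds_cnt {x : ℕ} :
    (cnt x e).Holds G π σ ↔ ∃ u, e.Holds G π (σ.setI x u) := by
  simp [Holds, ev, Finset.filter_eq_empty_iff]
@[simp] theorem holds_v {x : ℕ} : (v x).Holds G π σ ↔ σ.v x ≠ 0 := Iff.rfl
@[simp] theorem holds_get {j : Fin 16} {x : ℕ} :
    (get j x).Holds G π σ ↔ σ.a j (σ.i x) ≠ 0 := Iff.rfl

open Classical in
@[simp] theorem ev_ite :
    (ite e f g).ev G π σ = if e.Holds G π σ then f.ev G π σ else g.ev G π σ := by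
  by_cases h : e.ev G π σ = 0 <;> simp [Holds, ev, h]
open Classical in
@[simp] theorem ev_ind : (ind e).ev G π σ = if e.Holds G π σ then 1 else 0 := by
  rw [ind, ev_ite]; rfl
theorem holds_ite : (ite e f g).Holds G π σ ↔
    (e.Holds G π σ ∧ f.Holds G π σ) ∨ (¬ e.Holds G π σ ∧ g.Holds G π σ) := by
  by_cases h : e.ev G π σ = 0 <;> simp [Holds, ev, h]
@[simp] theorem ev_c {k : ℕ} : (c k).ev G π σ = k := rfl
@[simp] theorem ev_p {b : ℕ} : (p b).ev G π σ = π b := rfl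
@[simp] theorem ev_v {x : ℕ} : (v x).ev G π σ = σ.v x := rfl
@[simp] theorem ev_val {x : ℕ} : (val x).ev G π σ = σ.i x := rfl
@[simp] theorem ev_get {j : Fin 16} {x : ℕ} : (get j x).ev G π σ = σ.a j (σ.i x) := rfl
@[simp] theorem ev_succ : (succ e).ev G π σ = e.ev G π σ + 1 := rfl
@[simp] theorem ev_sub : (bin .sub e f).ev G π σ = e.ev G π σ - f.ev G π σ := rfl
@[simp] theorem ev_div : (bin .div e f).ev G π σ = e.ev G π σ / f.ev G π σ := rfl
@[simp] theorem ev_mod : (bin .mod e f).ev G π σ = e.ev G π σ % f.ev G π σ := rfl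
open Classical in
theorem ev_cnt {x : ℕ} : (cnt x e).ev G π σ =
    (Finset.univ.filter fun u => e.Holds G π (σ.setI x u)).card := by
  simp only [ev, Holds]; congr

end AExpr

namespace AProg

/-- The scalar variable `y` may be changed by the program. -/
def writesV : AProg → ℕ → Bool
  | .assign x _, y | .draw x _, y => x == y
  | .seq p q, y | .ite _ p q, y => p.writesV y || q.writesV y
  | .loop x _ p, y => x == y || p.writesV y
  | .loopV _ p, y => p.writesV y
  | _, _ => false

/-- The vertex variable `y` may be changed by the program. -/
def writesI : AProg → ℕ → Bool
  | .pick x _, y => x == y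
  | .seq p q, y | .ite _ p q, y => p.writesI y || q.writesI y
  | .loop _ _ p, y => p.writesI y
  | .loopV x p, y => x == y || p.writesI y
  | _, _ => false

/-- The array `j` may be changed by the program. -/
def writesA : AProg → Fin 16 → Bool
  | .par i _ _, j => i == j
  | .seq p q, j | .ite _ p q, j => p.writesA j || q.writesA j
  | .loop _ _ p, j | .loopV _ p, j => p.writesA j
  | _, _ => false

variable {n : ℕ} [NeZero n] {G : SimpleGraph (Fin n)} {π R : ℕ → ℕ} {σ : Store n}

theorem run_v {p : AProg} {y : ℕ} (h : p.writesV y = false) :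
    (p.run G π R σ).v y = σ.v y := by
  induction p generalizing σ with
  | skip | par | pick => rfl
  | assign x e | draw x e => simp_all [writesV, run, Ne.symm]
  | seq p q ihp ihq => simp_all [writesV, run]
  | ite e p q ihp ihq => simp only [run]; split_ifs <;> simp_all [writesV]
  | loop x b p ih =>
    simp only [writesV, Bool.or_eq_false_iff, beq_eq_false_iff_ne] at h
    refine iter_inv (fun _ (σ' : Store n) => σ'.v y = σ.v y) rfl fun i _ σ' h' => ?_
    rw [ih h.2, Store.setV_v, if_neg (Ne.symm h.1), h']
  | loopV x p ih =>
    exact iterV_inv (fun _ (σ' : Store n) => σ'.v y = σ.v y) rfl fun i σ' h' => by rw [ih h]; exact h'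

theorem run_i {p : AProg} {y : ℕ} (h : p.writesI y = false) :
    (p.run G π R σ).i y = σ.i y := by
  induction p generalizing σ with
  | skip | par | assign | draw => rfl
  | pick x e => simp_all [writesI, run, Ne.symm]
  | seq p q ihp ihq => simp_all [writesI, run]
  | ite e p q ihp ihq => simp only [run]; split_ifs <;> simp_all [writesI]
  | loopV x p ih =>
    simp only [writesI, Bool.or_eq_false_iff, beq_eq_false_iff_ne] at h
    refine iterV_inv (fun _ (σ' : Store n) => σ'.i y = σ.i y) rfl fun i σ' h' => ?_
    rw [ih h.2, Store.setI_i, if_neg (Ne.symm h.1), h']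
  | loop x b p ih =>
    exact iter_inv (fun _ (σ' : Store n) => σ'.i y = σ.i y) rfl fun i _ σ' h' => by rw [ih h]; exact h'

theorem run_a {p : AProg} {j : Fin 16} (h : p.writesA j = false) :
    (p.run G π R σ).a j = σ.a j := by
  induction p generalizing σ with
  | skip | pick | assign | draw => rfl
  | par x e => simp_all [writesA, run, Ne.symm]
  | seq p q ihp ihq => simp_all [writesA, run]
  | ite e p q ihp ihq => simp only [run]; split_ifs <;> simp_all [writesA]
  | loopV x p ih =>
    exact iterV_inv (fun _ (σ' : Store n) => σ'.a j = σ.a j) rfl fun i σ' h' => by rw [ih h]; exact h'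
  | loop x b p ih =>
    exact iter_inv (fun _ (σ' : Store n) => σ'.a j = σ.a j) rfl fun i _ σ' h' => by rw [ih h]; exact h'

end AProg

/-! ### Non-interference -/

/-- A set of scalar variables, vertex variables and arrays. -/
structure Footprint where
  V : ℕ → Bool
  I : ℕ → Bool
  A : Fin 16 → Bool

/-- The states agree on the variables and arrays in `S`. -/
structure Agree {n : ℕ} (S : Footprint) (σ σ' : Store n) : Prop where
  v : ∀ x, S.V x = true → σ.v x = σ'.v x
  i : ∀ x, S.I x = true → σ.i x = σ'.i x
  a : ∀ j, S.A j = true → σ.a j = σ'.a j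

/-- The expression mentions only variables and arrays in `S`. -/
def AExpr.reads (S : Footprint) : AExpr → Bool
  | .c _ | .p _ => true
  | .v x => S.V x
  | .val x => S.I x
  | .get j x => S.A j && S.I x
  | .adj x y => S.I x && S.I y
  | .succ e | .cnt _ e => e.reads S
  | .bin _ e f => e.reads S && f.reads S
  | .ite e f g => e.reads S && f.reads S && g.reads S

/-- The program reads only variables and arrays in `S`, and no random numbers. -/
def AProg.reads (S : Footprint) : AProg → Bool
  | .skip => true
  | .assign _ e | .par _ _ e | .pick _ e => e.reads S
  | .draw _ _ => false
  | .seq p q => p.reads S && q.reads S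
  | .ite e p q => e.reads S && p.reads S && q.reads S
  | .loop _ _ p | .loopV _ p => p.reads S

section

variable {n : ℕ} {G : SimpleGraph (Fin n)} {π R R' : ℕ → ℕ} {σ σ' : Store n} {S : Footprint}

theorem Agree.setV (h : Agree S σ σ') (x k : ℕ) : Agree S (σ.setV x k) (σ'.setV x k) :=
  ⟨fun y hy => by simp only [Store.setV_v]; split_ifs; exacts [rfl, h.v y hy], h.i, h.a⟩

theorem Agree.setI (h : Agree S σ σ') (x : ℕ) (u : Fin n) : Agree S (σ.setI x u) (σ'.setI x u) :=
  ⟨h.v, fun y hy => by simp only [Store.setI_i]; split_ifs; exacts [rfl, h.i y hy], h.a⟩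

theorem Agree.setA (h : Agree S σ σ') (j : Fin 16) (f : Fin n → ℕ) :
    Agree S (σ.setA j f) (σ'.setA j f) :=
  ⟨h.v, h.i, fun j' hj => by simp only [Store.setA_a]; split_ifs; exacts [rfl, h.a j' hj]⟩

theorem AExpr.ev_congr {e : AExpr} (he : e.reads S = true) (h : Agree S σ σ') :
    e.ev G π σ = e.ev G π σ' := by
  induction e generalizing σ σ' with
  | c | p => rfl
  | v x => exact h.v x he
  | val x => rw [ev, ev, h.i x he]
  | get j x =>
    simp only [reads, Bool.and_eq_true] at he
    rw [ev, ev, h.a j he.1, h.i x he.2]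
  | adj x y =>
    simp only [reads, Bool.and_eq_true] at he
    rw [ev, ev, h.i x he.1, h.i y he.2]
  | succ e ih => rw [ev, ev, ih he h]
  | bin o e f ihe ihf =>
    simp only [reads, Bool.and_eq_true] at he
    rw [ev, ev, ihe he.1 h, ihf he.2 h]
  | ite e f g ihe ihf ihg =>
    simp only [reads, Bool.and_eq_true] at he
    rw [ev, ev, ihe he.1.1 h, ihf he.1.2 h, ihg he.2 h]
  | cnt x e ih =>
    simp only [ev]
    congr 1
    ext u
    simp only [Finset.mem_filter, Finset.mem_univ, true_and]
    rw [ih he (h.setI x u)]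

theorem Agree.iter {f f' : ℕ → Store n → Store n} (h : Agree S σ σ')
    (hf : ∀ i σ σ', Agree S σ σ' → Agree S (f i σ) (f' i σ')) (N : ℕ) :
    Agree S (iter f N σ) (iter f' N σ') := by
  induction N with
  | zero => exact h
  | succ N ih => exact hf _ _ _ ih

/-- The result of a program on `S` depends only on the initial state on `S`, if the program reads
nothing else. -/
theorem AProg.run_agree [NeZero n] {p : AProg} (hp : p.reads S = true) (h : Agree S σ σ') :
    Agree S (p.run G π R σ) (p.run G π R' σ') := by
  induction p generalizing σ σ' with
  | skip => exact h
  | assign x e => simp only [run]; rw [AExpr.ev_congr hp h]; exact h.setV x _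
  | par j x e =>
    have : (fun u => e.ev G π (σ.setI x u)) = fun u => e.ev G π (σ'.setI x u) :=
      funext fun u => AExpr.ev_congr hp (h.setI x u)
    simp only [run]; rw [this]; exact h.setA j _
  | pick x e =>
    have : (fun u => e.ev G π (σ.setI x u) ≠ 0) = fun u => e.ev G π (σ'.setI x u) ≠ 0 :=
      funext fun u => by rw [AExpr.ev_congr hp (h.setI x u)]
    simp only [run]; rw [this]; exact h.setI x _
  | draw x y => simp [reads] at hp
  | seq p q ihp ihq =>
    simp only [reads, Bool.and_eq_true] at hp
    exact ihq hp.2 (ihp hp.1 h)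
  | ite e p q ihp ihq =>
    simp only [reads, Bool.and_eq_true] at hp
    simp only [run]
    rw [AExpr.ev_congr hp.1.1 h]
    split_ifs
    · exact ihp hp.1.2 h
    · exact ihq hp.2 h
  | loop x b p ih => exact h.iter (fun i σ σ' h' => ih hp (h'.setV x i)) _
  | loopV x p ih =>
    refine h.iter (fun i σ σ' h' => ?_) _
    split_ifs
    · exact ih hp (h'.setI x _)
    · exact h'

end

section

variable {n : ℕ} [NeZero n] {G : SimpleGraph (Fin n)} {π R : ℕ → ℕ} {σ : Store n}

namespace AProg

@[simp] theorem run_skip : AProg.skip.run G π R σ = σ := rfl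
@[simp] theorem run_assign {x : ℕ} {e : AExpr} :
    (assign x e).run G π R σ = σ.setV x (e.ev G π σ) := rfl
@[simp] theorem run_par {j : Fin 16} {x : ℕ} {e : AExpr} :
    (par j x e).run G π R σ = σ.setA j fun u => e.ev G π (σ.setI x u) := rfl
@[simp] theorem run_pick {x : ℕ} {e : AExpr} :
    (pick x e).run G π R σ = σ.setI x (select fun u => e.Holds G π (σ.setI x u)) := rfl
@[simp] theorem run_seq {p q : AProg} :
    (seq p q).run G π R σ = q.run G π R (p.run G π R σ) := rfl
open Classical in
@[simp] theorem run_ite {e : AExpr} {p q : AProg} : (ite e p q).run G π R σ =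
    if e.Holds G π σ then p.run G π R σ else q.run G π R σ := by
  by_cases h : e.ev G π σ = 0 <;> simp [AExpr.Holds, run, h]

theorem run_loop_inv {x b : ℕ} {p : AProg} (I : ℕ → Store n → Prop) (h0 : I 0 σ)
    (hs : ∀ i < π b, ∀ σ, I i σ → I (i + 1) (p.run G π R (σ.setV x i))) :
    I (π b) ((loop x b p).run G π R σ) := iter_inv I h0 hs

theorem run_loopV_inv {x : ℕ} {p : AProg} (I : ℕ → Store n → Prop) (h0 : I 0 σ)
    (hs : ∀ u : Fin n, ∀ σ, I u σ → I (u + 1) (p.run G π R (σ.setI x u))) :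
    I n ((loopV x p).run G π R σ) := iterV_inv I h0 hs

end AProg

@[simp] theorem select_eq (u : Fin n) : (select fun v => v = u) = u :=
  select_spec (P := fun v => v = u) ⟨u, rfl⟩

@[simp] theorem select_val_eq (u : Fin n) : (select fun v : Fin n => (v : ℕ) = u) = u :=
  Fin.ext (select_spec (P := fun v : Fin n => (v : ℕ) = u) ⟨u, rfl⟩)

/-- The set of vertices with nonzero entry in the array `j`. -/
def Store.set (σ : Store n) (j : Fin 16) : Set (Fin n) := {u | σ.a j u ≠ 0}

/-! ### Breadth-first search -/

open AExpr AProg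

/-- Breadth-first search in the subgraph induced by the array `y`: if the array `d` is `1` on the
sources and `0` elsewhere, then `d` becomes the distance from the sources plus one. -/
def bfs (d y : Fin 16) : AProg :=
  .loop 0 0 <| .par d 4 <| .ite (get d 4) (get d 4) <|
    .ite ((get y 4).and (cnt 5 (((get d 5).eq (succ (v 0))).and (adj 5 4)))) (succ (succ (v 0))) (c 0)

theorem _root_.SimpleGraph.IsLayering.mem {V : Type*} {G : SimpleGraph V} {Y S : Set V} {d : V → ℕ}
    (h : (G.within Y).IsLayering S d) (hS : S ⊆ Y) {u : V} (hu : d u ≠ 0) : u ∈ Y := by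
  obtain ⟨j, hj⟩ := Nat.exists_eq_succ_of_ne_zero hu
  obtain ⟨x, hx, hw⟩ := h.sound u j hj
  cases j with
  | zero => rw [← hw.eq]; exact hS hx
  | succ j =>
    obtain ⟨y, -, hy⟩ := hw.last
    exact hy.2.2

open Classical in
theorem bfs_spec {d y : Fin 16} (hdy : d ≠ y) (h0 : π 0 = n) {S : Set (Fin n)} (hS : S ⊆ σ.set y)
    (hd : ∀ u, (σ.a d u = 1 ∧ u ∈ S) ∨ (σ.a d u = 0 ∧ u ∉ S)) :
    (G.within (σ.set y)).IsLayering S (((bfs d y).run G π R σ).a d) := by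
  let H := G.within (σ.set y)
  -- After `i` rounds the array is correct on the vertices at distance at most `i`.
  let I : ℕ → Store n → Prop := fun i σ' => σ'.a y = σ.a y ∧
    (∀ u j, σ'.a d u = j + 1 → j ≤ i ∧ u ∈ σ.set y ∧ ∃ x ∈ S, H.HasWalk j x u) ∧
    (∀ x ∈ S, ∀ u q, H.HasWalk q x u → q ≤ i → σ'.a d u ≠ 0 ∧ σ'.a d u ≤ q + 1)
  have key : I (π 0) ((bfs d y).run G π R σ) := by
    refine run_loop_inv I ⟨rfl, fun u j hj => ?_, fun x hx u q hq hq0 => ?_⟩ ?_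
    · rcases hd u with ⟨h1, h2⟩ | ⟨h1, h2⟩
      · obtain rfl : j = 0 := by omega
        exact ⟨le_rfl, hS h2, u, h2, SimpleGraph.HasWalk.refl u⟩
      · omega
    · obtain rfl : q = 0 := by omega
      obtain rfl := hq.eq
      rcases hd x with ⟨h1, h2⟩ | ⟨h1, h2⟩
      · omega
      · exact absurd hx h2
    · rintro i - σ' ⟨h1, h2, h3⟩
      have hrow : ∀ u, ((AProg.par d 4 (AExpr.ite (get d 4) (get d 4)
          (AExpr.ite ((get y 4).and (cnt 5 (((get d 5).eq (succ (v 0))).and (adj 5 4))))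
            (succ (succ (v 0))) (c 0)))).run G π R (σ'.setV 0 i)).a d u =
          if σ'.a d u ≠ 0 then σ'.a d u else
            if σ.a y u ≠ 0 ∧ ∃ w, σ'.a d w = i + 1 ∧ G.Adj w u then i + 2 else 0 := by
        intro u; simp [h1]
      refine ⟨by simp [Ne.symm hdy, h1], fun u j hj => ?_, fun x hx u q hq hqi => ?_⟩
      · rw [hrow] at hj
        split_ifs at hj with h4 h5
        · obtain ⟨h6, h7⟩ := h2 u j hj
          exact ⟨by omega, h7⟩
        · obtain ⟨hu, w, hw, hadj⟩ := h5
          obtain ⟨h6, h7, x, hx, h8⟩ := h2 w i hw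
          obtain rfl : j = i + 1 := by omega
          exact ⟨le_rfl, hu, x, hx, h8.trans (SimpleGraph.HasWalk.of_adj ⟨hadj, h7, hu⟩)⟩
      · rw [hrow]
        rcases Nat.lt_or_ge i q with hlt | hle
        · obtain rfl : q = i + 1 := by omega
          obtain ⟨w, hw, hadj⟩ := hq.last
          obtain ⟨h4, h5⟩ := h3 x hx w i hw le_rfl
          by_cases h6 : σ'.a d w = i + 1
          · by_cases h7 : σ'.a d u = 0
            · rw [if_neg (by simpa using h7), if_pos ⟨hadj.2.2, w, h6, hadj.1⟩]
              omega
            · rw [if_pos h7]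
              obtain ⟨j, hj⟩ := Nat.exists_eq_succ_of_ne_zero h7
              have := (h2 u j hj).1
              omega
          · obtain ⟨j, hj⟩ := Nat.exists_eq_succ_of_ne_zero h4
            obtain ⟨-, -, x', hx', h8⟩ := h2 w j hj
            obtain ⟨h9, h10⟩ := h3 x' hx' u (j + 1) (h8.trans (SimpleGraph.HasWalk.of_adj hadj))
              (by omega)
            rw [if_pos h9]
            omega
        · obtain ⟨h4, h5⟩ := h3 x hx u q hq hle
          rw [if_pos h4]
          exact ⟨h4, h5⟩
  obtain ⟨-, h2, h3⟩ := key
  refine ⟨fun u j hj => (h2 u j hj).2.2, fun x hx u q hq => ?_⟩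
  -- All distances are less than `n`, so that `n` rounds suffice.
  obtain ⟨r, hr, hrn, hw⟩ := hq.lt_card
  rw [Fintype.card_fin] at hrn
  obtain ⟨h4, h5⟩ := h3 x hx u r hw (by omega)
  exact ⟨h4, by omega⟩

/-! ### Finding a shortest odd cycle -/

/-- For each vertex, breadth-first search in the subgraph induced by the array `2`; the scalar `1`
becomes the least `m + 1` such that the layer at distance `m` around some vertex contains an edge,
the vertex variable `1` such a vertex. -/
def search : AProg :=
  .seq (.assign 1 (c 0)) <| .loopV 0 <|
    .seq (.par 3 4 (((val 4).eq (val 0)).and (get 2 4)).ind) <| .seq (bfs 3 2) <|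
    .loop 2 0 <|
    .ite ((((v 1).eq (c 0)).or ((succ (v 2)).lt (v 1))).and
        (cnt 2 (((get 3 2).eq (succ (v 2))).and
          (cnt 3 (((get 3 3).eq (succ (v 2))).and (adj 2 3))))))
      (.seq (.assign 1 (succ (v 2))) (.pick 1 ((val 1).eq (val 0)))) .skip

/-- If `search` leaves `m + 1` in the scalar `1`, then there is a closed walk of length `2 m + 1`,
and no closed walk of odd length is shorter. -/
theorem search_spec (h0 : π 0 = n) :
    let σ' := search.run G π R σ
    let H := G.within (σ.set 2)
    (∀ m, σ'.v 1 = m + 1 → σ'.i 1 ∈ σ.set 2 ∧ ∃ d x y, H.IsLayering {σ'.i 1} d ∧ H.Adj x y ∧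
      d x = m + 1 ∧ d y = m + 1) ∧
    ∀ w q, Odd q → H.HasWalk q w w → σ'.v 1 ≠ 0 ∧ 2 * σ'.v 1 ≤ q + 1 := by
  intro σ' H
  let Good : Store n → Prop := fun σ' => ∀ m, σ'.v 1 = m + 1 → σ'.i 1 ∈ σ.set 2 ∧
    ∃ d x y, H.IsLayering {σ'.i 1} d ∧ H.Adj x y ∧ d x = m + 1 ∧ d y = m + 1
  let Min : Fin n → Store n → Prop := fun w σ' => ∀ q, Odd q → H.HasWalk q w w →
    σ'.v 1 ≠ 0 ∧ 2 * σ'.v 1 ≤ q + 1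
  let I : ℕ → Store n → Prop := fun i σ' => σ'.a 2 = σ.a 2 ∧ Good σ' ∧
    ∀ w : Fin n, (w : ℕ) < i → Min w σ'
  have key : I n σ' := by
    refine run_loopV_inv I ⟨rfl, fun m hm => ?_, fun w hw => absurd hw (by omega)⟩ ?_
    · simp at hm
    intro w σ₁ ⟨h1, h2, h3⟩
    rw [run_seq, run_seq]
    set σ₂ := (bfs 3 2).run G π R ((AProg.par 3 4 (((val 4).eq (val 0)).and (get 2 4)).ind).run G π R
      (σ₁.setI 0 w)) with hσ₂
    have h4 : σ₂.a 2 = σ.a 2 := by rw [hσ₂, run_a (by rfl)]; simpa using h1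
    have h5 : σ₂.v 1 = σ₁.v 1 := by rw [hσ₂, run_v (by rfl)]; simp
    have h6 : σ₂.i 1 = σ₁.i 1 := by rw [hσ₂, run_i (by rfl)]; simp
    have h7 : σ₂.i 0 = w := by rw [hσ₂, run_i (by rfl)]; simp
    set d := σ₂.a 3 with hd
    have h8 : H.IsLayering {u | u = w ∧ u ∈ σ.set 2} d := by
      have hset : ((AProg.par 3 4 (((val 4).eq (val 0)).and (get 2 4)).ind).run G π R
        (σ₁.setI 0 w)).set 2 = σ.set 2 := by
        ext u; simp [Store.set, h1]
      have := bfs_spec (G := G) (π := π) (R := R) (σ := (AProg.par 3 4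
        (((val 4).eq (val 0)).and (get 2 4)).ind).run G π R (σ₁.setI 0 w)) (d := 3) (y := 2)
        (S := {u | u = w ∧ u ∈ σ.set 2}) (by decide) h0 (by rw [hset]; exact fun u h => h.2) ?_
      · rw [hset] at this; exact this
      · intro u
        by_cases hu : u = w ∧ u ∈ σ.set 2
        · refine Or.inl ⟨?_, hu⟩
          have := hu.2
          simp only [Store.set, Set.mem_ofPred_eq, ← h1] at this
          simp [hu.1]; rw [← hu.1]; simpa using this
        · refine Or.inr ⟨?_, hu⟩
          simp only [Store.set, Set.mem_ofPred_eq, ← h1] at hu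
          simp only [run_par, Store.setA_a, if_true, ev_ind, holds_and, holds_eq, ev_val, holds_get,
            Store.setI_i, Store.setI_a, Fin.val_inj]
          rw [if_neg]
          simpa using hu
    have h8' : w ∈ σ.set 2 → H.IsLayering {w} d := by
      intro hw
      have : {u | u = w ∧ u ∈ σ.set 2} = {w} := by
        ext u; constructor
        · exact fun h => h.1
        · rintro rfl; exact ⟨rfl, hw⟩
      rwa [this] at h8
    have h9 : ∀ u, d u ≠ 0 → w ∈ σ.set 2 := by
      intro u hu
      obtain ⟨j, hj⟩ := Nat.exists_eq_succ_of_ne_zero hu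
      obtain ⟨x, ⟨rfl, hx⟩, -⟩ := h8.sound u j hj
      exact hx
    -- `J` is the invariant of the loop over the layers around `w`.
    let J : ℕ → Store n → Prop := fun j σ' => σ'.a 2 = σ.a 2 ∧ σ'.a 3 = d ∧ σ'.i 0 = w ∧ Good σ' ∧
      (∀ u : Fin n, (u : ℕ) < w → Min u σ') ∧
      ∀ j' < j, (∃ x y, H.Adj x y ∧ d x = j' + 1 ∧ d y = j' + 1) → σ'.v 1 ≠ 0 ∧ σ'.v 1 ≤ j' + 1
    suffices hJ : J (π 0) (AProg.run G π R (AProg.loop 2 0 _) σ₂) by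
      obtain ⟨g1, -, -, g4, g5, g6⟩ := hJ
      refine ⟨g1, g4, fun u hu q hq hw => ?_⟩
      rcases lt_or_eq_of_le (Nat.lt_succ_iff.1 hu) with hlt | heq
      · exact g5 u hlt q hq hw
      · obtain rfl : u = w := Fin.ext heq
        have hu2 : u ∈ σ.set 2 := by
          obtain ⟨q, rfl⟩ : ∃ q', q = q' + 1 := ⟨q - 1, by have := hq.pos; omega⟩
          obtain ⟨y, -, hy⟩ := hw.last
          exact hy.2.2
        obtain ⟨j, x, y, hj, hxy, hx, hy⟩ := (h8' hu2).exists_adj_same_layer hq hw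
        obtain ⟨r, hr, hrn, hw'⟩ := ((h8' hu2).hasWalk hx).lt_card
        have h10 := (h8' hu2).complete u rfl x r hw'
        rw [Fintype.card_fin] at hrn
        have := g6 j (by omega) ⟨x, y, hxy, hx, hy⟩
        omega
    refine run_loop_inv J ⟨h4, rfl, h7, ?_, ?_,
      fun j hj => absurd hj (by omega)⟩ ?_
    · intro m hm
      rw [h5] at hm; rw [h6]
      exact h2 m hm
    · intro u hu q hq hw
      rw [h5]; exact h3 u hu q hq hw
    · rintro j hj σ₃ ⟨g1, g2, g3, g4, g5, g6⟩
      have hcond : (AExpr.Holds G π ((((v 1).eq (c 0)).or ((succ (v 2)).lt (v 1))).and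
          (cnt 2 (((get 3 2).eq (succ (v 2))).and
          (cnt 3 (((get 3 3).eq (succ (v 2))).and (adj 2 3)))))) (σ₃.setV 2 j)) ↔
          (σ₃.v 1 = 0 ∨ j + 1 < σ₃.v 1) ∧ ∃ x, d x = j + 1 ∧ ∃ y, d y = j + 1 ∧ G.Adj x y := by
        simp [g2]
      rw [run_ite]
      by_cases hc : (σ₃.v 1 = 0 ∨ j + 1 < σ₃.v 1) ∧ ∃ x, d x = j + 1 ∧ ∃ y, d y = j + 1 ∧ G.Adj x y
      · rw [if_pos (hcond.2 hc)]
        obtain ⟨hc1, x, hx, y, hy, hxy⟩ := hc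
        have hw := h9 x (by omega)
        have hi : (AProg.run G π R (.seq (.assign 1 (succ (v 2)))
            (.pick 1 ((val 1).eq (val 0)))) (σ₃.setV 2 j)).i 1 = w := by
          simp [g3]
        have hv : (AProg.run G π R (.seq (.assign 1 (succ (v 2)))
            (.pick 1 ((val 1).eq (val 0)))) (σ₃.setV 2 j)).v 1 = j + 1 := by simp
        refine ⟨by simpa using g1, by simpa using g2, by simpa using g3, ?_, ?_, ?_⟩
        · intro m hm
          rw [hv] at hm
          obtain rfl : j = m := by omega
          rw [hi]
          exact ⟨hw, d, x, y, h8' hw, ⟨hxy, h8.mem (fun u h => h.2) (by omega),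
            h8.mem (fun u h => h.2) (by omega)⟩, hx, hy⟩
        · intro u hu q hq hw'
          have := g5 u hu q hq hw'
          rw [hv]; omega
        · intro j' hj' hex
          rw [hv]
          rcases Nat.lt_succ_iff_lt_or_eq.1 hj' with h | rfl
          · have := g6 j' h hex; omega
          · omega
      · rw [if_neg (fun h => hc (hcond.1 h))]
        refine ⟨g1, g2, g3, ?_, ?_, ?_⟩
        · intro m hm; exact g4 m hm
        · intro u hu q hq hw'; exact g5 u hu q hq hw'
        · intro j' hj' hex
          rcases Nat.lt_succ_iff_lt_or_eq.1 hj' with h | rfl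
          · exact g6 j' h hex
          · obtain ⟨x, y, hxy, hx, hy⟩ := hex
            have : ¬ (σ₃.v 1 = 0 ∨ j' + 1 < σ₃.v 1) := fun h => hc ⟨h, x, hx, y, hy, hxy.1⟩
            have h11 : (σ₃.setV 2 j').v 1 = σ₃.v 1 := by simp
            rw [run_skip, h11]; omega
  exact ⟨key.2.1, fun w q hq hw => key.2.2 w w.2 q hq hw⟩

end

section

open AExpr AProg

variable {n : ℕ} [NeZero n] {G : SimpleGraph (Fin n)} {π R : ℕ → ℕ} {σ : Store n}

/-- Mark in the array `4` a shortest path from the vertex variable `x` to the root of the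
breadth-first search in the array `3`. -/
def trace (x : ℕ) : AProg :=
  .loop 2 0 <|
    .seq (.par 4 4 (AExpr.ite ((val 4).eq (val x)) (c 1) (get 4 4))) <|
    .seq (.pick 6 ((val 6).eq (val x))) <|
    .pick x (AExpr.ite ((c 1).lt (get 3 6)) ((adj 6 x).and ((succ (get 3 x)).eq (get 3 6)))
      ((val x).eq (val 6)))

/-- A neighbour of `z` that is closer to the root, or `z` itself if `z` is the root; here `d` is the
distance from the root plus one. -/
noncomputable def nextVertex (G : SimpleGraph (Fin n)) (d : Fin n → ℕ) (z : Fin n) : Fin n :=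
  select fun u => (1 < d z ∧ G.Adj z u ∧ d u + 1 = d z) ∨ (¬ 1 < d z ∧ u = z)

theorem trace_spec {x : ℕ} (hx : x ≠ 4) (hx' : x ≠ 6) (h0 : π 0 = n) (u : Fin n) :
    ((trace x).run G π R σ).a 4 u ≠ 0 ↔
      σ.a 4 u ≠ 0 ∨ ∃ j < n, u = (nextVertex G (σ.a 3))^[j] (σ.i x) := by
  let I : ℕ → Store n → Prop := fun i σ' => σ'.a 3 = σ.a 3 ∧
    σ'.i x = (nextVertex G (σ.a 3))^[i] (σ.i x) ∧
    ∀ u, σ'.a 4 u ≠ 0 ↔ σ.a 4 u ≠ 0 ∨ ∃ j < i, u = (nextVertex G (σ.a 3))^[j] (σ.i x)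
  have key : I (π 0) ((trace x).run G π R σ) := by
    refine run_loop_inv I ⟨rfl, rfl, fun u => by simp⟩ ?_
    rintro i - σ' ⟨h1, h2, h3⟩
    have h4 : ∀ u, AExpr.ev G π (AExpr.ite ((val 4).eq (val x)) (c 1) (get 4 4))
        ((σ'.setV 2 i).setI 4 u) = if u = σ'.i x then 1 else σ'.a 4 u := by
      intro u; simp [hx, Fin.val_inj]
    refine ⟨by simp [h1], ?_, fun u => ?_⟩
    · rw [Function.iterate_succ_apply', ← h2, nextVertex]
      simp [holds_ite, hx', Ne.symm hx', h1, Fin.val_inj]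
    · have h5 : ((AProg.seq (.par 4 4 (AExpr.ite ((val 4).eq (val x)) (c 1) (get 4 4)))
          (.seq (.pick 6 ((val 6).eq (val x))) (.pick x (AExpr.ite ((c 1).lt (get 3 6))
            ((adj 6 x).and ((succ (get 3 x)).eq (get 3 6))) ((val x).eq (val 6)))))).run G π R
          (σ'.setV 2 i)).a 4 u = if u = σ'.i x then 1 else σ'.a 4 u := by
        rw [← h4 u]; simp
      rw [h5]
      split_ifs with h6
      · simp only [ne_eq, one_ne_zero, not_false_eq_true, true_iff]
        exact Or.inr ⟨i, Nat.lt_succ_self i, h6.trans h2⟩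
      · rw [h3 u]
        refine or_congr_right ⟨fun ⟨j, hj, h⟩ => ⟨j, hj.trans (Nat.lt_succ_self i), h⟩,
          fun ⟨j, hj, h⟩ => ⟨j, ?_, h⟩⟩
        rcases Nat.lt_succ_iff_lt_or_eq.1 hj with hj | rfl
        · exact hj
        · exact absurd (h.trans h2.symm) h6
  rw [h0] at key
  exact key.2.2 u

variable {H : SimpleGraph (Fin n)} {Y : Set (Fin n)} {r : Fin n} {d : Fin n → ℕ}

theorem nextVertex_spec (hd : (G.within Y).IsLayering {r} d) {z : Fin n} {j : ℕ}
    (hz : d z = j + 2) : d (nextVertex G d z) = j + 1 ∧ (G.within Y).Adj z (nextVertex G d z) := by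
  obtain ⟨y, hy, hadj⟩ := (hd.hasWalk (j := j + 1) hz).last
  have h1 := hd.complete r rfl y _ hy
  have h2 := hd.adj_le hadj h1.1
  have h3 := select_spec (P := fun u => (1 < d z ∧ G.Adj z u ∧ d u + 1 = d z) ∨
    (¬ 1 < d z ∧ u = z)) ⟨y, Or.inl ⟨by omega, hadj.1.symm, by omega⟩⟩
  change (1 < d z ∧ G.Adj z (nextVertex G d z) ∧ d (nextVertex G d z) + 1 = d z) ∨
    (¬ 1 < d z ∧ nextVertex G d z = z) at h3
  rcases h3 with ⟨h4, h5, h6⟩ | ⟨h4, -⟩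
  · refine ⟨by omega, h5, hadj.2.2, ?_⟩
    obtain ⟨y', -, hadj'⟩ : ∃ y', True ∧ (G.within Y).Adj y' (nextVertex G d z) := by
      cases j with
      | zero =>
        have h7 := hd.mem_of_eq_one (u := nextVertex G d z) (by omega)
        have h8 := hd.mem_of_eq_one (u := y) (by omega)
        rw [Set.mem_singleton_iff] at h7 h8
        rw [h7, ← h8]
        exact ⟨z, trivial, hadj.symm⟩
      | succ j =>
        obtain ⟨y', -, h⟩ := (hd.hasWalk (u := nextVertex G d z) (j := j + 1) (by omega)).last
        exact ⟨y', trivial, h⟩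
    exact hadj'.2.2
  · omega

theorem nextVertex_of_eq_one (z : Fin n) (hz : d z = 1) : nextVertex G d z = z := by
  have h3 := select_spec (P := fun u => (1 < d z ∧ G.Adj z u ∧ d u + 1 = d z) ∨
    (¬ 1 < d z ∧ u = z)) ⟨z, Or.inr ⟨by omega, rfl⟩⟩
  rcases h3 with ⟨h4, -⟩ | ⟨-, h4⟩
  · omega
  · exact h4

theorem nextVertex_iterate (hd : (G.within Y).IsLayering {r} d) {z : Fin n} {m : ℕ}
    (hz : d z = m + 1) :
    (∀ j ≤ m, d ((nextVertex G d)^[j] z) = m + 1 - j) ∧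
    (∀ j < m, (G.within Y).Adj ((nextVertex G d)^[j] z) ((nextVertex G d)^[j + 1] z)) ∧
    ∀ u, (∃ j < n, u = (nextVertex G d)^[j] z) ↔ ∃ j ≤ m, u = (nextVertex G d)^[j] z := by
  have h1 : ∀ j ≤ m, d ((nextVertex G d)^[j] z) = m + 1 - j := by
    intro j
    induction j with
    | zero => intro _; simpa using hz
    | succ j ih =>
      intro hj
      rw [Function.iterate_succ_apply']
      have := (nextVertex_spec hd (z := (nextVertex G d)^[j] z) (j := m - j - 1)
        (by rw [ih (by omega)]; omega)).1
      omega
  have h2 : ∀ j, m ≤ j → (nextVertex G d)^[j] z = (nextVertex G d)^[m] z := by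
    intro j hj
    induction j, hj using Nat.le_induction with
    | base => rfl
    | succ j hj ih =>
      rw [Function.iterate_succ_apply', ih]
      exact nextVertex_of_eq_one _ (by rw [h1 m le_rfl]; omega)
  refine ⟨h1, fun j hj => ?_, fun u => ⟨fun ⟨j, hj, h⟩ => ?_, fun ⟨j, hj, h⟩ => ⟨j, ?_, h⟩⟩⟩
  · rw [Function.iterate_succ_apply']
    exact (nextVertex_spec hd (z := (nextVertex G d)^[j] z) (j := m - j - 1)
      (by rw [h1 j hj.le]; omega)).2
  · rcases le_total j m with hjm | hjm
    · exact ⟨j, hjm, h⟩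
    · exact ⟨m, le_rfl, h.trans (h2 j hjm)⟩
  · obtain ⟨q, hq, hqn, hw⟩ := (hd.hasWalk hz).lt_card
    have := hd.complete r rfl z q hw
    rw [Fintype.card_fin] at hqn
    omega

/-- After `search`, mark a shortest odd cycle in the array `4`. -/
def extract : AProg :=
  .seq (.par 3 4 ((val 4).eq (val 1)).ind) <| .seq (bfs 3 2) <|
  .seq (.pick 2 (((get 3 2).eq (v 1)).and (cnt 3 (((get 3 3).eq (v 1)).and (adj 2 3))))) <|
  .seq (.pick 3 (((get 3 3).eq (v 1)).and (adj 2 3))) <|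
  .seq (.par 4 4 (c 0)) <| .seq (trace 2) (trace 3)

/-- Find a shortest odd cycle in the subgraph induced by the array `2`, and mark it in the array
`4`. If its length is `2 m + 1`, the scalar `1` becomes `m + 1`; it becomes `0` if there is none.
-/
def find : AProg := .seq search (.ite (v 1) extract .skip)

theorem find_spec (h0 : π 0 = n) :
    let σ' := find.run G π R σ
    let H := G.within (σ.set 2)
    (σ'.v 1 = 0 ∧ H.NoOddWalk) ∨ ∃ m c, σ'.v 1 = m + 1 ∧ H.ShortestOddCycle m c ∧
      σ'.i 1 = c 0 ∧ ∀ u, σ'.a 4 u ≠ 0 ↔ ∃ a < 2 * m + 1, u = c a := by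
  intro σ' H
  set σ₁ := search.run G π R σ with hσ₁
  obtain ⟨h1, h2⟩ : (∀ m, σ₁.v 1 = m + 1 → σ₁.i 1 ∈ σ.set 2 ∧ ∃ d x y,
      H.IsLayering {σ₁.i 1} d ∧ H.Adj x y ∧ d x = m + 1 ∧ d y = m + 1) ∧
    ∀ w q, Odd q → H.HasWalk q w w → σ₁.v 1 ≠ 0 ∧ 2 * σ₁.v 1 ≤ q + 1 := search_spec h0
  have h3 : σ₁.a 2 = σ.a 2 := run_a (by rfl)
  have h3' : σ₁.set 2 = σ.set 2 := by simp [Store.set, h3]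
  by_cases hz : σ₁.v 1 = 0
  · refine Or.inl ⟨by simp [σ', find, ← hσ₁, hz], fun u q hw => ?_⟩
    by_contra ho
    exact (h2 u q (Nat.not_even_iff_odd.1 ho) hw).1 hz
  refine Or.inr ?_
  obtain ⟨m, hm⟩ := Nat.exists_eq_succ_of_ne_zero hz
  have hσ' : σ' = extract.run G π R σ₁ := by simp [σ', find, ← hσ₁, hz]
  obtain ⟨hr, d', x, y, hd', hxy, hx, hy⟩ := h1 m hm
  set r := σ₁.i 1 with hr'
  set σ₂ := (bfs 3 2).run G π R ((AProg.par 3 4 ((val 4).eq (val 1)).ind).run G π R σ₁) with hσ₂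
  set d := σ₂.a 3 with hd
  have hset : ((AProg.par 3 4 ((val 4).eq (val 1)).ind).run G π R σ₁).set 2 = σ.set 2 := by
    rw [← h3']; ext u; simp [Store.set]
  have hlay : H.IsLayering {r} d := by
    have := bfs_spec (G := G) (π := π) (R := R)
      (σ := (AProg.par 3 4 ((val 4).eq (val 1)).ind).run G π R σ₁) (d := 3) (y := 2) (S := {r})
      (by decide) h0 (by rw [hset]; simpa using hr) ?_
    · rwa [hset] at this
    · intro u
      by_cases hu : u = r
      · exact Or.inl ⟨by simp [hu, ← hr'], hu⟩
      · exact Or.inr ⟨by simpa [Fin.val_inj] using hu, hu⟩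
  -- The distances are computed anew; they agree with those found by `search`.
  have huniq : ∀ u, d' u = m + 1 → d u = m + 1 := by
    intro u hu
    have h4 := hlay.complete r rfl u _ (hd'.hasWalk hu)
    have h5 := hd'.complete r rfl u _ (hlay.hasWalk (j := d u - 1) (by omega))
    omega
  have h4 : σ₂.v 1 = m + 1 := by rw [hσ₂, run_v (by rfl)]; simpa using hm
  have h5 : σ₂.i 1 = r := by rw [hσ₂, run_i (by rfl)]; simp [hr']
  set a := select (fun u => d u = m + 1 ∧ ∃ w, d w = m + 1 ∧ G.Adj u w) with ha
  have ha' : d a = m + 1 ∧ ∃ w, d w = m + 1 ∧ G.Adj a w :=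
    select_spec (P := fun u => d u = m + 1 ∧ ∃ w, d w = m + 1 ∧ G.Adj u w)
      ⟨x, huniq x hx, y, huniq y hy, hxy.1⟩
  set b := select (fun u => d u = m + 1 ∧ G.Adj a u) with hb
  have hb' : d b = m + 1 ∧ G.Adj a b := select_spec (P := fun u => d u = m + 1 ∧ G.Adj a u) ha'.2
  set σ₃ := (AProg.par 4 4 (c 0)).run G π R ((AProg.pick 3 (((get 3 3).eq (v 1)).and
    (adj 2 3))).run G π R ((AProg.pick 2 (((get 3 2).eq (v 1)).and
      (cnt 3 (((get 3 3).eq (v 1)).and (adj 2 3))))).run G π R σ₂)) with hσ₃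
  have h6 : σ₃.i 2 = a := by simp [hσ₃, h4, ha, hd]
  have h7 : σ₃.i 3 = b := by
    have : σ₃.i 3 = select (fun u => d u = m + 1 ∧ G.Adj (σ₃.i 2) u) := by simp [hσ₃, h4, hd]
    rw [this, h6]
  have h8 : σ₃.a 3 = d := by simp [hσ₃, hd]
  have h9 : ∀ u, σ₃.a 4 u = 0 := by simp [hσ₃]
  have h10 : σ₃.i 1 = r := by simp [hσ₃, h5]
  have h11 : σ₃.v 1 = m + 1 := by simp [hσ₃, h4]
  have hσ'' : σ' = (trace 3).run G π R ((trace 2).run G π R σ₃) := by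
    rw [hσ', extract]; simp only [run_seq]; rw [← hσ₂, ← hσ₃]
  have hmem : ∀ u, d u ≠ 0 → u ∈ σ.set 2 := fun u hu => hlay.mem (by simpa using hr) hu
  obtain ⟨ha1, ha2, ha3⟩ := nextVertex_iterate hlay ha'.1
  obtain ⟨hb1, hb2, hb3⟩ := nextVertex_iterate hlay hb'.1
  obtain ⟨c, hc, hc0, hc1⟩ := hlay.shortestOddCycle ha1 hb1 ha2 hb2
    ⟨hb'.2, hmem a (by omega), hmem b (by omega)⟩ fun u q hq hw => by
      have := h2 u q hq hw; omega
  refine ⟨m, c, ?_, hc, ?_, fun u => ?_⟩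
  · rw [hσ'', run_v (by rfl), run_v (by rfl), h11]
  · rw [hσ'', run_i (by rfl), run_i (by rfl), h10, hc0]
  · have h12 : ((trace 2).run G π R σ₃).i 3 = b := by rw [run_i (by rfl), h7]
    have h13 : ((trace 2).run G π R σ₃).a 3 = d := by rw [run_a (by rfl), h8]
    rw [hσ'', trace_spec (by decide) (by decide) h0, trace_spec (by decide) (by decide) h0, h12,
      h13, h8, h6, hc1, ha3, hb3, h9]
    constructor
    · rintro ((h | ⟨j, hj, h⟩) | ⟨j, hj, h⟩)
      · exact absurd rfl h
      · exact ⟨j, hj, Or.inl h⟩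
      · exact ⟨j, hj, Or.inr h⟩
    · rintro ⟨j, hj, h | h⟩
      · exact Or.inl (Or.inr ⟨j, hj, h⟩)
      · exact Or.inr ⟨j, hj, h⟩

end

/-! ### Packing short odd cycles -/

section

open AExpr AProg

variable {n : ℕ} [NeZero n] {G : SimpleGraph (Fin n)} {π R : ℕ → ℕ} {σ : Store n}

/-- Find a shortest odd cycle in the subgraph induced by the array `2`; if it is short, give its
vertices a new label in the array `5` and remove them from the array `2`. -/
def packStep : AProg :=
  .seq find <| .ite ((v 1).and ((p 5).lt (v 1)).not)
    (.seq (.assign 3 (succ (v 3))) <| .seq (.par 5 4 (AExpr.ite (get 4 4) (v 3) (get 5 4))) <|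
      .par 2 4 (AExpr.ite (get 4 4) (c 0) (get 2 4))) .skip

/-- Greedily find disjoint short odd cycles in the subgraph induced by the array `1`. The scalar `3`
counts them, the array `5` labels their vertices, and the array `2` contains the other vertices. -/
def pack : AProg :=
  .seq (.par 2 4 (get 1 4)) <| .seq (.par 5 4 (c 0)) <| .seq (.assign 3 (c 0)) <| .loop 4 0 packStep

/-- In `σ`, the vertices of `X` are divided into the set in the array `2` and `σ.v 3` induced odd
cycles, each of at most `2 r` vertices, that are labelled by the array `5`. -/
structure Packed (G : SimpleGraph (Fin n)) (X : Set (Fin n)) (r : ℕ) (σ : Store n) : Prop where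
  rest : ∀ u, u ∈ σ.set 2 → u ∈ X ∧ σ.a 5 u = 0
  label : ∀ u, u ∈ X → u ∉ σ.set 2 → σ.a 5 u ≠ 0
  le : ∀ u, σ.a 5 u ≤ σ.v 3
  cycle : ∀ l, 1 ≤ l → l ≤ σ.v 3 → (G.within X).IsInducedOddCycle {u | σ.a 5 u = l} ∧
    {u | σ.a 5 u = l}.ncard ≤ 2 * r

/-- All closed walks of odd length in `G[Y]` have more than `2 r` edges. -/
def NoShort (G : SimpleGraph (Fin n)) (Y : Set (Fin n)) (r : ℕ) : Prop :=
  ∀ u q, Odd q → (G.within Y).HasWalk q u u → 2 * r + 1 ≤ q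

omit [NeZero n] in
theorem NoShort.mono {Y Y' : Set (Fin n)} {r : ℕ} (h : NoShort G Y r) (hY : Y' ⊆ Y) :
    NoShort G Y' r :=
  fun u q hq hw => h u q hq (hw.mono (G.within_mono hY))

omit [NeZero n] in
theorem ncard_cycle_le (m : ℕ) (c : ℕ → Fin n) : {u | ∃ a < m, u = c a}.ncard ≤ m := by
  have : {u | ∃ a < m, u = c a} = ((Finset.range m).image c : Set (Fin n)) := by
    ext u; simp [eq_comm]
  rw [this, Set.ncard_coe_finset]
  simpa using Finset.card_image_le (s := Finset.range m) (f := c)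

/-- A step of the packing shrinks the array `2`, unless no short odd cycle is left. -/
theorem packStep_spec (h0 : π 0 = n) {X : Set (Fin n)} (h : Packed G X (π 5) σ) :
    let σ' := packStep.run G π R σ
    Packed G X (π 5) σ' ∧ σ'.set 2 ⊆ σ.set 2 ∧
      (NoShort G (σ.set 2) (π 5) ∨ (σ'.set 2).ncard < (σ.set 2).ncard) := by
  intro σ'
  set σ₁ := find.run G π R σ with hσ₁
  have h2 : σ₁.a 2 = σ.a 2 := run_a (by rfl)
  have h2' : σ₁.set 2 = σ.set 2 := by simp [Store.set, h2]
  have h5 : σ₁.a 5 = σ.a 5 := run_a (by rfl)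
  have h3 : σ₁.v 3 = σ.v 3 := run_v (by rfl)
  have hp1 : Packed G X (π 5) σ₁ := ⟨by rw [h2', h5]; exact h.rest, by rw [h2', h5]; exact h.label,
    by rw [h5, h3]; exact h.le, by rw [h5, h3]; exact h.cycle⟩
  obtain ⟨hz, hno⟩ | ⟨m, c, hm, hc, -, hmark⟩ := find_spec (G := G) (R := R) (σ := σ) h0
  · have hσ' : σ' = σ₁ := by
      simp only [σ', packStep, run_seq, ← hσ₁, run_ite]
      rw [if_neg]
      · rfl
      · rw [← hσ₁] at hz
        simp [hz]
    rw [hσ']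
    exact ⟨hp1, h2'.subset, Or.inl fun u q hq hw =>
      absurd (hno u q hw) (Nat.not_even_iff_odd.2 hq)⟩
  rw [← hσ₁] at hm hmark
  by_cases hs : m + 1 ≤ π 5
  · have hσ' : σ' = ((σ₁.setV 3 (σ.v 3 + 1)).setA 5 fun u => if σ₁.a 4 u ≠ 0 then σ.v 3 + 1 else
        σ.a 5 u).setA 2 fun u => if σ₁.a 4 u ≠ 0 then 0 else σ.a 2 u := by
      simp only [σ', packStep, run_seq, ← hσ₁, run_ite]
      rw [if_pos]
      · simp only [run_assign, run_par, ev_succ, ev_v, ev_ite, ev_c, holds_get, ev_get, h3]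
        congr 1
        · congr 1
          funext u
          simp [h5]
        · funext u
          simp [h2]
      · simp [hm]; omega
    have hCY : ∀ u, σ₁.a 4 u ≠ 0 → u ∈ σ.set 2 := by
      intro u hu
      obtain ⟨a, ha, rfl⟩ := (hmark u).1 hu
      exact (hc.adj a ha).2.1
    have hset : ∀ u, u ∈ σ'.set 2 ↔ u ∈ σ.set 2 ∧ σ₁.a 4 u = 0 := by
      intro u
      by_cases hu : σ₁.a 4 u = 0 <;> simp [hσ', Store.set, hu]
    have h5' : ∀ u, σ'.a 5 u = if σ₁.a 4 u ≠ 0 then σ.v 3 + 1 else σ.a 5 u := by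
      intro u; simp [hσ']
    have h3' : σ'.v 3 = σ.v 3 + 1 := by simp [hσ']
    refine ⟨⟨fun u hu => ?_, fun u hu hu' => ?_, fun u => ?_, fun l hl hl' => ?_⟩,
      fun u hu => ((hset u).1 hu).1, Or.inr ?_⟩
    · rw [hset] at hu
      rw [h5', if_neg (by simpa using hu.2)]
      exact h.rest u hu.1
    · rw [hset] at hu'
      rw [h5']
      split_ifs with h6
      · omega
      · exact h.label u hu fun h7 => hu' ⟨h7, by simpa using h6⟩
    · rw [h5', h3']
      have := h.le u
      split_ifs <;> omega
    · rw [h3'] at hl'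
      rcases Nat.le_succ_iff.1 hl' with hl' | rfl
      · have : {u | σ'.a 5 u = l} = {u | σ.a 5 u = l} := by
          ext u
          simp only [Set.mem_ofPred_eq, h5']
          split_ifs with h6
          · have := (h.rest u (hCY u h6)).2
            omega
          · rfl
        rw [this]
        exact h.cycle l hl hl'
      · have : {u | σ'.a 5 u = σ.v 3 + 1} = {u | ∃ a < 2 * m + 1, u = c a} := by
          ext u
          simp only [Set.mem_ofPred_eq, h5', ← hmark]
          split_ifs with h6
          · simp [h6]
          · have := h.le u
            simp only [h6, iff_false]; omega
        rw [this]
        exact ⟨hc.isInducedOddCycle.mono fun u hu => (h.rest u hu).1,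
          (ncard_cycle_le _ _).trans (by omega)⟩
    · refine Set.ncard_lt_ncard ⟨fun u hu => ((hset u).1 hu).1, fun hsub => ?_⟩
      have h6 : σ₁.a 4 (c 0) ≠ 0 := (hmark _).2 ⟨0, by omega, rfl⟩
      exact h6 ((hset _).1 (hsub (hCY _ h6))).2
  · have hσ' : σ' = σ₁ := by
      simp only [σ', packStep, run_seq, ← hσ₁, run_ite]
      rw [if_neg]
      · rfl
      · simp [hm]; omega
    rw [hσ']
    refine ⟨hp1, h2'.subset, Or.inl fun u q hq hw => ?_⟩
    have := hc.min u q hq hw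
    omega

theorem pack_spec (h0 : π 0 = n) : Packed G (σ.set 1) (π 5) (pack.run G π R σ) ∧
    NoShort G ((pack.run G π R σ).set 2) (π 5) := by
  let I : ℕ → Store n → Prop := fun i σ' => Packed G (σ.set 1) (π 5) σ' ∧
    (NoShort G (σ'.set 2) (π 5) ∨ (σ'.set 2).ncard + i ≤ n)
  have key : I (π 0) (pack.run G π R σ) := by
    simp only [pack, run_seq]
    refine run_loop_inv I ⟨⟨fun u hu => ?_, fun u hu hu' => ?_, fun u => ?_, fun l hl hl' => ?_⟩,
      Or.inr ?_⟩ ?_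
    · exact ⟨by simpa [Store.set] using hu, by simp⟩
    · exact absurd (by simpa [Store.set] using hu) hu'
    · simp
    · simp at hl'; omega
    · simpa using Set.ncard_le_card (Store.set _ 2)
    · rintro i - σ₁ ⟨h1, h2⟩
      obtain ⟨h3, h4, h5⟩ := packStep_spec (σ := σ₁.setV 4 i) (G := G) (R := R) h0
        ⟨h1.rest, h1.label, h1.le, h1.cycle⟩
      refine ⟨h3, ?_⟩
      change _ ⊆ σ₁.set 2 at h4
      change NoShort G (σ₁.set 2) (π 5) ∨ _ < (σ₁.set 2).ncard at h5
      rcases h2 with h2 | h2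
      · exact Or.inl (h2.mono h4)
      · rcases h5 with h5 | h5
        · exact Or.inl (h5.mono h4)
        · right; omega
  refine ⟨key.1, ?_⟩
  rcases key.2 with h | h
  · exact h
  · intro u q hq hw
    have h1 : (pack.run G π R σ).set 2 = ∅ := by
      rw [← Set.ncard_eq_zero]; omega
    obtain ⟨q, rfl⟩ : ∃ q', q = q' + 1 := ⟨q - 1, by have := hq.pos; omega⟩
    obtain ⟨y, -, hy⟩ := hw.last
    have := hy.2.2
    rw [h1] at this
    exact absurd this (Set.notMem_empty _)

end

/-! ### Removing an odd cycle -/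

section

open AExpr AProg

variable {n : ℕ} [NeZero n] {G : SimpleGraph (Fin n)} {π R : ℕ → ℕ} {σ : Store n}

/-- The condition that the vertex `4` is in the layer at distance `e - 2` from the cycle or at
distance `R + e - 2` from the chosen vertex of the cycle. -/
def inLayers (e : AExpr) : AExpr :=
  ((get 6 4).eq e).or ((AExpr.bin .sub (get 3 4) (p 4)).eq e)

/-- After `find` in the array `2`, delete from the array `1` two small layers, one around the cycle
found and one around one of its vertices. -/
def cut : AProg :=
  .seq (.par 6 4 (get 4 4).ind) <| .seq (bfs 6 2) <|
  .seq (.par 3 4 ((val 4).eq (val 1)).ind) <| .seq (bfs 3 2) <|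
  .seq (.assign 6 (c 0)) <|
  .seq (.loop 7 4 <| .ite ((p 7).lt (cnt 4 (inLayers (succ (succ (v 7)))))) .skip
    (.assign 6 (v 7))) <|
  .par 1 4 ((get 1 4).and (inLayers (succ (succ (v 6)))).not).ind

omit [NeZero n] in
open Classical in
/-- Among the first `r` pairs of layers there is a small one. -/
theorem exists_small_layers (f g : Fin n → ℕ) {r b : ℕ} (hb : 2 * n < r * (b + 1)) :
    ∃ i < r, (Finset.univ.filter fun u => f u = i + 2 ∨ g u = i + 2).card ≤ b := by
  by_contra! h
  have h1 : ∑ i ∈ Finset.range r, (Finset.univ.filter fun u => f u = i + 2 ∨ g u = i + 2).card =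
      ∑ u : Fin n, ((Finset.range r).filter fun i => f u = i + 2 ∨ g u = i + 2).card :=
    Finset.sum_card_bipartiteAbove_eq_sum_card_bipartiteBelow fun i u => f u = i + 2 ∨ g u = i + 2
  have h2 : ∑ u : Fin n, ((Finset.range r).filter fun i => f u = i + 2 ∨ g u = i + 2).card ≤
      n * 2 := by
    refine (Finset.sum_le_card_nsmul _ _ 2 fun u _ => ?_).trans (by simp)
    refine (Finset.card_le_card (t := {f u - 2, g u - 2}) fun i hi => ?_).trans Finset.card_le_two
    have := (Finset.mem_filter.1 hi).2
    simp only [Finset.mem_insert, Finset.mem_singleton]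
    omega
  have h3 : r * (b + 1) ≤
      ∑ i ∈ Finset.range r, (Finset.univ.filter fun u => f u = i + 2 ∨ g u = i + 2).card := by
    have := Finset.card_nsmul_le_sum (Finset.range r)
      (fun i => (Finset.univ.filter fun u => f u = i + 2 ∨ g u = i + 2).card) (b + 1)
      fun i hi => h i (Finset.mem_range.1 hi)
    simpa using this
  omega

/-- The parameters `4` and `7` are the number of pairs of layers and a bound for the smallest pair.
The odd cycles that remain after `cut` are separated from the cycle `c`. -/
theorem cut_spec (h0 : π 0 = n) (hr : 2 * n < π 4 * (π 7 + 1)) {m : ℕ} {c : ℕ → Fin n}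
    (hm : 2 * π 4 ≤ m) (h1 : σ.set 1 = σ.set 2)
    (hc : (G.within (σ.set 2)).ShortestOddCycle m c) (hi : σ.i 1 = c 0)
    (hmark : ∀ u, σ.a 4 u ≠ 0 ↔ ∃ a < 2 * m + 1, u = c a) :
    let X' := (cut.run G π R σ).set 1
    X' ⊆ σ.set 2 ∧ (σ.set 2 \ X').ncard ≤ π 7 ∧
      ∀ D, (G.within X').IsInducedOddCycle D → ∀ d ∈ D, ∀ e, (∃ a < 2 * m + 1, e = c a) →
        d ≠ e ∧ ¬ G.Adj d e := by
  classical
  intro X'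
  set σ₁ := (AProg.par 6 4 (get 4 4).ind).run G π R σ with hσ₁
  have hs1 : σ₁.set 2 = σ.set 2 := by simp [hσ₁, Store.set]
  have hC := bfs_spec (G := G) (π := π) (R := R) (σ := σ₁) (d := 6) (y := 2)
    (S := {u | ∃ a < 2 * m + 1, u = c a}) (by decide) h0 (by
      rintro _ ⟨a, ha, rfl⟩; rw [hs1]; exact (hc.adj a ha).2.1) (fun u => by
      by_cases hu : ∃ a < 2 * m + 1, u = c a
      · exact Or.inl ⟨by simpa [hσ₁] using (hmark u).2 hu, hu⟩
      · exact Or.inr ⟨by simpa [hσ₁] using (not_congr (hmark u)).2 hu, hu⟩)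
  set σ₂ := (AProg.par 3 4 ((val 4).eq (val 1)).ind).run G π R ((bfs 6 2).run G π R σ₁) with hσ₂
  have hi1 : ((bfs 6 2).run G π R σ₁).i 1 = c 0 := by rw [run_i (by rfl)]; simp [hσ₁, hi]
  have hs2 : σ₂.set 2 = σ.set 2 := by
    rw [← hs1, Store.set, hσ₂, run_par, Store.setA_a, if_neg (by decide), run_a (by rfl)]; rfl
  have hv := bfs_spec (G := G) (π := π) (R := R) (σ := σ₂) (d := 3) (y := 2)
    (S := {c 0}) (by decide) h0 (by
      rw [hs2, Set.singleton_subset_iff]; exact (hc.adj 0 (by omega)).2.1) (fun u => by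
      by_cases hu : u = c 0
      · exact Or.inl ⟨by simp [hσ₂, hi1, hu], hu⟩
      · exact Or.inr ⟨by simpa [hσ₂, hi1, Fin.val_inj] using hu, hu⟩)
  rw [hs1] at hC
  rw [hs2] at hv
  set dC := ((bfs 6 2).run G π R σ₁).a 6 with hdC
  set σ₃ := (bfs 3 2).run G π R σ₂ with hσ₃
  set dv := σ₃.a 3 with hdv
  have h6 : σ₃.a 6 = dC := by rw [hσ₃, run_a (by rfl)]; simp [hσ₂, hdC]
  have h11 : σ₃.a 1 = σ.a 1 := by
    rw [hσ₃, run_a (by rfl), hσ₂, run_par, Store.setA_a, if_neg (by decide), run_a (by rfl)]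
    simp [hσ₁]
  let layers : ℕ → Finset (Fin n) := fun i =>
    Finset.univ.filter fun u => dC u = i + 2 ∨ dv u - π 4 = i + 2
  -- Once a small pair of layers has been met, the scalar `6` is the index of such a pair.
  let I : ℕ → Store n → Prop := fun i σ' => σ'.a 6 = dC ∧ σ'.a 3 = dv ∧ σ'.a 1 = σ.a 1 ∧
    ((∃ i' < i, (layers i').card ≤ π 7) → σ'.v 6 < π 4 ∧ (layers (σ'.v 6)).card ≤ π 7)
  set σ₄ := (AProg.loop 7 4 (.ite ((p 7).lt (cnt 4 (inLayers (succ (succ (v 7)))))) .skip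
    (.assign 6 (v 7)))).run G π R ((AProg.assign 6 (AExpr.c 0)).run G π R σ₃) with hσ₄
  have key : I (π 4) σ₄ := by
    refine run_loop_inv I ⟨h6, rfl, h11, fun ⟨i', hi', _⟩ => absurd hi' (by omega)⟩ ?_
    rintro i hi σ' ⟨g1, g2, g3, g4⟩
    have hcnt : (cnt 4 (inLayers (succ (succ (v 7))))).ev G π (σ'.setV 7 i) = (layers i).card := by
      rw [ev_cnt]; simp [inLayers, g1, g2, layers]
    rw [run_ite]
    by_cases hlt : π 7 < (layers i).card
    · rw [if_pos (by rw [holds_lt, hcnt]; exact hlt)]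
      refine ⟨g1, g2, g3, fun ⟨i', hi', hcard⟩ => g4 ⟨i', ?_, hcard⟩⟩
      rcases Nat.lt_succ_iff_lt_or_eq.1 hi' with h | rfl
      · exact h
      · omega
    · rw [if_neg (by rw [holds_lt, hcnt]; exact hlt)]
      exact ⟨g1, g2, g3, fun _ => by simpa using ⟨hi, not_lt.1 hlt⟩⟩
  obtain ⟨g1, g2, g3, g4⟩ := key
  obtain ⟨hsel, hcard⟩ := g4 (exists_small_layers dC (fun u => dv u - π 4) hr)
  have hX' : ∀ u, u ∈ X' ↔ u ∈ σ.set 2 ∧ ¬ (dC u = σ₄.v 6 + 2 ∨ dv u - π 4 = σ₄.v 6 + 2) := by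
    intro u
    have : cut.run G π R σ = (AProg.par 1 4
        ((get 1 4).and (inLayers (succ (succ (v 6)))).not).ind).run G π R σ₄ := rfl
    simp only [X', this, ← h1]
    simp only [Store.set, run_par, Store.setA_a, if_true, ev_ind, Set.mem_ofPred_eq, holds_and,
      holds_not, inLayers, holds_or, holds_eq, holds_get, ev_get, ev_succ, ev_v, ev_sub, ev_p,
      Store.setI_i, Store.setI_a, Store.setI_v, g1, g2, g3]
    simp
  refine ⟨fun u hu => ((hX' u).1 hu).1, ?_, fun D hD d hd e he => ?_⟩
  · refine le_trans ?_ hcard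
    rw [← Set.ncard_coe_finset]
    refine Set.ncard_le_ncard fun u hu => ?_
    have h2 := (not_congr (hX' u)).1 hu.2
    simp only [layers, Finset.coe_filter, Finset.mem_univ, true_and, Set.mem_ofPred_eq]
    by_contra h3
    exact h2 ⟨hu.1, h3⟩
  · refine hc.separated hC hv (i := σ₄.v 6 + 1) (R := π 4) (by omega) (by omega) hm
      (fun u hu => ((hX' u).1 hu).1) (fun u hu => ?_) hD hd he
    have h2 := ((hX' u).1 hu).2
    omega

/-- After `pack`, remove a cycle and its neighbourhood, if there are many short odd cycles; the
scalar `5` is a random number that determines which one. Otherwise remove all of them, and apply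
`cut` to a shortest odd cycle of the rest. -/
def choose : AProg :=
  .ite ((p 6).lt (v 3))
    (.seq (.assign 6 (succ (AExpr.bin .mod (v 5) (v 3)))) <|
      .par 1 4 ((get 1 4).and
        (((get 5 4).eq (v 6)).or (cnt 5 (((get 5 5).eq (v 6)).and (adj 5 4)))).not).ind)
    (.seq (.par 1 4 (get 2 4)) <| .seq find <| .ite (v 1) cut .skip)

/-- Each case of `choose` removes an induced odd cycle and separates it from the remaining odd
cycles, so that the induced packings become smaller. The removed vertices are a cycle and its
neighbours if there are many short cycles, and they are few otherwise. -/
theorem choose_spec (h0 : π 0 = n) (hr : 2 * n < π 4 * (π 7 + 1)) (h5 : π 5 = 2 * π 4)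
    (hp : Packed G (σ.set 1) (π 5) σ) (hs : NoShort G (σ.set 2) (π 5)) :
    let X' := (choose.run G π R σ).set 1
    X' ⊆ σ.set 1 ∧
    (∀ j, 1 ≤ j → (G.within X').HasInducedOddCyclePacking j →
      (G.within (σ.set 1)).HasInducedOddCyclePacking (j + 1)) ∧
    (π 6 < σ.v 3 → ∀ u ∈ σ.set 1, u ∉ X' → σ.a 5 u = σ.v 5 % σ.v 3 + 1 ∨
      ∃ w, σ.a 5 w = σ.v 5 % σ.v 3 + 1 ∧ G.Adj w u) ∧
    (σ.v 3 ≤ π 6 → (σ.set 1 \ X').ncard ≤ 2 * π 5 * π 6 + π 7) := by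
  classical
  intro X'
  by_cases hlt : π 6 < σ.v 3
  · have hX' : ∀ u, u ∈ X' ↔ u ∈ σ.set 1 ∧ ¬ (σ.a 5 u = σ.v 5 % σ.v 3 + 1 ∨
        ∃ w, σ.a 5 w = σ.v 5 % σ.v 3 + 1 ∧ G.Adj w u) := by
      intro u
      simp only [X', choose, run_ite]
      rw [if_pos (by simpa using hlt)]
      simp [Store.set]
    have hmod : σ.v 5 % σ.v 3 < σ.v 3 := Nat.mod_lt _ (by omega)
    refine ⟨fun u hu => ((hX' u).1 hu).1, fun j hj hpack => ?_, fun _ u hu hu' => ?_,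
      fun h => absurd h (by omega)⟩
    · refine hpack.succ (fun u hu => ((hX' u).1 hu).1)
        (hp.cycle (σ.v 5 % σ.v 3 + 1) (by omega) (by omega)).1 fun D hD d hd e he => ?_
      have h1 := ((hX' d).1 (hD.subset hd)).2
      refine ⟨fun h => h1 (Or.inl (h ▸ he)), fun h => h1 (Or.inr ⟨e, he, h.symm⟩)⟩
    · by_contra h
      exact hu' ((hX' u).2 ⟨hu, h⟩)
  · set σ₁ := (AProg.par 1 4 (get 2 4)).run G π R σ with hσ₁
    have e1 : σ₁.set 1 = σ.set 2 := by simp [hσ₁, Store.set]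
    have e2 : σ₁.set 2 = σ.set 2 := by simp [hσ₁, Store.set]
    set σ₂ := find.run G π R σ₁ with hσ₂
    have e3 : σ₂.set 1 = σ.set 2 := by rw [← e1, Store.set, hσ₂, run_a (by rfl)]; rfl
    have e4 : σ₂.set 2 = σ.set 2 := by rw [← e2, Store.set, hσ₂, run_a (by rfl)]; rfl
    have hrun : choose.run G π R σ = (AProg.ite (v 1) cut .skip).run G π R σ₂ := by
      simp only [choose, run_ite]
      rw [if_neg (by simpa using hlt)]
      simp only [run_seq, run_ite, ← hσ₁, ← hσ₂]
    have hsub : σ.set 2 ⊆ σ.set 1 := fun u hu => (hp.rest u hu).1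
    -- The short cycles cover at most `2 π 5` vertices each, and there are at most `π 6` of them.
    have hdel : (σ.set 1 \ σ.set 2).ncard ≤ 2 * π 5 * π 6 := by
      have hle := Finset.card_le_mul_card_image_of_maps_to (f := σ.a 5)
        (s := Finset.univ.filter fun u => u ∈ σ.set 1 \ σ.set 2) (t := Finset.Icc 1 (σ.v 3))
        (fun u hu => by
          have hu := (Finset.mem_filter.1 hu).2
          have := hp.label u hu.1 hu.2
          have := hp.le u
          exact Finset.mem_Icc.2 ⟨by omega, by omega⟩) (2 * π 5) (fun l hl => by
          rw [Finset.mem_Icc] at hl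
          refine le_trans ?_ (hp.cycle l hl.1 hl.2).2
          rw [← Set.ncard_coe_finset]
          refine Set.ncard_le_ncard fun u hu => ?_
          simp only [Finset.coe_filter, Set.mem_ofPred_eq] at hu
          exact hu.2)
      rw [← Set.ncard_coe_finset] at hle
      simp only [Finset.coe_filter, Finset.mem_univ, true_and, Nat.card_Icc,
        Nat.add_sub_cancel] at hle
      exact hle.trans (Nat.mul_le_mul_left _ (by omega))
    suffices H : X' ⊆ σ.set 2 ∧ (σ.set 2 \ X').ncard ≤ π 7 ∧
        (∀ j, 1 ≤ j → (G.within X').HasInducedOddCyclePacking j →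
          (G.within (σ.set 1)).HasInducedOddCyclePacking (j + 1)) by
      refine ⟨H.1.trans hsub, H.2.2, fun h => absurd h hlt, fun _ => ?_⟩
      calc (σ.set 1 \ X').ncard ≤ ((σ.set 1 \ σ.set 2) ∪ (σ.set 2 \ X')).ncard :=
            Set.ncard_le_ncard fun u hu => by
              by_cases h : u ∈ σ.set 2
              · exact Or.inr ⟨h, hu.2⟩
              · exact Or.inl ⟨hu.1, h⟩
        _ ≤ _ := (Set.ncard_union_le _ _).trans (by have := H.2.1; omega)
    obtain ⟨hz, hno⟩ | ⟨m, c, hm, hc, hi, hmark⟩ := find_spec (G := G) (R := R) (σ := σ₁) h0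
    · have hX' : X' = σ.set 2 := by
        simp only [X', hrun, run_ite]
        rw [if_neg (by rw [← hσ₂] at hz; simpa using hz)]
        exact e3
      rw [e2] at hno
      rw [hX']
      refine ⟨subset_rfl, by simp, fun j hj hpack => ?_⟩
      exact absurd hpack (hno.not_hasInducedOddCyclePacking hj)
    · rw [e2, ← e4] at hc
      rw [← hσ₂] at hm hi hmark
      have hm' := hs _ _ (by simp) (e4 ▸ hc.closed ▸ hc.arc (Nat.zero_le _) le_rfl :
        (G.within (σ.set 2)).HasWalk (2 * m + 1) (c 0) (c 0))
      obtain ⟨k1, k2, k3⟩ := cut_spec (R := R) h0 hr (by omega) (e3.trans e4.symm) hc hi hmark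
      have hX' : X' = (cut.run G π R σ₂).set 1 := by
        simp only [X', hrun, run_ite]
        rw [if_pos (by simp [hm])]
      rw [← hX', e4] at k1 k2
      rw [← hX'] at k3
      refine ⟨k1, k2, fun j hj hpack => ?_⟩
      rw [e4] at hc
      exact hpack.succ (k1.trans hsub) (hc.isInducedOddCycle.mono hsub) k3

end

/-! ### One level of the deletion process -/

section

open AExpr AProg

variable {n : ℕ} [NeZero n] {G : SimpleGraph (Fin n)} {π R : ℕ → ℕ} {σ σ' : Store n}

/-- Reset the scratch variables and arrays, so that the result of a level depends only on the array
`1` and the scalar `5`. -/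
def reset : AProg :=
  .seq (.assign 0 (c 0)) <| .seq (.assign 1 (c 0)) <| .seq (.assign 2 (c 0)) <|
  .seq (.assign 3 (c 0)) <| .seq (.assign 4 (c 0)) <| .seq (.assign 6 (c 0)) <|
  .seq (.assign 7 (c 0)) <| .seq (.pick 0 (c 0)) <| .seq (.pick 1 (c 0)) <|
  .seq (.pick 2 (c 0)) <| .seq (.pick 3 (c 0)) <| .seq (.pick 4 (c 0)) <|
  .seq (.pick 5 (c 0)) <| .seq (.pick 6 (c 0)) <| .seq (.par 2 4 (c 0)) <|
  .seq (.par 3 4 (c 0)) <| .seq (.par 4 4 (c 0)) <| .seq (.par 5 4 (c 0)) <| .par 6 4 (c 0)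

/-- Delete some vertices from the set `X` given by the array `1`, such that the induced odd cycle
packing number of `G[X]` decreases. -/
def level : AProg := .seq reset <| .seq pack choose

/-- The variables and arrays used by `level`; the scalar `5` is included if `b` is true. -/
def levelVars (b : Bool) : Footprint where
  V x := decide (x < 8) && (b || x != 5)
  I x := decide (x < 7)
  A j := decide (1 ≤ j.val ∧ j.val < 7)

theorem reset_agree {R' : ℕ → ℕ} (h : σ.a 1 = σ'.a 1) (b : Bool) (h5 : b = true → σ.v 5 = σ'.v 5) :
    Agree (levelVars b) (reset.run G π R σ) (reset.run G π R' σ') := by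
  have ha : ∀ j : Fin 16, 1 ≤ j.val → j.val < 7 → j = 1 ∨ j = 2 ∨ j = 3 ∨ j = 4 ∨ j = 5 ∨ j = 6 := by
    decide
  refine ⟨fun x hx => ?_, fun x hx => ?_, fun j hj => ?_⟩
  · simp only [levelVars, Bool.and_eq_true, decide_eq_true_eq] at hx
    obtain ⟨h1, h2⟩ := hx
    interval_cases x <;> simp [reset] at h2 ⊢
    exact h5 h2
  · simp only [levelVars, decide_eq_true_eq] at hx
    interval_cases x <;> simp [reset, AExpr.Holds]
  · simp only [levelVars, decide_eq_true_eq] at hj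
    obtain rfl | rfl | rfl | rfl | rfl | rfl := ha j hj.1 hj.2 <;> simp [reset, h]

/-- The result of a level depends only on the array `1` and the random number in the scalar `5`. -/
theorem level_agree {R' : ℕ → ℕ} (h : σ.a 1 = σ'.a 1) (h5 : σ.v 5 = σ'.v 5) :
    (level.run G π R σ).a 1 = (level.run G π R' σ').a 1 :=
  (run_agree (p := .seq pack choose) (S := levelVars true) (by rfl)
    (reset_agree h true fun _ => h5)).a 1 (by rfl)

/-- The packing of short cycles does not depend on the random number. -/
theorem pack_agree {R' : ℕ → ℕ} (h : σ.a 1 = σ'.a 1) :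
    ((AProg.seq reset pack).run G π R σ).a 5 = ((AProg.seq reset pack).run G π R' σ').a 5 ∧
    ((AProg.seq reset pack).run G π R σ).v 3 = ((AProg.seq reset pack).run G π R' σ').v 3 := by
  have := run_agree (G := G) (π := π) (R := R) (R' := R') (p := pack) (S := levelVars false)
    (by rfl) (reset_agree (G := G) (π := π) (R := R) (R' := R') (b := false) h fun h => by simp at h)
  exact ⟨this.a 5 (by rfl), this.v 3 (by rfl)⟩

/-- The state with scalar `5` equal to `r`, array `1` equal to `f`, and `0` elsewhere. -/
def levelStart (f : Fin n → ℕ) (r : ℕ) : Store n :=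
  ⟨fun x => if x = 5 then r else 0, fun _ => 0, fun j => if j = 1 then f else 0⟩

/-- The effect of `level` on the array `1`, as a function of this array and the random number. -/
noncomputable def levelMap (G : SimpleGraph (Fin n)) (π : ℕ → ℕ) (f : Fin n → ℕ) (r : ℕ) :
    Fin n → ℕ := (level.run G π (fun _ => 0) (levelStart f r)).a 1

theorem level_run : (level.run G π R σ).a 1 = levelMap G π (σ.a 1) (σ.v 5) :=
  level_agree (by simp [levelStart]) (by simp [levelStart])

theorem level_packing (h0 : π 0 = n) (hr : 2 * n < π 4 * (π 7 + 1)) (h5 : π 5 = 2 * π 4) :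
    (level.run G π R σ).set 1 ⊆ σ.set 1 ∧
    ∀ j, 1 ≤ j → (G.within ((level.run G π R σ).set 1)).HasInducedOddCyclePacking j →
      (G.within (σ.set 1)).HasInducedOddCyclePacking (j + 1) := by
  set σ₁ := reset.run G π R σ with hσ₁
  set σ₂ := pack.run G π R σ₁ with hσ₂
  have h1 : σ₁.set 1 = σ.set 1 := by simp only [Store.set, hσ₁]; rw [run_a (by rfl)]
  have h2 : σ₂.set 1 = σ.set 1 := by rw [← h1, Store.set, hσ₂, run_a (by rfl)]; rfl
  obtain ⟨hp, hs⟩ := pack_spec (G := G) (R := R) (σ := σ₁) h0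
  rw [← hσ₂] at hp hs
  rw [h1, ← h2] at hp
  obtain ⟨k1, k2, -, -⟩ := choose_spec (R := R) h0 hr h5 hp hs
  rw [h2] at k1 k2
  exact ⟨k1, k2⟩

open Classical in
/-- The number of vertices of `I` that are removed when passing from `f` to `f'`. -/
noncomputable def loss (I : Set (Fin n)) (f f' : Fin n → ℕ) : ℕ :=
  (Finset.univ.filter fun u => u ∈ I ∧ f u ≠ 0 ∧ f' u = 0).card

open Classical in
/-- The vertices of `X` with at least `n / e` neighbours in `I`. -/
noncomputable def heavy (G : SimpleGraph (Fin n)) (I X : Set (Fin n)) (e : ℕ) : Finset (Fin n) :=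
  Finset.univ.filter fun u => u ∈ X ∧ n ≤ (Finset.univ.filter fun w => G.Adj u w ∧ w ∈ I).card * e

omit [NeZero n] in
/-- If a cycle without heavy vertices is removed with its neighbourhood, then few vertices of the
independent set `I` are lost: the cycle has a vertex outside `I`, which has a neighbour in `I` but
is not heavy, so `1 < n / e`, and each vertex of the cycle accounts for at most `n / e` vertices. -/
theorem loss_of_cycle {I X C : Set (Fin n)} {f f' : Fin n → ℕ} {e L M : ℕ} (hI : G.IsIndepSet I)
    (hmax : ∀ u ∉ I, ∃ w ∈ I, G.Adj u w) (he : L * M ≤ e) (hL : 0 < L)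
    (hC : (G.within X).IsInducedOddCycle C)
    (hcard : C.ncard ≤ L) (hB : ∀ u ∈ C, u ∉ heavy G I X e)
    (hdel : ∀ u, f u ≠ 0 → f' u = 0 → u ∈ C ∨ ∃ w ∈ C, G.Adj w u) : loss I f f' * M ≤ n := by
  classical
  let N : Fin n → Finset (Fin n) := fun u => Finset.univ.filter fun w => G.Adj u w ∧ w ∈ I
  have hlight : ∀ u ∈ C, (N u).card * e < n := by
    intro u hu
    have := hB u hu
    simp only [heavy, Finset.mem_filter, Finset.mem_univ, true_and, not_and, not_le] at this
    exact this (hC.subset hu)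
  -- This bounds by `n / e` also the contribution of a vertex of the cycle that lies in `I` itself.
  have hen : e ≤ n := by
    obtain ⟨d, hd⟩ := hC.nonempty
    obtain ⟨d', hd', hadj⟩ := hC.exists_adj hd
    obtain ⟨u, hu, huI⟩ : ∃ u ∈ C, u ∉ I := by
      by_cases h : d ∈ I
      · exact ⟨d', hd', fun h' => hI h h' hadj.1.ne hadj.1⟩
      · exact ⟨d, hd, h⟩
    obtain ⟨w, hw, huw⟩ := hmax u huI
    have h1 : 1 ≤ (N u).card := Finset.card_pos.2 ⟨w, by simp [N, hw, huw]⟩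
    nlinarith [hlight u hu]
  have hNI : ∀ u ∈ C, ((if u ∈ I then {u} else ∅) ∪ N u).card * e ≤ n := by
    intro u hu
    by_cases h : u ∈ I
    · have : N u = ∅ := by
        ext w
        simp only [N, Finset.mem_filter, Finset.mem_univ, true_and, Finset.notMem_empty, iff_false]
        exact fun hw => hI h hw.2 hw.1.ne hw.1
      simpa [this, h] using hen
    · simpa [h] using (hlight u hu).le
  have hsub : (Finset.univ.filter fun u => u ∈ I ∧ f u ≠ 0 ∧ f' u = 0) ⊆
      (Finset.univ.filter fun u => u ∈ C).biUnion fun u => (if u ∈ I then {u} else ∅) ∪ N u := by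
    intro u hu
    simp only [Finset.mem_filter, Finset.mem_univ, true_and] at hu
    rw [Finset.mem_biUnion]
    rcases hdel u hu.2.1 hu.2.2 with h | ⟨w, hw, hadj⟩
    · exact ⟨u, by simpa using h, by simp [hu.1]⟩
    · exact ⟨w, by simpa using hw, by simp [N, hu.1, hadj]⟩
  have h1 : loss I f f' * e ≤ L * n := by
    calc loss I f f' * e ≤ (∑ u ∈ Finset.univ.filter fun u => u ∈ C,
          ((if u ∈ I then {u} else ∅) ∪ N u).card) * e :=
          Nat.mul_le_mul_right _ ((Finset.card_le_card hsub).trans Finset.card_biUnion_le)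
      _ ≤ (Finset.univ.filter fun u => u ∈ C).card * n := by
          rw [Finset.sum_mul, ← smul_eq_mul]
          exact Finset.sum_le_card_nsmul _ _ _ fun u hu => hNI u (Finset.mem_filter.1 hu).2
      _ ≤ L * n := by
          refine Nat.mul_le_mul_right _ ?_
          rw [← Set.ncard_coe_finset]
          simpa using hcard
  refine Nat.le_of_mul_le_mul_left (c := L) ?_ hL
  calc L * (loss I f f' * M) = loss I f f' * (L * M) := by ring
    _ ≤ loss I f f' * e := Nat.mul_le_mul_left _ he
    _ ≤ L * n := h1

/-- For all but few values of the random number, few vertices of `I` are lost in a level, provided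
that there are few heavy vertices: if there are many short cycles, most of them avoid the heavy
vertices, since they are disjoint; if there are few, only few vertices are removed anyway. -/
theorem card_bad_level {I : Set (Fin n)} {f : Fin n → ℕ} {q d K M : ℕ} (hI : G.IsIndepSet I)
    (hmax : ∀ u ∉ I, ∃ w ∈ I, G.Adj u w) (h0 : π 0 = n) (h4 : π 4 = 4 * M) (h5 : π 5 = 2 * π 4)
    (hq : q = 2 * (2 * π 5) * M) (h6 : π 6 = n / q) (h7 : π 7 = 2 * n / π 4) (hd : 4 * K * q ≤ d)
    (hM : 0 < M) (hB : (heavy G I {u | f u ≠ 0} q).card * d ≤ n) :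
    ((Finset.range n).filter fun r => n < loss I f (levelMap G π f r) * M).card * (4 * K) ≤ n := by
  classical
  have hr : 2 * n < π 4 * (π 7 + 1) := by
    rw [h7]; exact Nat.lt_mul_div_succ _ (by omega)
  have hq0 : 0 < q := by
    have : 0 < π 5 := by omega
    rw [hq]; positivity
  -- The packing of short cycles, which is the same for all values `r` of the random number.
  let P := (AProg.seq reset pack).run G π (fun _ => 0) (levelStart f 0)
  have hstep : ∀ r, let X' := {u | levelMap G π f r u ≠ 0}
      (π 6 < P.v 3 → (G.within {u | f u ≠ 0}).IsInducedOddCycle {u | P.a 5 u = r % P.v 3 + 1} ∧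
        {u | P.a 5 u = r % P.v 3 + 1}.ncard ≤ 2 * π 5 ∧
        ∀ u, f u ≠ 0 → u ∉ X' → P.a 5 u = r % P.v 3 + 1 ∨
        ∃ w, P.a 5 w = r % P.v 3 + 1 ∧ G.Adj w u) ∧
      (P.v 3 ≤ π 6 → ({u | f u ≠ 0} \ X').ncard ≤ 2 * π 5 * π 6 + π 7) := by
    intro r X'
    obtain ⟨e1, e2⟩ := pack_agree (G := G) (π := π) (R := fun _ => 0) (R' := fun _ => 0)
      (σ := levelStart f r) (σ' := levelStart f 0) rfl
    set σ₁ := reset.run G π (fun _ => 0) (levelStart f r) with hσ₁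
    set σ₂ := pack.run G π (fun _ => 0) σ₁ with hσ₂
    have h1 : σ₁.set 1 = {u | f u ≠ 0} := by
      simp only [Store.set, hσ₁]; rw [run_a (by rfl)]; rfl
    have h2 : σ₂.set 1 = {u | f u ≠ 0} := by rw [← h1, Store.set, hσ₂, run_a (by rfl)]; rfl
    have e3 : σ₂.v 5 = r := by
      rw [hσ₂, run_v (by rfl), hσ₁, run_v (by rfl)]; rfl
    have e4 : σ₂.v 3 = P.v 3 := e2
    have e5 : σ₂.a 5 = P.a 5 := e1
    obtain ⟨hp, hs⟩ := pack_spec (G := G) (R := fun _ => 0) (σ := σ₁) h0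
    rw [← hσ₂] at hp hs
    rw [h1, ← h2] at hp
    obtain ⟨-, -, k3, k4⟩ := choose_spec (R := fun _ => 0) h0 hr h5 hp hs
    have hX' : (choose.run G π (fun _ => 0) σ₂).set 1 = X' := rfl
    rw [h2, e3, e4, e5, hX'] at k3
    rw [h2, e4, hX'] at k4
    refine ⟨fun hlt => ?_, k4⟩
    have hmod : r % P.v 3 < P.v 3 := Nat.mod_lt _ (by omega)
    have := hp.cycle (r % P.v 3 + 1) (by omega) (by omega)
    rw [h2, e5] at this
    exact ⟨this.1, this.2, k3 hlt⟩
  by_cases hlt : π 6 < P.v 3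
  -- Many short cycles: if `r` is bad, then the cycle with label `r % P.v 3 + 1` contains a heavy
  -- vertex. So there are at most as many such remainders as heavy vertices, and the quotient
  -- `r / P.v 3` takes less than `q` values.
  · have hcnt : n < P.v 3 * q := by rwa [h6, Nat.div_lt_iff_lt_mul hq0] at hlt
    have hsub : ∀ r ∈ (Finset.range n).filter fun r => n < loss I f (levelMap G π f r) * M,
        (r % P.v 3 + 1, r / P.v 3) ∈
          (heavy G I {u | f u ≠ 0} q).image (P.a 5) ×ˢ Finset.range q := by
      intro r hr
      simp only [Finset.mem_filter, Finset.mem_range] at hr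
      rw [Finset.mem_product]
      constructor
      · by_contra hno
        simp only [Finset.mem_image, not_exists, not_and] at hno
        obtain ⟨g1, g2, g3⟩ := (hstep r).1 hlt
        have := loss_of_cycle (f := f) (f' := levelMap G π f r) (e := q) (L := 2 * π 5) (M := M) hI
          hmax (by rw [hq]; nlinarith) (by omega) g1 g2 (fun u hu hu' => hno u hu' hu)
          (fun u hu hu' => g3 u hu (by simpa using hu'))
        omega
      · rw [Finset.mem_range, Nat.div_lt_iff_lt_mul (by omega)]
        rw [mul_comm]; omega
    have hinj := Finset.card_le_card_of_injOn _ hsub (fun r _ r' _ h => by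
      simp only [Prod.mk.injEq, Nat.add_right_cancel_iff] at h
      rw [← Nat.div_add_mod r (P.v 3), ← Nat.div_add_mod r' (P.v 3), h.1, h.2])
    rw [Finset.card_product, Finset.card_range] at hinj
    have h8 := Finset.card_image_le (s := heavy G I {u | f u ≠ 0} q) (f := P.a 5)
    calc _ ≤ (heavy G I {u | f u ≠ 0} q).card * q * (4 * K) :=
          Nat.mul_le_mul_right _ (hinj.trans (Nat.mul_le_mul_right _ h8))
      _ = (heavy G I {u | f u ≠ 0} q).card * (4 * K * q) := by ring
      _ ≤ _ := (Nat.mul_le_mul_left _ hd).trans hB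
  -- Few short cycles: they and the two layers have at most `n / M` vertices.
  · have : ((Finset.range n).filter fun r => n < loss I f (levelMap G π f r) * M) = ∅ := by
      refine Finset.filter_eq_empty_iff.2 fun r _ => not_lt.2 ?_
      have h8 := (hstep r).2 (not_lt.1 hlt)
      have h9 : loss I f (levelMap G π f r) ≤
          ({u | f u ≠ 0} \ {u | levelMap G π f r u ≠ 0}).ncard := by
        rw [loss, ← Set.ncard_coe_finset]
        refine Set.ncard_le_ncard fun u hu => ?_
        simp only [Finset.coe_filter, Finset.mem_univ, true_and, Set.mem_ofPred_eq] at hu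
        exact ⟨hu.2.1, by simpa using hu.2.2⟩
      have h10 : n / q * q ≤ n := Nat.div_mul_le_self _ _
      have h11 : 2 * n / π 4 * π 4 ≤ 2 * n := Nat.div_mul_le_self _ _
      rw [h6, h7] at h8
      rw [h4] at h11 h8
      rw [hq] at h10
      have h12 := Nat.mul_le_mul_right M (h9.trans h8)
      rw [hq] at h12
      generalize n / (2 * (2 * π 5) * M) = A at *
      generalize 2 * n / (4 * M) = B at *
      nlinarith
    rw [this]; simp

end

/-! ### Independent sets in bipartite graphs -/

section

open AExpr AProg

variable {n : ℕ} [NeZero n] {G : SimpleGraph (Fin n)} {π R : ℕ → ℕ} {σ : Store n}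

/-- Colour the graph induced by the array `1`: the array `7` becomes `1` or `2` on its vertices and
`0` elsewhere. From every vertex, its component is coloured anew by the parity of the distance; this
avoids having to choose a vertex in every component. -/
def colour : AProg :=
  .seq (.par 2 4 (get 1 4)) <| .seq (.par 7 4 (c 0)) <| .loopV 8 <|
    .seq (.par 3 4 (((val 4).eq (val 8)).and (get 2 4)).ind) <| .seq (bfs 3 2) <|
    .par 7 4 (AExpr.ite (get 3 4) (succ (AExpr.bin .mod (get 3 4) (c 2))) (get 7 4))

/-- A proper colouring of `G[X]` with the colours `1` and `2`; the other vertices have colour `0`.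
-/
structure IsColouring (G : SimpleGraph (Fin n)) (X : Set (Fin n)) (col : Fin n → ℕ) : Prop where
  le : ∀ u, col u ≤ 2
  ne_zero : ∀ u, u ∈ X ↔ col u ≠ 0
  adj : ∀ u v, G.Adj u v → col u ≠ 0 → col v ≠ 0 → col u ≠ col v

theorem colour_spec (h0 : π 0 = n) (hX : (G.within (σ.set 1)).NoOddWalk) :
    IsColouring G (σ.set 1) ((colour.run G π R σ).a 7) := by
  classical
  let H := G.within (σ.set 1)
  let I : ℕ → Store n → Prop := fun i σ' => σ'.a 2 = σ.a 1 ∧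
    (∀ u, σ'.a 7 u ≤ 2) ∧ (∀ u, u ∉ σ.set 1 → σ'.a 7 u = 0) ∧
    (∀ u : Fin n, (u : ℕ) < i → u ∈ σ.set 1 → σ'.a 7 u ≠ 0) ∧
    ∀ u v, H.Adj u v → (σ'.a 7 u = 0 ∧ σ'.a 7 v = 0) ∨ σ'.a 7 u + σ'.a 7 v = 3
  have key : I n (colour.run G π R σ) := by
    rw [colour, run_seq, run_seq]
    refine run_loopV_inv I ⟨by simp, by simp, by simp, fun u hu => absurd hu (by omega),
      by simp⟩ ?_
    rintro w σ₁ ⟨h1, h2, h3, h4, h5⟩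
    rw [run_seq, run_seq]
    set σ₂ := (AProg.par 3 4 (((val 4).eq (val 8)).and (get 2 4)).ind).run G π R (σ₁.setI 8 w)
      with hσ₂
    set σ₃ := (bfs 3 2).run G π R σ₂ with hσ₃
    have e2 : σ₂.set 2 = σ.set 1 := by ext u; simp [hσ₂, Store.set, h1]
    have hL : H.IsLayering {u | u = w ∧ u ∈ σ.set 1} (σ₃.a 3) := by
      have := bfs_spec (G := G) (π := π) (R := R) (σ := σ₂) (d := 3) (y := 2)
        (S := {u | u = w ∧ u ∈ σ.set 1}) (by decide) h0 (by rw [e2]; exact fun u h => h.2) ?_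
      · rw [e2] at this; exact this
      · intro u
        by_cases hu : u = w ∧ σ.a 1 u ≠ 0
        · refine Or.inl ⟨?_, hu⟩
          have := hu.2
          simp only [hu.1] at this ⊢
          simp [hσ₂, h1, this]
        · refine Or.inr ⟨?_, hu⟩
          simp only [hσ₂, run_par, Store.setA_a, if_true, ev_ind]
          rw [if_neg]
          simpa [h1, Fin.val_inj] using hu
    have e7 : σ₃.a 7 = σ₁.a 7 := by rw [hσ₃, run_a (by rfl)]; simp [hσ₂]
    have e3 : σ₃.a 2 = σ.a 1 := by rw [hσ₃, run_a (by rfl)]; simp [hσ₂, h1]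
    set d := σ₃.a 3 with hd
    have hw : ∀ u, d u ≠ 0 → w ∈ σ.set 1 := by
      intro u hu
      obtain ⟨j, hj⟩ := Nat.exists_eq_succ_of_ne_zero hu
      obtain ⟨x, ⟨rfl, hx⟩, -⟩ := hL.sound u j hj
      exact hx
    have hrow : ∀ u, ((AProg.par 7 4 (AExpr.ite (get 3 4)
        (succ (AExpr.bin .mod (get 3 4) (c 2))) (get 7 4))).run G π R σ₃).a 7 u =
        if d u ≠ 0 then d u % 2 + 1 else σ₁.a 7 u := by
      intro u; simp [e7, hd]
    refine ⟨by simp [e3], fun u => ?_, fun u hu => ?_, fun u hu huX => ?_, fun u v huv => ?_⟩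
    · rw [hrow]
      have := h2 u
      split_ifs <;> omega
    · rw [hrow, if_neg, h3 u hu]
      exact fun h => hu (hL.mem (fun _ h => h.2) h)
    · rw [hrow]
      split_ifs with h
      · omega
      · rcases Nat.lt_succ_iff_lt_or_eq.1 hu with hlt | heq
        · exact h4 u hlt huX
        · obtain rfl := Fin.ext heq
          have := hL.eq_one_of_mem (u := u) ⟨rfl, huX⟩
          exact absurd this (by omega)
    · rw [hrow, hrow]
      by_cases hu : d u = 0
      · have hv : d v = 0 := by
          by_contra hv
          exact (hL.adj_le huv.symm hv).1 hu
        rw [if_neg (by omega), if_neg (by omega)]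
        exact h5 u v huv
      · obtain ⟨hv, hle⟩ := hL.adj_le huv hu
        have hle' := (hL.adj_le huv.symm hv).2
        rw [if_pos hu, if_pos hv]
        have hne : d u ≠ d v := by
          intro heq
          obtain ⟨j, hj⟩ := Nat.exists_eq_succ_of_ne_zero hu
          have hset : {u | u = w ∧ u ∈ σ.set 1} = {w} := by
            ext u; constructor
            · exact fun h => h.1
            · rintro rfl; exact ⟨rfl, hw _ hu⟩
          rw [hset] at hL
          have := hX _ _ (hL.closed_walk hj (heq ▸ hj) huv)
          exact (Nat.not_even_iff_odd.2 (by simp)) this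
        omega
  obtain ⟨-, h2, h3, h4, h5⟩ := key
  have hiff : ∀ u, u ∈ σ.set 1 ↔ (colour.run G π R σ).a 7 u ≠ 0 :=
    fun u => ⟨h4 u u.2, fun h => by_contra fun h' => h (h3 u h')⟩
  refine ⟨h2, hiff, fun u v huv hu hv heq => ?_⟩
  have := h5 u v ⟨huv, (hiff u).2 hu, (hiff v).2 hv⟩
  omega

omit [NeZero n] in
/-- A matching between the vertices of colour `1` and those of colour `2` found by an auction: `mt
v = u + 1` if `v` is matched to `u`, and `u` has paid at most one more than the least price among
its neighbours. -/
structure Auction (G : SimpleGraph (Fin n)) (col price mt : Fin n → ℕ) : Prop where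
  edge : ∀ u v : Fin n, mt v = u + 1 → col u = 1 ∧ col v = 2 ∧ G.Adj u v
  inj : ∀ v v', mt v ≠ 0 → mt v = mt v' → v = v'
  matched : ∀ v, price v ≠ 0 → mt v ≠ 0
  min : ∀ u v : Fin n, mt v = u + 1 → ∀ v', col v' = 2 → G.Adj u v' → price v ≤ price v' + 1
  le : ∀ v, price v ≤ n + 1
  le_card : ∀ v, mt v ≤ n

/-- No unmatched vertex of colour `1` has a neighbour of price at most `n`. -/
def AuctionEnd (G : SimpleGraph (Fin n)) (col price mt : Fin n → ℕ) : Prop :=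
  ∀ u : Fin n, col u = 1 → (∀ v, mt v ≠ u + 1) → ∀ v, col v = 2 → G.Adj u v → n < price v

section

variable {X : Set (Fin n)} {col price mt : Fin n → ℕ}

omit [NeZero n] in
/-- If the unmatched vertex `u` takes its cheapest neighbour `v`, and the price of `v` goes up by
one, then the auction rule is preserved. The vertex that was matched to `v` becomes unmatched. -/
theorem Auction.step (h : Auction G col price mt) {u v : Fin n} (hu : col u = 1)
    (hfree : ∀ v, mt v ≠ u + 1) (hv : col v = 2) (huv : G.Adj u v) (hn : price v ≤ n)
    (hmin : ∀ v', col v' = 2 → G.Adj u v' → price v ≤ price v') :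
    Auction G col (fun w => if w = v then price w + 1 else price w)
      (fun w => if w = v then (u : ℕ) + 1 else mt w) := by
  refine ⟨fun a b hab => ?_, fun a b ha hab => ?_, fun a ha => ?_, fun a b hab b' hb' hadj => ?_,
    fun a => ?_, fun a => ?_⟩
  · split_ifs at hab with h1
    · obtain rfl : u = a := Fin.ext (by omega)
      subst h1
      exact ⟨hu, hv, huv⟩
    · exact h.edge a b hab
  · split_ifs at ha hab with h1 h2 h2
    · rw [h1, h2]
    · exact absurd hab.symm (hfree b)
    · exact absurd hab (hfree a)
    · exact h.inj a b ha hab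
  · split_ifs at ha ⊢
    · omega
    · exact h.matched a ha
  · split_ifs at hab with h1
    · obtain rfl : u = a := Fin.ext (by omega)
      subst h1
      rw [if_pos rfl]
      have := hmin b' hb' hadj
      split_ifs <;> omega
    · rw [if_neg h1]
      have := h.min a b hab b' hb' hadj
      split_ifs <;> omega
  · have := h.le a
    split_ifs with h1
    · subst h1; omega
    · exact this
  · have := h.le_card a
    split_ifs with h1
    · exact u.2
    · exact this

open Classical in
/-- The vertices of colour `2` of price less than `θ`, and the vertices of colour `1` without such
neighbours. -/
noncomputable def threshold (G : SimpleGraph (Fin n)) (col price : Fin n → ℕ) (θ : ℕ) :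
    Finset (Fin n) :=
  Finset.univ.filter fun u => (col u = 1 ∧ ¬ ∃ v, col v = 2 ∧ G.Adj u v ∧ price v < θ) ∨
    (col u = 2 ∧ price u < θ)

omit [NeZero n] in
theorem IsColouring.isIndepSet_threshold (h : IsColouring G X col) (θ : ℕ) :
    G.IsIndepSet (threshold G col price θ : Set (Fin n)) := by
  intro u hu v hv _ huv
  simp only [threshold, Finset.coe_filter, Finset.mem_univ, true_and, Set.mem_ofPred_eq] at hu hv
  have := h.adj u v huv
  rcases hu with hu | hu <;> rcases hv with hv | hv
  · omega
  · exact hu.2 ⟨v, hv.1, huv, hv.2⟩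
  · exact hv.2 ⟨u, hu.1, huv.symm, hu.2⟩
  · omega

omit [NeZero n] in
/-- Some threshold set is at least as large as any independent set of the bipartite graph. This is a
form of König's theorem. If no price equals `θ`, then by the auction rule the vertices outside the
threshold set are at most as many as the matched pairs, each of which contains a vertex outside any
given independent set. -/
theorem exists_threshold (hc : IsColouring G X col) (h : Auction G col price mt)
    (hend : AuctionEnd G col price mt) {I : Finset (Fin n)} (hI : G.IsIndepSet (I : Set (Fin n)))
    (hIX : (I : Set (Fin n)) ⊆ X) : ∃ i < n + 1, I.card ≤ (threshold G col price (i + 1)).card := by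
  classical
  -- There are `n + 1` candidates for the price, but only `n` vertices.
  obtain ⟨i, hi, hno⟩ : ∃ i < n + 1, ∀ v, price v ≠ i + 1 := by
    by_contra! hcon
    have : (Finset.range (n + 1)) ⊆ Finset.univ.image fun v => price v - 1 := by
      intro i hi
      obtain ⟨v, hv⟩ := hcon i (Finset.mem_range.1 hi)
      exact Finset.mem_image.2 ⟨v, Finset.mem_univ _, by omega⟩
    have := (Finset.card_le_card this).trans Finset.card_image_le
    simp at this
  refine ⟨i, hi, ?_⟩
  let XF : Finset (Fin n) := Finset.univ.filter fun u => u ∈ X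
  let T := threshold G col price (i + 1)
  let M : Finset (Fin n) := Finset.univ.filter fun v => mt v ≠ 0
  have hT : ∀ u ∈ XF \ T, (col u = 1 ∧ ∃ v, col v = 2 ∧ G.Adj u v ∧ price v < i + 1) ∨
      (col u = 2 ∧ i + 1 ≤ price u) := by
    intro u hu
    simp only [XF, T, threshold, Finset.mem_sdiff, Finset.mem_filter, Finset.mem_univ, true_and,
      not_or, not_and, not_not, not_lt] at hu
    have h1 := hc.le u
    have h2 := (hc.ne_zero u).1 hu.1
    rcases (by omega : col u = 1 ∨ col u = 2) with h3 | h3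
    · exact Or.inl ⟨h3, hu.2.1 h3⟩
    · exact Or.inr ⟨h3, hu.2.2 h3⟩
  -- Each vertex outside the threshold set belongs to a matched pair of its own: a vertex `u` of
  -- colour `1` has a neighbour of price below `i + 1`, so it is matched, to a vertex of price at
  -- most `i + 1` and hence below `i + 1`; a vertex of colour `2` has a positive price.
  have hM1 : (XF \ T).card ≤ M.card := by
    have hex : ∀ u : Fin n, ∃ v, (∃ v, mt v = u + 1) → mt v = u + 1 := by
      intro u
      by_cases hv : ∃ v, mt v = u + 1
      · exact ⟨hv.choose, fun _ => hv.choose_spec⟩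
      · exact ⟨u, fun h => absurd h hv⟩
    choose m hm using hex
    have hleft : ∀ u, col u = 1 → (∃ v, col v = 2 ∧ G.Adj u v ∧ price v < i + 1) →
        mt (m u) = u + 1 ∧ price (m u) ≤ i := by
      rintro u hu ⟨v, hv, huv, hp⟩
      have h1 := hm u (by
        by_contra hcon
        push Not at hcon
        have := hend u hu hcon v hv huv
        omega)
      have := h.min u (m u) h1 v hv huv
      have := hno (m u)
      exact ⟨h1, by omega⟩
    refine Finset.card_le_card_of_injOn (fun u => if col u = 1 then m u else u) ?_ ?_
    · intro u hu
      simp only [M, Finset.coe_filter, Finset.mem_univ, true_and, Set.mem_ofPred_eq]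
      rcases hT u hu with ⟨h1, h2⟩ | ⟨h1, h2⟩
      · rw [if_pos h1, (hleft u h1 h2).1]; omega
      · rw [if_neg (by omega)]; exact h.matched u (by omega)
    · intro u hu u' hu' heq
      dsimp only at heq
      rcases hT u hu with ⟨h1, h2⟩ | ⟨h1, h2⟩ <;> rcases hT u' hu' with ⟨h1', h2'⟩ | ⟨h1', h2'⟩
      · rw [if_pos h1, if_pos h1'] at heq
        have g1 := (hleft u h1 h2).1
        have g2 := (hleft u' h1' h2').1
        rw [heq] at g1
        exact Fin.ext (by omega)
      · rw [if_pos h1, if_neg (by omega)] at heq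
        have := (hleft u h1 h2).2
        rw [heq] at this; omega
      · rw [if_neg (by omega), if_pos h1'] at heq
        have := (hleft u' h1' h2').2
        rw [← heq] at this; omega
      · rwa [if_neg (by omega), if_neg (by omega)] at heq
  -- Each matched pair contains a vertex outside the independent set.
  have hM2 : M.card ≤ (XF \ I).card := by
    have hex : ∀ v, ∃ u : Fin n, mt v ≠ 0 → mt v = u + 1 := by
      intro v
      by_cases hv : mt v = 0
      · exact ⟨v, fun h => absurd hv h⟩
      · exact ⟨⟨mt v - 1, by have := h.le_card v; omega⟩, fun _ => by dsimp only; omega⟩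
    choose o ho using hex
    have hM : ∀ v ∈ M, mt v = o v + 1 ∧ col (o v) = 1 ∧ col v = 2 ∧ G.Adj (o v) v := by
      intro v hv
      have h1 := ho v (by simpa [M] using hv)
      exact ⟨h1, h.edge _ _ h1⟩
    refine Finset.card_le_card_of_injOn (fun v => if v ∈ I then o v else v) ?_ ?_
    · intro v hv
      obtain ⟨h1, h2, h3, h4⟩ := hM v hv
      simp only [XF, Finset.coe_sdiff, Finset.coe_filter, Finset.mem_univ, true_and, Set.mem_sdiff,
        Set.mem_ofPred_eq, hc.ne_zero, Finset.mem_coe]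
      split_ifs with h5
      · exact ⟨by omega, fun h6 => hI h6 h5 h4.ne h4⟩
      · exact ⟨by omega, h5⟩
    · intro v hv v' hv' heq
      obtain ⟨h1, h2, h3, -⟩ := hM v hv
      obtain ⟨h1', h2', h3', -⟩ := hM v' hv'
      dsimp only at heq
      split_ifs at heq
      · exact h.inj v v' (by omega) (by rw [h1, h1', heq])
      · rw [heq] at h2; omega
      · rw [← heq] at h2'; omega
      · exact heq
  have h1 := Finset.le_card_sdiff T XF
  have h2 : I ⊆ XF := fun u hu => by simpa [XF] using hIX hu
  have h3 := Finset.card_sdiff_add_card_eq_card h2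
  change I.card ≤ T.card
  omega

end

/-- An unmatched vertex `8` of colour `1`. -/
def free : AExpr := ((get 7 8).eq (c 1)).and (cnt 9 ((get 9 9).eq (succ (val 8)))).not

/-- The vertex `9` is a neighbour of the vertex `8` of colour `2` and price at most `n`. -/
def eligible : AExpr := ((get 7 9).eq (c 2)).and ((adj 8 9).and ((get 8 9).lt (p 9)))

/-- A step of the auction: an unmatched vertex takes its cheapest neighbour, whose price goes up. -/
def auctionStep : AProg :=
  .seq (.pick 8 (free.and (cnt 9 eligible))) <| .ite (free.and (cnt 9 eligible))
    (.seq (.pick 9 (eligible.and (cnt 10 (((get 7 10).eq (c 2)).and ((adj 8 10).and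
        ((get 8 10).lt (get 8 9))))).not)) <|
      .seq (.par 9 4 (AExpr.ite ((val 4).eq (val 9)) (succ (val 8)) (get 9 4))) <|
      .par 8 4 (AExpr.ite ((val 4).eq (val 9)) (succ (get 8 4)) (get 8 4))) .skip

/-- The auction. Since each step before the end increases the sum of the prices, which are at most
`n + 1`, there are at most `n (n + 1)` steps. -/
def auction : AProg := .seq (.par 8 4 (c 0)) <| .seq (.par 9 4 (c 0)) <| .loop 13 10 auctionStep

omit [NeZero n] in
theorem holds_free : free.Holds G π σ ↔ σ.a 7 (σ.i 8) = 1 ∧ ∀ v, σ.a 9 v ≠ σ.i 8 + 1 := by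
  simp [free]

omit [NeZero n] in
theorem holds_eligible (h9 : π 9 = n + 1) : eligible.Holds G π σ ↔
    σ.a 7 (σ.i 9) = 2 ∧ G.Adj (σ.i 8) (σ.i 9) ∧ σ.a 8 (σ.i 9) ≤ n := by
  simp [eligible, h9]

/-- A step of the auction preserves the rule, and either the auction is at its end or the sum of the
prices increases. -/
theorem auctionStep_spec (h9 : π 9 = n + 1) {col : Fin n → ℕ} (h7 : σ.a 7 = col)
    (h : Auction G col (σ.a 8) (σ.a 9)) :
    let σ' := auctionStep.run G π R σ
    Auction G col (σ'.a 8) (σ'.a 9) ∧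
      ((AuctionEnd G col (σ.a 8) (σ.a 9) ∧ σ'.a 8 = σ.a 8 ∧ σ'.a 9 = σ.a 9) ∨
        (¬ AuctionEnd G col (σ.a 8) (σ.a 9) ∧ ∑ u, σ'.a 8 u = ∑ u, σ.a 8 u + 1)) := by
  classical
  intro σ'
  let σ₁ := (AProg.pick 8 (free.and (cnt 9 eligible))).run G π R σ
  have hrun : σ' = (AProg.ite (free.and (cnt 9 eligible))
    (.seq (.pick 9 (eligible.and (cnt 10 (((get 7 10).eq (c 2)).and ((adj 8 10).and
        ((get 8 10).lt (get 8 9))))).not)) <|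
      .seq (.par 9 4 (AExpr.ite ((val 4).eq (val 9)) (succ (val 8)) (get 9 4))) <|
      .par 8 4 (AExpr.ite ((val 4).eq (val 9)) (succ (get 8 4)) (get 8 4))) .skip).run G π R σ₁ := rfl
  have hcond : ∀ u, (free.and (cnt 9 eligible)).Holds G π (σ.setI 8 u) ↔
      (col u = 1 ∧ ∀ v, σ.a 9 v ≠ u + 1) ∧ ∃ v, col v = 2 ∧ G.Adj u v ∧ σ.a 8 v ≤ n := by
    intro u; simp [holds_free, holds_eligible h9, h7]
  have hσ₁ : σ₁ = σ.setI 8 (σ₁.i 8) := by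
    simp [σ₁]
  rw [hrun, run_ite]
  by_cases hex : ∃ u, (free.and (cnt 9 eligible)).Holds G π (σ.setI 8 u)
  · have hsel : (free.and (cnt 9 eligible)).Holds G π σ₁ := by
      have := select_spec hex
      exact this
    rw [if_pos hsel]
    rw [hσ₁, hcond] at hsel
    obtain ⟨⟨hu, hfree⟩, hv⟩ := hsel
    set u := σ₁.i 8 with hu'
    have hnot : ¬ AuctionEnd G col (σ.a 8) (σ.a 9) := fun hend => by
      obtain ⟨v, hv1, hv2, hv3⟩ := hv
      have := hend u hu hfree v hv1 hv2
      omega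
    obtain ⟨v₀, hv₀⟩ := hv
    obtain ⟨v, hv, hv4⟩ := Finset.exists_min_image
      (Finset.univ.filter fun v => col v = 2 ∧ G.Adj u v ∧ σ.a 8 v ≤ n) (σ.a 8)
      ⟨v₀, by simpa using hv₀⟩
    simp only [Finset.mem_filter, Finset.mem_univ, true_and] at hv hv4
    obtain ⟨hv1, hv2, hv3⟩ := hv
    let E : AExpr := eligible.and (cnt 10 (((get 7 10).eq (c 2)).and ((adj 8 10).and
        ((get 8 10).lt (get 8 9))))).not
    have hE : ∀ v, E.Holds G π (σ₁.setI 9 v) ↔ (col v = 2 ∧ G.Adj u v ∧ σ.a 8 v ≤ n) ∧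
        ∀ v', col v' = 2 → G.Adj u v' → σ.a 8 v ≤ σ.a 8 v' := by
      intro v
      rw [hσ₁]
      simp [E, holds_eligible h9, h7]
    have hselv := select_spec (P := fun v => E.Holds G π (σ₁.setI 9 v)) ⟨v, (hE v).2
      ⟨⟨hv1, hv2, hv3⟩, fun v' h1 h2 => by
        by_cases h3 : σ.a 8 v' ≤ n
        · exact hv4 v' ⟨h1, h2, h3⟩
        · omega⟩⟩
    set z := select fun v => E.Holds G π (σ₁.setI 9 v) with hz
    obtain ⟨⟨hz1, hz2, hz3⟩, hz4⟩ := (hE z).1 hselv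
    have hst := h.step hu hfree hz1 hz2 hz3 hz4
    set σ₂ := σ₁.setI 9 z with hσ₂
    set σ₃ := (AProg.run G π R (.seq (.pick 9 E) <|
      .seq (.par 9 4 (AExpr.ite ((val 4).eq (val 9)) (succ (val 8)) (get 9 4))) <|
      .par 8 4 (AExpr.ite ((val 4).eq (val 9)) (succ (get 8 4)) (get 8 4))) σ₁) with hσ₃
    have r8 : σ₃.a 8 = fun w => if w = z then σ.a 8 w + 1 else σ.a 8 w := by
      have : σ₁.a 8 = σ.a 8 := by rw [hσ₁]; rfl
      funext w
      simp only [hσ₃, run_seq, run_pick, ← hz]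
      simp [this, Fin.val_inj]
    have r9 : σ₃.a 9 = fun w => if w = z then (u : ℕ) + 1 else σ.a 9 w := by
      have : σ₁.a 9 = σ.a 9 := by rw [hσ₁]; rfl
      funext w
      simp only [hσ₃, run_seq, run_pick, ← hz]
      simp [this, Fin.val_inj, ← hu']
    change Auction G col (σ₃.a 8) (σ₃.a 9) ∧ (_ ∨ (_ ∧ ∑ u, σ₃.a 8 u = _))
    rw [r8, r9]
    refine ⟨hst, Or.inr ⟨hnot, ?_⟩⟩
    have : ∀ w, (if w = z then σ.a 8 w + 1 else σ.a 8 w) = σ.a 8 w + if w = z then 1 else 0 := by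
      intro w; split_ifs <;> rfl
    simp [this, Finset.sum_add_distrib]
  · have hnot : ¬ (free.and (cnt 9 eligible)).Holds G π σ₁ := by
      rw [hσ₁]; exact fun h => hex ⟨_, h⟩
    rw [if_neg hnot, run_skip, hσ₁]
    refine ⟨h, Or.inl ⟨fun u hu hf v hv huv => ?_, rfl, rfl⟩⟩
    by_contra hcon
    exact hex ⟨u, (hcond u).2 ⟨⟨hu, hf⟩, v, hv, huv, not_lt.1 hcon⟩⟩

theorem auction_spec (h9 : π 9 = n + 1) (h10 : π 10 = n * (n + 1)) {col : Fin n → ℕ}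
    (h7 : σ.a 7 = col) :
    let σ' := auction.run G π R σ
    Auction G col (σ'.a 8) (σ'.a 9) ∧ AuctionEnd G col (σ'.a 8) (σ'.a 9) := by
  classical
  intro σ'
  let I : ℕ → Store n → Prop := fun i σ' => σ'.a 7 = col ∧ Auction G col (σ'.a 8) (σ'.a 9) ∧
    (AuctionEnd G col (σ'.a 8) (σ'.a 9) ∨ i ≤ ∑ u, σ'.a 8 u)
  have key : I (π 10) σ' := by
    refine run_loop_inv I ⟨by simp [h7], ⟨?_, ?_, ?_, ?_, ?_, ?_⟩, Or.inr (Nat.zero_le _)⟩ ?_ <;>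
      try simp
    rintro i - σ₁ ⟨h1, h2, h3⟩
    obtain ⟨h4, h5⟩ := auctionStep_spec (R := R) (σ := σ₁.setV 13 i) h9 h1 h2
    refine ⟨by rw [run_a (by rfl)]; exact h1, h4, ?_⟩
    rcases h5 with ⟨h5, h6, h7⟩ | ⟨h6, h5⟩
    · rw [h6, h7]; exact Or.inl h5
    · rcases h3 with h3 | h3
      · exact absurd h3 h6
      · rw [h5]; exact Or.inr (Nat.succ_le_succ h3)
  obtain ⟨-, h1, h2⟩ := key
  -- If the auction were not over, the sum of the prices would exceed `n (n + 1)`.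
  refine ⟨h1, h2.elim id fun h2 u _ _ v _ _ => ?_⟩
  by_contra hcon
  have : ∑ u, σ'.a 8 u < ∑ _u : Fin n, (n + 1) :=
    Finset.sum_lt_sum (fun u _ => h1.le u) ⟨v, Finset.mem_univ _, by omega⟩
  simp only [Finset.sum_const, Finset.card_univ, Fintype.card_fin, smul_eq_mul] at this
  omega

end

section

open AExpr AProg

variable {n : ℕ} [NeZero n] {G : SimpleGraph (Fin n)} {π R : ℕ → ℕ} {σ : Store n}

/-- The indicator of the threshold set for the price `θ`, where `θ - 1` is the scalar `14`. -/
def inThreshold : AExpr :=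
  ((((get 7 4).eq (c 1)).and (cnt 5 (((get 7 5).eq (c 2)).and ((adj 4 5).and
    ((get 8 5).lt (succ (v 14)))))).not).or
    (((get 7 4).eq (c 2)).and ((get 8 4).lt (succ (v 14))))).ind

/-- Store the threshold set in the array `0` and its size in the scalar `12`, if it is larger than
what is stored there. -/
def thresholdStep : AProg :=
  .seq (.par 10 4 inThreshold) <| .ite ((v 12).lt (cnt 4 (get 10 4)))
    (.seq (.assign 12 (cnt 4 (get 10 4))) (.par 0 4 (get 10 4))) .skip

/-- Compare the best independent set found so far with a largest independent set of the bipartite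
graph induced by the array `1`. -/
def finish : AProg := .seq colour <| .seq auction <| .loop 14 9 thresholdStep

/-- The array `0` contains an independent set, and the scalar `12` its size. -/
def Record (G : SimpleGraph (Fin n)) (σ : Store n) : Prop :=
  G.IsIndepSet (σ.set 0) ∧ (σ.set 0).ncard = σ.v 12

theorem thresholdStep_spec {X : Set (Fin n)} (hc : IsColouring G X (σ.a 7)) (h : Record G σ) :
    let σ' := thresholdStep.run G π R σ
    Record G σ' ∧ σ.v 12 ≤ σ'.v 12 ∧ (threshold G (σ.a 7) (σ.a 8) (σ.v 14 + 1)).card ≤ σ'.v 12 := by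
  classical
  intro σ'
  set T := threshold G (σ.a 7) (σ.a 8) (σ.v 14 + 1) with hT
  set σ₁ := (AProg.par 10 4 inThreshold).run G π R σ with hσ₁
  have h1 : ∀ u, σ₁.a 10 u ≠ 0 ↔ u ∈ T := by
    intro u
    simp only [hσ₁, run_par, Store.setA_a, if_true, inThreshold, ev_ind, hT, threshold,
      Finset.mem_filter, Finset.mem_univ, true_and]
    simp [or_iff_not_imp_left]
  have hcnt : (cnt 4 (get 10 4)).ev G π σ₁ = T.card := by
    rw [ev_cnt]
    congr 1
    ext u
    simpa using h1 u
  have hv : σ₁.v 12 = σ.v 12 := rfl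
  have hset : σ₁.set 0 = σ.set 0 := by simp [Store.set, hσ₁]
  have hrun : σ' = (AProg.ite ((v 12).lt (cnt 4 (get 10 4)))
    (.seq (.assign 12 (cnt 4 (get 10 4))) (.par 0 4 (get 10 4))) .skip).run G π R σ₁ := rfl
  rw [hrun, run_ite]
  by_cases hlt : σ.v 12 < T.card
  · rw [if_pos (by rw [holds_lt, hcnt]; exact hlt)]
    simp only [run_seq, run_assign, hcnt]
    have hset' : ((AProg.par 0 4 (get 10 4)).run G π R (σ₁.setV 12 T.card)).set 0 = T := by
      ext u
      simpa [Store.set] using h1 u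
    refine ⟨⟨by rw [hset']; exact hc.isIndepSet_threshold _, ?_⟩, ?_, ?_⟩
    · rw [hset', Set.ncard_coe_finset]; simp
    · simpa using hlt.le
    · simp
  · rw [if_neg (by rw [holds_lt, hcnt]; exact hlt)]
    exact ⟨⟨by rw [run_skip, hset]; exact h.1, by rw [run_skip, hset]; exact h.2⟩, le_rfl,
      not_lt.1 hlt⟩

theorem finish_spec (h0 : π 0 = n) (h9 : π 9 = n + 1) (h10 : π 10 = n * (n + 1))
    (hX : (G.within (σ.set 1)).NoOddWalk) (h : Record G σ) :
    let σ' := finish.run G π R σ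
    Record G σ' ∧ σ.v 12 ≤ σ'.v 12 ∧ ∀ I : Finset (Fin n), G.IsIndepSet (I : Set (Fin n)) →
      (I : Set (Fin n)) ⊆ σ.set 1 → I.card ≤ σ'.v 12 := by
  intro σ'
  set σ₁ := colour.run G π R σ with hσ₁
  have hc := colour_spec (R := R) h0 hX
  rw [← hσ₁] at hc
  set σ₂ := auction.run G π R σ₁ with hσ₂
  obtain ⟨ha, hend⟩ := auction_spec (G := G) (R := R) (σ := σ₁) h9 h10 rfl
  rw [← hσ₂] at ha hend
  have e7 : σ₂.a 7 = σ₁.a 7 := run_a (by rfl)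
  have e0 : σ₂.a 0 = σ.a 0 := by rw [hσ₂, run_a (by rfl), hσ₁, run_a (by rfl)]
  have e12 : σ₂.v 12 = σ.v 12 := by rw [hσ₂, run_v (by rfl), hσ₁, run_v (by rfl)]
  let J : ℕ → Store n → Prop := fun i σ' => σ'.a 7 = σ₁.a 7 ∧ σ'.a 8 = σ₂.a 8 ∧ Record G σ' ∧
    σ.v 12 ≤ σ'.v 12 ∧ ∀ j < i, (threshold G (σ₁.a 7) (σ₂.a 8) (j + 1)).card ≤ σ'.v 12
  have key : J (π 9) σ' := by
    refine run_loop_inv J ⟨e7, rfl, ⟨by rw [Store.set, e0]; exact h.1,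
      by rw [Store.set, e0, e12]; exact h.2⟩, e12.ge, fun j hj => absurd hj (by omega)⟩ ?_
    rintro i - σ₃ ⟨g1, g2, g3, g4, g5⟩
    have hr : Record G (σ₃.setV 14 i) := ⟨g3.1, g3.2⟩
    obtain ⟨k1, k2, k3⟩ := thresholdStep_spec (π := π) (R := R) (σ := σ₃.setV 14 i) (X := σ.set 1)
      (by rw [Store.setV_a, g1]; exact hc) hr
    have e1 : (σ₃.setV 14 i).v 12 = σ₃.v 12 := by simp
    have e2 : (σ₃.setV 14 i).v 14 = i := by simp
    rw [e1] at k2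
    rw [Store.setV_a, g1, g2, e2] at k3
    refine ⟨by rw [run_a (by rfl)]; exact g1, by rw [run_a (by rfl)]; exact g2, k1, g4.trans k2,
      fun j hj => ?_⟩
    rcases Nat.lt_succ_iff_lt_or_eq.1 hj with hj | rfl
    · exact (g5 j hj).trans k2
    · exact k3
  obtain ⟨-, -, k1, k2, k3⟩ := key
  refine ⟨k1, k2, fun I hI hIX => ?_⟩
  obtain ⟨i, hi, hle⟩ := exists_threshold hc ha hend hI hIX
  exact hle.trans (k3 i (by omega))

/-! ### The whole algorithm as an array program -/

/-- Remove from the array `1` the neighbours of those random vertices that correspond to the bits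
of the scalar `10`. -/
def sample : AProg :=
  .seq (.par 1 4 (c 1)) <| .seq (.assign 10 (v 9)) <| .loop 11 2 <|
    .seq (.ite (AExpr.bin .mod (v 10) (c 2))
      (.seq (.draw 15 11) <| .seq (.pick 9 ((val 9).eq (v 15))) <|
        .par 1 4 ((get 1 4).and (adj 4 9).not).ind) .skip) <|
    .assign 10 (AExpr.bin .div (v 10) (c 2))

/-- For each subset of the random vertices, remove its neighbourhood, then make the graph bipartite
in a number of levels, and find a largest independent set of the rest. -/
def main : AProg :=
  .seq (.par 0 4 (c 0)) <| .seq (.assign 12 (c 0)) <| .loop 9 3 <|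
    .seq sample <| .seq (.loop 8 1 (.seq (.draw 5 8) level)) finish

open Classical in
/-- The indicator of the vertices that are not adjacent to the random vertices `ρ i`, `i < T`, for
which the bit `i` of `m` is set. -/
noncomputable def afterSample (G : SimpleGraph (Fin n)) (ρ : ℕ → Fin n) (m : ℕ) : ℕ → Fin n → ℕ
  | 0, _ => 1
  | T + 1, u => if m.testBit T ∧ G.Adj u (ρ T) then 0 else afterSample G ρ m T u

omit [NeZero n] in
theorem afterSample_eq (ρ : ℕ → Fin n) (m T : ℕ) (u : Fin n) :
    afterSample G ρ m T u = 0 ∨ afterSample G ρ m T u = 1 := by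
  induction T with
  | zero => simp [afterSample]
  | succ T ih => rw [afterSample]; split_ifs <;> simp [ih]

omit [NeZero n] in
theorem afterSample_ne_zero {ρ : ℕ → Fin n} {m T : ℕ} {u : Fin n} :
    afterSample G ρ m T u ≠ 0 ↔ ∀ i < T, m.testBit i → ¬ G.Adj u (ρ i) := by
  induction T with
  | zero => simp [afterSample]
  | succ T ih =>
    rw [afterSample]
    split_ifs with h
    · simp only [ne_eq, not_true_eq_false, false_iff]
      exact fun h' => h' T (Nat.lt_succ_self T) h.1 h.2
    · rw [ih]
      refine ⟨fun h' i hi hb hadj => ?_, fun h' i hi => h' i (by omega)⟩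
      rcases Nat.lt_succ_iff_lt_or_eq.1 hi with hi | rfl
      · exact h' i hi hb hadj
      · exact h ⟨hb, hadj⟩

theorem AProg.run_draw {x y : ℕ} : (AProg.draw x y).run G π R σ = σ.setV x (R (σ.v y)) := rfl

theorem sample_spec {ρ : ℕ → Fin n} (hρ : ∀ i < π 2, R i = ρ i) :
    (sample.run G π R σ).a 1 = afterSample G ρ (σ.v 9) (π 2) := by
  classical
  let J : ℕ → Store n → Prop := fun i σ' => σ'.v 10 = σ.v 9 / 2 ^ i ∧
    σ'.a 1 = afterSample G ρ (σ.v 9) i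
  have key : J (π 2) (sample.run G π R σ) := by
    refine run_loop_inv J ⟨by simp, ?_⟩ ?_
    · funext u; simp [afterSample]
    rintro i hi σ₁ ⟨h1, h2⟩
    rw [run_seq]
    have hbit : (AExpr.bin .mod (v 10) (c 2)).Holds G π (σ₁.setV 11 i) ↔ (σ.v 9).testBit i := by
      rw [Holds, ev_mod, ev_v, ev_c, Store.setV_v, if_neg (by decide), h1, Nat.testBit,
        Nat.shiftRight_eq_div_pow, Nat.one_and_eq_mod_two]
      simp
    refine ⟨?_, ?_⟩
    · rw [run_assign, Store.setV_v, if_pos rfl, ev_div, ev_v, run_v (by rfl), ev_c]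
      simp [h1, pow_succ, Nat.div_div_eq_div_mul]
    · rw [run_assign, Store.setV_a, run_ite]
      by_cases hb : (σ.v 9).testBit i
      · rw [if_pos (hbit.2 hb)]
        funext u
        have := afterSample_eq (G := G) ρ (σ.v 9) i u
        simp only [run_seq, afterSample, hb, true_and]
        rcases this with h | h <;> simp [run_draw, hρ i hi, h2, h]
      · rw [if_neg (hbit.not.2 hb), run_skip, Store.setV_a, h2]
        funext u
        simp [afterSample, hb]
  exact key.2

/-- The array `1` after `l` levels, as a function of the random numbers. -/
noncomputable def levels (G : SimpleGraph (Fin n)) (π : ℕ → ℕ) (ρ : ℕ → Fin n) (f : Fin n → ℕ) :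
    ℕ → Fin n → ℕ
  | 0 => f
  | l + 1 => levelMap G π (levels G π ρ f l) (ρ l)

/-- With `M = lossFactor k t`, at most `n / M` vertices of the independent set may be lost in a
level; then at most `n / t` vertices are lost in `k` levels. -/
def lossFactor (k t : ℕ) : ℕ := (k + 1) * t

/-- With `q = heavyFactor k t`, vertices with at least `n / q` neighbours in the independent set are
heavy, and there are many short cycles if there are more than `n / q`. A short cycle has at most
`16 M` vertices, so that `n / q` short cycles have at most `n / (2 M)` vertices. -/
def heavyFactor (k t : ℕ) : ℕ := 32 * lossFactor k t * lossFactor k t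

/-- With `d = rareFactor k t`, there should be at most `n / d` heavy vertices. Then the cycle
chosen in a level contains a heavy vertex with probability at most `1 / (4 (k + 1))`. -/
def rareFactor (k t : ℕ) : ℕ := 4 * (k + 1) * heavyFactor k t

/-- The number of random vertices: one for each level, and `4 d q` for the sample, which by Markov's
inequality leave more than `n / d` heavy vertices with probability at most `1 / 4`. -/
def draws (k t : ℕ) : ℕ := k + 4 * rareFactor k t * heavyFactor k t

/-- The parameters of the algorithm: the number of vertices, the number of levels, the number of
random vertices and that of their subsets, the number of pairs of layers, half the maximal length of
short cycles, the number of short cycles up to which all of them are removed, a bound for the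
smallest pair of layers, and the numbers of thresholds and of steps of the auction. -/
def params (n k t : ℕ) : ℕ → ℕ
  | 0 => n
  | 1 => k
  | 2 => draws k t
  | 3 => 2 ^ draws k t
  | 4 => 4 * lossFactor k t
  | 5 => 2 * (4 * lossFactor k t)
  | 6 => n / heavyFactor k t
  | 7 => 2 * n / (4 * lossFactor k t)
  | 9 => n + 1
  | 10 => n * (n + 1)
  | _ => 0

omit [NeZero n] in
theorem _root_.SimpleGraph.HasInducedOddCyclePacking.of_within {X : Set (Fin n)} {j : ℕ}
    (h : (G.within X).HasInducedOddCyclePacking j) : G.HasInducedOddCyclePacking j := by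
  obtain ⟨len, f, h1, h2⟩ := h
  have hD : ∀ i a, f i a ∈ X := fun i a =>
    SimpleGraph.IsInducedOddCycle.subset ⟨_, (h1 i).1, (h1 i).2, f i, rfl⟩ ⟨a, rfl⟩
  refine ⟨len, fun i => ⟨(f i).toEmbedding, fun {a b} => ?_⟩, h1, fun i j hij a b =>
    ⟨(h2 i j hij a b).1, fun h => (h2 i j hij a b).2 ⟨h, hD _ _, hD _ _⟩⟩⟩
  rw [← (f i).map_adj_iff]
  exact ⟨fun h => ⟨h, hD _ _, hD _ _⟩, fun h => h.1⟩

/-- The result is an independent set, which for each mask `m` is at least as large as any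
independent set that survives the sampling step for `m` and all levels. -/
theorem main_spec {k t : ℕ} (ht : 1 ≤ t) (hG : ¬ G.HasInducedOddCyclePacking (k + 1))
    {ρ : ℕ → Fin n} (hρ : ∀ i < draws k t, R i = ρ i) :
    let π := params n k t
    let σ' := main.run G π R σ
    Record G σ' ∧ ∀ m < 2 ^ draws k t, ∀ I : Finset (Fin n), G.IsIndepSet (I : Set (Fin n)) →
      (∀ u ∈ I, levels G π ρ (afterSample G ρ m (draws k t)) k u ≠ 0) → I.card ≤ σ'.v 12 := by
  intro π σ'
  let X : ℕ → ℕ → Fin n → ℕ := fun m l => levels G π ρ (afterSample G ρ m (draws k t)) l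
  -- `J` is the invariant of the loop over the masks, `L` below that of the loop over the levels.
  let J : ℕ → Store n → Prop := fun m σ' => Record G σ' ∧ ∀ m' < m, ∀ I : Finset (Fin n),
    G.IsIndepSet (I : Set (Fin n)) → (∀ u ∈ I, X m' k u ≠ 0) → I.card ≤ σ'.v 12
  suffices key : J (π 3) σ' from key
  refine run_loop_inv J ⟨⟨?_, ?_⟩, fun m' hm' => absurd hm' (by omega)⟩ ?_
  · intro u hu; simp [Store.set] at hu
  · simp [Store.set]
  rintro m - σ₁ ⟨h1, h2⟩
  rw [run_seq, run_seq]
  set σ₂ := sample.run G π R (σ₁.setV 9 m) with hσ₂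
  set σ₃ := (AProg.loop 8 1 (.seq (.draw 5 8) level)).run G π R σ₂ with hσ₃
  have e1 : σ₂.a 1 = X m 0 := by
    have := sample_spec (G := G) (π := π) (σ := σ₁.setV 9 m) hρ
    rw [Store.setV_v, if_pos rfl] at this
    exact this
  let L : ℕ → Store n → Prop := fun l σ' => σ'.a 1 = X m l ∧
    ∀ j, 1 ≤ j → (G.within (σ'.set 1)).HasInducedOddCyclePacking j →
      G.HasInducedOddCyclePacking (j + l)
  have hL : L (π 1) σ₃ := by
    refine run_loop_inv L ⟨e1, fun j _ hj => hj.of_within⟩ ?_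
    rintro l hl τ ⟨g1, g2⟩
    have e2 : (AProg.seq (.draw 5 8) level).run G π R (τ.setV 8 l) =
        level.run G π R ((τ.setV 8 l).setV 5 (ρ l)) := by
      rw [run_seq, run_draw, Store.setV_v, if_pos rfl, hρ l]
      exact hl.trans_le (Nat.le_add_right _ _)
    rw [e2]
    have hM : 0 < lossFactor k t := by unfold lossFactor; positivity
    obtain ⟨-, g3⟩ := level_packing (G := G) (R := R) (π := π) (σ := (τ.setV 8 l).setV 5 (ρ l)) rfl
      (Nat.lt_mul_div_succ _ (show 0 < 4 * lossFactor k t by omega)) rfl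
    refine ⟨?_, fun j hj hpack => ?_⟩
    · rw [level_run]
      simp only [Store.setV_a, Store.setV_v, if_true, g1]
      rfl
    · have := g2 (j + 1) (by omega) (g3 j hj hpack)
      rwa [show j + 1 + l = j + (l + 1) by omega] at this
  -- An odd cycle left after `k` levels would give an induced packing of `k + 1` odd cycles in `G`.
  have hbip : (G.within (σ₃.set 1)).NoOddWalk :=
    SimpleGraph.noOddWalk_of_not_hasInducedOddCyclePacking fun h =>
      hG (by have := hL.2 1 le_rfl h; rwa [add_comm] at this)
  have e0 : σ₃.a 0 = σ₁.a 0 := by rw [hσ₃, run_a (by rfl), hσ₂, run_a (by rfl)]; rfl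
  have e12 : σ₃.v 12 = σ₁.v 12 := by rw [hσ₃, run_v (by rfl), hσ₂, run_v (by rfl)]; rfl
  have hr : Record G σ₃ := by
    refine ⟨?_, ?_⟩
    · rw [Store.set, e0]; exact h1.1
    · rw [Store.set, e0, e12]; exact h1.2
  obtain ⟨k1, k2, k3⟩ := finish_spec (n := n) (G := G) (R := R) (π := π) (σ := σ₃) rfl rfl rfl hbip hr
  refine ⟨k1, fun m' hm' I hI hIX => ?_⟩
  rcases Nat.lt_succ_iff_lt_or_eq.1 hm' with hm' | rfl
  · exact (h2 m' hm' I hI hIX).trans (e12.symm.trans_le k2)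
  · refine k3 I hI fun u hu => ?_
    change σ₃.a 1 u ≠ 0
    rw [hL.1]
    exact hIX u hu

/-- If the mask `m` keeps the independent set `I` and little of `I` is lost in each level, then the
result is almost as large as `I`. -/
theorem main_good {k t : ℕ} (ht : 1 ≤ t) (hG : ¬ G.HasInducedOddCyclePacking (k + 1))
    {ρ : ℕ → Fin n} (hρ : ∀ i < draws k t, R i = ρ i) {I : Finset (Fin n)}
    (hI : G.IsIndepSet (I : Set (Fin n))) {m : ℕ} (hm : m < 2 ^ draws k t) {f : Fin n → ℕ}
    (hf : f = afterSample G ρ m (draws k t)) (hIf : ∀ u ∈ I, f u ≠ 0)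
    (hloss : ∀ l < k, loss (I : Set (Fin n)) (levels G (params n k t) ρ f l)
      (levels G (params n k t) ρ f (l + 1)) * lossFactor k t ≤ n) :
    I.card * t ≤ (main.run G (params n k t) R σ).v 12 * t + n := by
  classical
  have h1 := (main_spec (σ := σ) ht hG hρ).2 m hm (I.filter fun u =>
    levels G (params n k t) ρ f k u ≠ 0) (fun u hu v hv => hI (Finset.filter_subset _ _ hu)
      (Finset.filter_subset _ _ hv)) (fun u hu => hf ▸ (Finset.mem_filter.1 hu).2)
  have h2 : ∀ l ≤ k, I.card * lossFactor k t ≤ (I.filter fun u =>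
      levels G (params n k t) ρ f l u ≠ 0).card * lossFactor k t + l * n := by
    intro l
    induction l with
    | zero =>
      intro _
      rw [Finset.filter_true_of_mem (by simpa [levels] using hIf)]
      omega
    | succ l ih =>
      intro hl
      have h3 := ih (by omega)
      have h4 := hloss l (by omega)
      have h5 : (I.filter fun u => levels G (params n k t) ρ f l u ≠ 0).card ≤
          (I.filter fun u => levels G (params n k t) ρ f (l + 1) u ≠ 0).card +
          loss (I : Set (Fin n)) (levels G (params n k t) ρ f l)
            (levels G (params n k t) ρ f (l + 1)) := by
        refine (Finset.card_le_card fun u hu => ?_).trans (Finset.card_union_le _ _)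
        simp only [Finset.mem_filter, Finset.mem_union, Finset.mem_univ, true_and,
          Finset.mem_coe] at hu ⊢
        by_cases h : levels G (params n k t) ρ f (l + 1) u = 0
        · exact Or.inr ⟨hu.1, hu.2, h⟩
        · exact Or.inl ⟨hu.1, h⟩
      nlinarith
  have h3 := h2 k le_rfl
  refine Nat.le_of_mul_le_mul_left (c := k + 1) ?_ (Nat.succ_pos k)
  have h4 := Nat.mul_le_mul_right (lossFactor k t) h1
  unfold lossFactor at *
  nlinarith

end

/-! ### The probability of failure -/

section

variable {n : ℕ} [NeZero n] {G : SimpleGraph (Fin n)} {π : ℕ → ℕ}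

theorem levels_congr {ρ ρ' : ℕ → Fin n} (f : Fin n → ℕ) {l : ℕ} (h : ∀ i < l, ρ i = ρ' i) :
    levels G π ρ f l = levels G π ρ' f l := by
  induction l with
  | zero => rfl
  | succ l ih => rw [levels, levels, ih fun i hi => h i (by omega), h l (by omega)]

omit [NeZero n] in
theorem afterSample_congr {ρ ρ' : ℕ → Fin n} {m m' T : ℕ}
    (h : ∀ i < T, m.testBit i = m'.testBit i ∧ (m.testBit i → ρ i = ρ' i)) :
    afterSample G ρ m T = afterSample G ρ' m' T := by
  induction T with
  | zero => rfl
  | succ T ih =>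
    funext u
    have h1 := h T (by omega)
    rw [afterSample, afterSample, ih fun i hi => h i (by omega), ← h1.1]
    by_cases h2 : m.testBit T
    · rw [h1.2 h2]
    · simp [h2]

theorem levels_subset (h0 : π 0 = n) (hr : 2 * n < π 4 * (π 7 + 1)) (h5 : π 5 = 2 * π 4)
    (ρ : ℕ → Fin n) (f : Fin n → ℕ) (l : ℕ) {u : Fin n} (hu : levels G π ρ f l u ≠ 0) :
    f u ≠ 0 := by
  induction l with
  | zero => exact hu
  | succ l ih =>
    have := (level_packing (G := G) (R := fun _ => 0)
      (σ := levelStart (levels G π ρ f l) (ρ l)) h0 hr h5).1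
    exact ih (this hu)

/-- If in each line parallel to the `l`-th coordinate axis at most the fraction `1 / c` of the
points has property `P`, then this is true in total. -/
theorem card_mul_le_of_lines {T c : ℕ} (P : (Fin T → Fin n) → Prop) [DecidablePred P] (l : Fin T)
    (h : ∀ ω, (Finset.univ.filter fun r => P (Function.update ω l r)).card * c ≤ n) :
    (Finset.univ.filter P).card * c ≤ n ^ T := by
  let e := Equiv.funSplitAt l (Fin n)
  have he : ∀ r y, e.symm (r, y) = Function.update (e.symm (0, y)) l r := by
    intro r y
    funext j
    by_cases hj : j = l
    · subst hj; simp [e, Equiv.funSplitAt, Equiv.piSplitAt]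
    · simp [e, Equiv.funSplitAt, Equiv.piSplitAt, hj]
  have h1 : (Finset.univ.filter P).card =
      ∑ y, (Finset.univ.filter fun r => P (Function.update (e.symm (0, y)) l r)).card := by
    simp only [Finset.card_filter, ← he]
    rw [← Fintype.sum_prod_type_right (f := fun x => if P (e.symm x) then 1 else 0)]
    exact (Equiv.sum_comp e.symm fun ω => if P ω then 1 else 0).symm
  have h2 : n * Fintype.card ({j // j ≠ l} → Fin n) = n ^ T := by
    have := Fintype.card_congr e
    rw [Fintype.card_prod] at this
    simpa using this.symm
  rw [h1, Finset.sum_mul, ← h2, mul_comm]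
  exact Finset.sum_le_card_nsmul _ _ _ fun y _ => h _

/-- A form of `(1 - 1 / q) ^ s ≤ q / s`, which is a weak bound that suffices. -/
theorem bernoulli_bound {a b q s : ℕ} (h : a + b ≤ b * q) : a ^ s * s ≤ q * (a + b) ^ s := by
  cases s with
  | zero => simp
  | succ s =>
    have h1 : a ^ s * (s + 1) * b ≤ (a + b) ^ (s + 1) := by
      induction s with
      | zero => simp
      | succ s ih =>
        calc a ^ (s + 1) * (s + 1 + 1) * b = a * (a ^ s * (s + 1) * b) + b * a ^ (s + 1) := by ring
          _ ≤ a * (a + b) ^ (s + 1) + b * (a + b) ^ (s + 1) := by gcongr; omega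
          _ = (a + b) ^ (s + 1 + 1) := by ring
    calc a ^ (s + 1) * (s + 1) = a ^ s * (s + 1) * a := by ring
      _ ≤ a ^ s * (s + 1) * (b * q) := Nat.mul_le_mul_left _ (by omega)
      _ = q * (a ^ s * (s + 1) * b) := by ring
      _ ≤ q * (a + b) ^ (s + 1) := Nat.mul_le_mul_left _ h1

omit [NeZero n] in
open Classical in
/-- A random sample is unlikely to avoid a set of at least `n / q` vertices. -/
theorem card_avoid {k s q : ℕ} (S : Finset (Fin n)) (hS : n ≤ S.card * q) :
    (Finset.univ.filter fun ω : Fin (k + s) → Fin n => ∀ i, k ≤ i.val → ω i ∉ S).card * s ≤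
      q * n ^ (k + s) := by
  have h1 : (Finset.univ.filter fun ω : Fin (k + s) → Fin n => ∀ i, k ≤ i.val → ω i ∉ S) =
      Fintype.piFinset fun i : Fin (k + s) => if k ≤ i.val then Sᶜ else Finset.univ := by
    ext ω
    simp only [Finset.mem_filter, Finset.mem_univ, true_and, Fintype.mem_piFinset]
    refine forall_congr' fun i => ?_
    by_cases hi : k ≤ i.val <;> simp [hi]
  have h2 : (Sᶜ).card + S.card = n := by
    simp [Finset.card_compl_add_card]
  rw [h1, Fintype.card_piFinset, Fin.prod_univ_add]
  have h3 := bernoulli_bound (a := Sᶜ.card) (b := S.card) (q := q) (s := s) (by omega)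
  rw [h2] at h3
  have h4 : ∀ i : Fin k, ¬ k ≤ i.val := fun i => by omega
  simp only [Fin.val_castAdd, h4, if_false, Finset.card_univ, Fintype.card_fin, Finset.prod_const,
    Fin.val_natAdd, Nat.le_add_right, if_true]
  calc n ^ k * Sᶜ.card ^ s * s = n ^ k * (Sᶜ.card ^ s * s) := by ring
    _ ≤ n ^ k * (q * n ^ s) := Nat.mul_le_mul_left _ h3
    _ = q * n ^ (k + s) := by ring

/-- The sequence of random vertices, continued by the vertex `0`. -/
def extend {T : ℕ} (ω : Fin T → Fin n) (i : ℕ) : Fin n := if h : i < T then ω ⟨i, h⟩ else 0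

open Classical in
/-- The mask that selects from the random vertices with index at least `k` those in `I`. -/
noncomputable def maskOf (k : ℕ) {T : ℕ} (I : Finset (Fin n)) (ω : Fin T → Fin n) : ℕ :=
  Nat.ofBits fun i => decide (k ≤ i.val ∧ ω i ∈ I)

omit [NeZero n] in
theorem testBit_maskOf {k T : ℕ} {I : Finset (Fin n)} {ω : Fin T → Fin n} {i : ℕ} (hi : i < T) :
    (maskOf k I ω).testBit i ↔ k ≤ i ∧ ω ⟨i, hi⟩ ∈ I := by
  rw [maskOf, Nat.testBit_ofBits_lt _ _ hi]; simp

/-- The array `1` after the sampling step for the mask that selects the vertices in `I`. -/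
noncomputable def startOf (G : SimpleGraph (Fin n)) (k : ℕ) {T : ℕ} (I : Finset (Fin n))
    (ω : Fin T → Fin n) : Fin n → ℕ := afterSample G (extend ω) (maskOf k I ω) T

/-- A vertex survives the sampling step if it is not adjacent to a sampled vertex of `I`. -/
theorem startOf_ne_zero {k T : ℕ} {I : Finset (Fin n)} {ω : Fin T → Fin n} {u : Fin n} :
    startOf G k I ω u ≠ 0 ↔ ∀ i : Fin T, k ≤ i.val → ω i ∈ I → ¬ G.Adj u (ω i) := by
  rw [startOf, afterSample_ne_zero]
  constructor
  · intro h i hk hi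
    have := h i i.2 ((testBit_maskOf i.2).2 ⟨hk, hi⟩)
    simpa [extend] using this
  · intro h i hi hb
    obtain ⟨h1, h2⟩ := (testBit_maskOf hi).1 hb
    simpa [extend, hi] using h ⟨i, hi⟩ h1 h2

/-- The sampling step does not depend on the random vertices that are reserved for the levels. -/
theorem startOf_update {k T : ℕ} {I : Finset (Fin n)} (ω : Fin T → Fin n) {l : Fin T}
    (hl : l.val < k) (r : Fin n) : startOf G k I (Function.update ω l r) = startOf G k I ω := by
  have h : ∀ i : Fin T, k ≤ i.val → Function.update ω l r i = ω i := fun i hi =>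
    Function.update_of_ne (fun h => by rw [h] at hi; omega) _ _
  refine afterSample_congr fun i hi => ⟨?_, fun hb => ?_⟩
  · rw [Bool.eq_iff_iff, testBit_maskOf hi, testBit_maskOf hi]
    exact and_congr_right fun h1 => by rw [h _ h1]
  · have := h ⟨i, hi⟩ ((testBit_maskOf hi).1 hb).1
    simpa [extend, hi] using this

open Classical in
/-- By Markov's inequality there are rarely many heavy vertices. -/
theorem card_many_heavy {k s q d : ℕ} (I : Finset (Fin n)) (hd : 0 < d) (hq : 0 < q)
    (hs : s = 4 * d * q) :
    (Finset.univ.filter fun ω : Fin (k + s) → Fin n =>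
      n < (heavy G (I : Set (Fin n)) {u | startOf G k I ω u ≠ 0} q).card * d).card * 4 ≤
      n ^ (k + s) := by
  set bad := Finset.univ.filter fun ω : Fin (k + s) → Fin n =>
      n < (heavy G (I : Set (Fin n)) {u | startOf G k I ω u ≠ 0} q).card * d with hbad
  have hn : 0 < n := Nat.pos_of_ne_zero (NeZero.ne n)
  have h1 : bad.card * n ≤ ∑ ω : Fin (k + s) → Fin n,
      (heavy G (I : Set (Fin n)) {u | startOf G k I ω u ≠ 0} q).card * d := by
    rw [← smul_eq_mul]
    refine (Finset.card_nsmul_le_sum bad _ n fun ω hω => ?_).trans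
      (Finset.sum_le_sum_of_subset (Finset.subset_univ _))
    exact (Finset.mem_filter.1 hω).2.le
  have h2 : ∑ ω : Fin (k + s) → Fin n,
      (heavy G (I : Set (Fin n)) {u | startOf G k I ω u ≠ 0} q).card =
      ∑ u : Fin n, (Finset.univ.filter fun ω : Fin (k + s) → Fin n =>
        u ∈ heavy G (I : Set (Fin n)) {u | startOf G k I ω u ≠ 0} q).card := by
    have := Finset.sum_card_bipartiteAbove_eq_sum_card_bipartiteBelow
      (s := (Finset.univ : Finset (Fin (k + s) → Fin n))) (t := (Finset.univ : Finset (Fin n)))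
      fun ω u => u ∈ heavy G (I : Set (Fin n)) {u | startOf G k I ω u ≠ 0} q
    simpa [Finset.bipartiteAbove, Finset.bipartiteBelow] using this
  have h3 : ∀ u : Fin n, (Finset.univ.filter fun ω : Fin (k + s) → Fin n =>
      u ∈ heavy G (I : Set (Fin n)) {u | startOf G k I ω u ≠ 0} q).card * s ≤
      q * n ^ (k + s) := by
    intro u
    by_cases hu : n ≤ (Finset.univ.filter fun w => G.Adj u w ∧ w ∈ (I : Set (Fin n))).card * q
    · refine le_trans (Nat.mul_le_mul_right _ (Finset.card_le_card fun ω hω => ?_))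
        (card_avoid _ hu)
      simp only [heavy, Finset.mem_filter, Finset.mem_univ, true_and, Set.mem_ofPred_eq] at hω ⊢
      intro i hi hmem
      exact startOf_ne_zero.1 hω.1 i hi (by simpa using hmem.2) hmem.1
    · rw [Finset.filter_eq_empty_iff.2]
      · simp
      · intro ω _ hω
        simp only [heavy, Finset.mem_filter, Finset.mem_univ, true_and] at hω
        refine hu ?_
        convert hω.2
  have h4 : bad.card * n * s ≤ d * (n * (q * n ^ (k + s))) := by
    calc bad.card * n * s ≤ (∑ u : Fin n, (Finset.univ.filter fun ω : Fin (k + s) → Fin n =>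
          u ∈ heavy G (I : Set (Fin n)) {u | startOf G k I ω u ≠ 0} q).card) * d * s := by
          rw [← h2, Finset.sum_mul]; exact Nat.mul_le_mul_right _ h1
      _ = d * ∑ u : Fin n, (Finset.univ.filter fun ω : Fin (k + s) → Fin n =>
          u ∈ heavy G (I : Set (Fin n)) {u | startOf G k I ω u ≠ 0} q).card * s := by
          rw [← Finset.sum_mul]; ring
      _ ≤ d * (n * (q * n ^ (k + s))) := by
          refine Nat.mul_le_mul_left _ ((Finset.sum_le_card_nsmul _ _ _ fun u _ => h3 u).trans ?_)
          simp
  refine Nat.le_of_mul_le_mul_left (c := n * d * q) ?_ (by positivity)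
  calc n * d * q * (bad.card * 4) = bad.card * n * (4 * d * q) := by ring
    _ = bad.card * n * s := congrArg _ hs.symm
    _ ≤ _ := h4
    _ = _ := by ring

/-- With probability at least `1 / 2` the algorithm finds an independent set that is almost as large
as the given one. -/
theorem card_good {k t : ℕ} (ht : 1 ≤ t) (hG : ¬ G.HasInducedOddCyclePacking (k + 1))
    {I : Finset (Fin n)} (hI : G.IsIndepSet (I : Set (Fin n)))
    (hmax : ∀ u ∉ I, ∃ w ∈ I, G.Adj u w) (σ : (Fin (draws k t) → Fin n) → Store n)
    (good : Finset (Fin (draws k t) → Fin n))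
    (hgood : ∀ ω, I.card * t ≤ (main.run G (params n k t) (fun i => extend ω i) (σ ω)).v 12 * t + n →
      ω ∈ good) :
    n ^ draws k t ≤ 2 * good.card := by
  classical
  set q := heavyFactor k t with hq
  set d := rareFactor k t with hd
  set M := lossFactor k t with hM
  have hM0 : 0 < M := by rw [hM, lossFactor]; positivity
  have hq0 : 0 < q := by rw [hq, heavyFactor]; positivity
  have hd0 : 0 < d := by rw [hd, rareFactor]; positivity
  let π := params n k t
  have hr : 2 * n < π 4 * (π 7 + 1) :=
    Nat.lt_mul_div_succ _ (show 0 < 4 * lossFactor k t by omega)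
  have hkT : k ≤ draws k t := Nat.le_add_right _ _
  -- The bad events: there are many heavy vertices, or much is lost in level `l`.
  let A : (Fin (draws k t) → Fin n) → Prop := fun ω =>
    n < (heavy G (I : Set (Fin n)) {u | startOf G k I ω u ≠ 0} q).card * d
  let B : ℕ → (Fin (draws k t) → Fin n) → Prop := fun l ω =>
    n < loss (I : Set (Fin n)) (levels G π (extend ω) (startOf G k I ω) l)
      (levels G π (extend ω) (startOf G k I ω) (l + 1)) * M
  have hA : (Finset.univ.filter A).card * 4 ≤ n ^ draws k t :=
    card_many_heavy I hd0 hq0 rfl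
  have hB : ∀ l < k, (Finset.univ.filter fun ω => B l ω ∧ ¬ A ω).card * (4 * (k + 1)) ≤
      n ^ draws k t := by
    intro l hl
    -- The choice in level `l` is independent of the sample and of the choices in previous levels.
    refine card_mul_le_of_lines (n := n) (fun ω => B l ω ∧ ¬ A ω)
      (⟨l, hl.trans_le hkT⟩ : Fin (draws k t)) fun ω => ?_
    have e1 : ∀ r, startOf G k I (Function.update ω ⟨l, hl.trans_le hkT⟩ r) = startOf G k I ω :=
      fun r => startOf_update ω hl r
    by_cases hAω : A ω
    · rw [Finset.filter_eq_empty_iff.2]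
      · simp
      · rintro r - ⟨-, h⟩
        exact h (by simp only [A, e1]; exact hAω)
    set f := levels G π (extend ω) (startOf G k I ω) l with hf
    have e2 : ∀ r, levels G π (extend (Function.update ω ⟨l, hl.trans_le hkT⟩ r))
        (startOf G k I ω) l = f := by
      intro r
      refine levels_congr _ fun i hi => ?_
      simp only [extend]
      rw [dif_pos (by omega), dif_pos (by omega), Function.update_of_ne]
      exact fun h => by simp only [Fin.mk.injEq] at h; omega
    have e3 : ∀ r : Fin n, B l (Function.update ω ⟨l, hl.trans_le hkT⟩ r) ↔
        n < loss (I : Set (Fin n)) f (levelMap G π f r) * M := by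
      intro r
      simp only [B, levels, e1, e2]
      have : extend (Function.update ω ⟨l, hl.trans_le hkT⟩ r) l = r := by
        simp [extend, hl.trans_le hkT]
      rw [this]
    have hcard := card_bad_level (G := G) (π := π) (I := (I : Set (Fin n))) (f := f) (q := q)
      (d := d) (K := k + 1) (M := M) hI hmax rfl rfl rfl
      (show q = 2 * (2 * (2 * (4 * M))) * M by rw [hq, heavyFactor]; ring) rfl rfl
      (le_of_eq (by rw [hd, rareFactor])) hM0 (by
        refine (Nat.mul_le_mul_right _ (Finset.card_le_card fun u hu => ?_)).trans (not_lt.1 hAω)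
        simp only [heavy, Finset.mem_filter, Finset.mem_univ, true_and, Set.mem_ofPred_eq] at hu ⊢
        exact ⟨levels_subset (n := n) (π := π) rfl hr rfl _ _ l hu.1, hu.2⟩)
    refine le_trans (Nat.mul_le_mul_right _ ?_) hcard
    refine Finset.card_le_card_of_injOn Fin.val (fun r hr => ?_) Fin.val_injective.injOn
    simp only [Finset.coe_filter, Finset.mem_univ, true_and, Set.mem_ofPred_eq,
      Finset.mem_range] at hr ⊢
    exact ⟨r.2, (e3 r).1 hr.1⟩
  -- If no bad event occurs, the mask that selects the sampled vertices in `I` is good.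
  have hcover : (Finset.univ : Finset (Fin (draws k t) → Fin n)) ⊆ good ∪ (Finset.univ.filter A ∪
      (Finset.range k).biUnion fun l => Finset.univ.filter fun ω => B l ω ∧ ¬ A ω) := by
    intro ω _
    by_contra h
    simp only [Finset.mem_union, Finset.mem_filter, Finset.mem_univ, true_and, Finset.mem_biUnion,
      Finset.mem_range, not_or, not_exists, not_and, not_not] at h
    obtain ⟨h1, h2, h3⟩ := h
    refine h1 (hgood ω (main_good (R := fun i => extend ω i) (ρ := extend ω) (m := maskOf k I ω)
      (f := startOf G k I ω) ht hG (fun _ _ => rfl) hI (Nat.ofBits_lt_two_pow _) rfl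
      (fun u hu => ?_) fun l hl => ?_))
    · exact startOf_ne_zero.2 fun i _ hi hadj => hI hu hi hadj.ne hadj
    · by_contra h4
      exact h2 (h3 l hl (not_le.1 h4))
  have h1 := (Finset.card_le_card hcover).trans (Finset.card_union_le _ _)
  have h2 := Finset.card_union_le (Finset.univ.filter A)
    ((Finset.range k).biUnion fun l => Finset.univ.filter fun ω => B l ω ∧ ¬ A ω)
  have h3 : ((Finset.range k).biUnion fun l => Finset.univ.filter fun ω => B l ω ∧ ¬ A ω).card * 4 ≤
      n ^ draws k t := by
    refine Nat.le_of_mul_le_mul_left (c := k + 1) ?_ (Nat.succ_pos k)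
    calc (k + 1) * (((Finset.range k).biUnion fun l =>
          Finset.univ.filter fun ω => B l ω ∧ ¬ A ω).card * 4) ≤ (∑ l ∈ Finset.range k,
          (Finset.univ.filter fun ω => B l ω ∧ ¬ A ω).card) * (4 * (k + 1)) := by
          rw [mul_comm, mul_assoc]
          exact Nat.mul_le_mul_right _ Finset.card_biUnion_le
      _ ≤ k * n ^ draws k t := by
          rw [Finset.sum_mul]
          refine (Finset.sum_le_card_nsmul _ _ _ fun l hl => hB l (Finset.mem_range.1 hl)).trans ?_
          simp
      _ ≤ (k + 1) * n ^ draws k t := Nat.mul_le_mul_right _ (Nat.le_succ k)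
  simp only [Finset.card_univ, Fintype.card_pi, Fintype.card_fin, Finset.prod_const] at h1
  omega

end

/-! ### The running time -/

/-- The degree of the polynomial that bounds the running time of an expression. -/
def AExpr.deg : AExpr → ℕ
  | .c _ | .p _ | .v _ | .val _ | .get _ _ | .adj _ _ => 0
  | .succ e => e.deg
  | .bin _ e f => max e.deg f.deg
  | .ite e f g => max e.deg (max f.deg g.deg)
  | .cnt _ e => e.deg + 1

/-- The degree of the polynomial that bounds the running time of a program, if the parameter `b` is
of order `n ^ δ b`. -/
def AProg.deg (δ : ℕ → ℕ) : AProg → ℕ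
  | .skip | .draw _ _ => 0
  | .assign _ e => e.deg
  | .par _ _ e | .pick _ e => e.deg + 1
  | .seq p q => max (p.deg δ) (q.deg δ)
  | .ite e p q => max e.deg (max (p.deg δ) (q.deg δ))
  | .loop _ b p => p.deg δ + δ b
  | .loopV _ p => p.deg δ + 1

section

variable {n : ℕ}

theorem le_mul_pow_of_le {a c d d' : ℕ} (hn : 1 ≤ n) (h : a ≤ c * n ^ d) (hd : d ≤ d') :
    a ≤ c * n ^ d' :=
  h.trans (Nat.mul_le_mul_left _ (Nat.pow_le_pow_right hn hd))

theorem le_mul_pow_of_const (hn : 1 ≤ n) (c d : ℕ) : c ≤ c * n ^ d :=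
  Nat.le_mul_of_pos_right _ (Nat.pow_pos hn)

/-- The coefficient is the cost for `n = 1`, because every factor `n` is at least `1`. -/
theorem AExpr.cost_le (hn : 1 ≤ n) (e : AExpr) : e.cost n ≤ e.cost 1 * n ^ e.deg := by
  induction e with
  | c | p | v | val | get | adj => simp [cost, deg]
  | succ e ih =>
    have := le_mul_pow_of_const hn 5 e.deg
    simp only [cost, deg, add_mul]; omega
  | bin o e f ihe ihf =>
    have h1 := le_mul_pow_of_le hn ihe (le_max_left e.deg f.deg)
    have h2 := le_mul_pow_of_le hn ihf (le_max_right e.deg f.deg)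
    have := le_mul_pow_of_const hn 5 (max e.deg f.deg)
    simp only [cost, deg, add_mul]; omega
  | ite e f g ihe ihf ihg =>
    have h1 := le_mul_pow_of_le hn ihe (le_max_left e.deg (max f.deg g.deg))
    have h2 := le_mul_pow_of_le hn ihf (show f.deg ≤ max e.deg (max f.deg g.deg) by omega)
    have h3 := le_mul_pow_of_le hn ihg (show g.deg ≤ max e.deg (max f.deg g.deg) by omega)
    have := le_mul_pow_of_const hn 5 (max e.deg (max f.deg g.deg))
    simp only [cost, deg, add_mul]; omega
  | cnt x e ih =>
    have h1 := le_mul_pow_of_const hn 20 e.deg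
    have h2 := le_mul_pow_of_const hn 20 (e.deg + 1)
    have h3 : n * (e.cost n + 20) ≤ n * ((e.cost 1 + 20) * n ^ e.deg) :=
      Nat.mul_le_mul_left _ (by rw [add_mul]; omega)
    have h4 : n * ((e.cost 1 + 20) * n ^ e.deg) = (e.cost 1 + 20) * n ^ (e.deg + 1) := by ring
    simp only [cost, deg, one_mul]; rw [add_mul (e.cost 1 + 20)]; omega

theorem AProg.cost_le (hn : 1 ≤ n) {π π' δ : ℕ → ℕ} (hπ : ∀ b, π b ≤ π' b * n ^ δ b) (p : AProg) :
    p.cost n π ≤ p.cost 1 π' * n ^ p.deg δ := by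
  induction p with
  | skip | draw => simp [cost, deg]
  | assign x e =>
    have := le_mul_pow_of_const hn 5 e.deg
    have := e.cost_le hn
    simp only [cost, deg, add_mul]; omega
  | par j x e =>
    have h0 := e.cost_le hn
    have h1 := le_mul_pow_of_const hn 60 e.deg
    have h2 := le_mul_pow_of_const hn 60 (e.deg + 1)
    have h3 : n * (e.cost n + 60) ≤ n * ((e.cost 1 + 60) * n ^ e.deg) :=
      Nat.mul_le_mul_left _ (by rw [add_mul]; omega)
    have h4 : n * ((e.cost 1 + 60) * n ^ e.deg) = (e.cost 1 + 60) * n ^ (e.deg + 1) := by ring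
    simp only [cost, deg, one_mul]; rw [add_mul (e.cost 1 + 60)]; omega
  | pick x e =>
    have h0 := e.cost_le hn
    have h1 := le_mul_pow_of_const hn 20 e.deg
    have h2 := le_mul_pow_of_const hn 20 (e.deg + 1)
    have h3 : n * (e.cost n + 20) ≤ n * ((e.cost 1 + 20) * n ^ e.deg) :=
      Nat.mul_le_mul_left _ (by rw [add_mul]; omega)
    have h4 : n * ((e.cost 1 + 20) * n ^ e.deg) = (e.cost 1 + 20) * n ^ (e.deg + 1) := by ring
    simp only [cost, deg, one_mul]; rw [add_mul (e.cost 1 + 20)]; omega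
  | seq p q ihp ihq =>
    have h1 := le_mul_pow_of_le hn ihp (le_max_left (p.deg δ) (q.deg δ))
    have h2 := le_mul_pow_of_le hn ihq (le_max_right (p.deg δ) (q.deg δ))
    simp only [cost, deg, add_mul]; omega
  | ite e p q ihp ihq =>
    have h1 := le_mul_pow_of_le hn (e.cost_le hn) (le_max_left e.deg (max (p.deg δ) (q.deg δ)))
    have h2 := le_mul_pow_of_le hn ihp
      (show p.deg δ ≤ max e.deg (max (p.deg δ) (q.deg δ)) by omega)
    have h3 := le_mul_pow_of_le hn ihq
      (show q.deg δ ≤ max e.deg (max (p.deg δ) (q.deg δ)) by omega)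
    have := le_mul_pow_of_const hn 5 (max e.deg (max (p.deg δ) (q.deg δ)))
    simp only [cost, deg, add_mul]; omega
  | loop x b p ih =>
    have h1 := le_mul_pow_of_const hn 20 (p.deg δ)
    have h2 := le_mul_pow_of_const hn 20 (p.deg δ + δ b)
    have h3 : π b * (p.cost n π + 20) ≤ π' b * n ^ δ b * ((p.cost 1 π' + 20) * n ^ p.deg δ) :=
      Nat.mul_le_mul (hπ b) (by rw [add_mul]; omega)
    have h4 : π' b * n ^ δ b * ((p.cost 1 π' + 20) * n ^ p.deg δ) =
      π' b * (p.cost 1 π' + 20) * n ^ (p.deg δ + δ b) := by ring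
    simp only [cost, deg]; rw [add_mul (π' b * _)]; omega
  | loopV x p ih =>
    have h1 := le_mul_pow_of_const hn 20 (p.deg δ)
    have h2 := le_mul_pow_of_const hn 20 (p.deg δ + 1)
    have h3 : n * (p.cost n π + 20) ≤ n * ((p.cost 1 π' + 20) * n ^ p.deg δ) :=
      Nat.mul_le_mul_left _ (by rw [add_mul]; omega)
    have h4 : n * ((p.cost 1 π' + 20) * n ^ p.deg δ) =
      (p.cost 1 π' + 20) * n ^ (p.deg δ + 1) := by ring
    simp only [cost, deg, one_mul]; rw [add_mul (p.cost 1 π' + 20)]; omega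

/-- The order of the parameters. -/
def paramDeg : ℕ → ℕ
  | 0 => 1
  | 6 => 1
  | 7 => 1
  | 9 => 1
  | 10 => 2
  | _ => 0

theorem params_le (hn : 1 ≤ n) (k t b : ℕ) :
    params n k t b ≤ (params 1 k t b + 2) * n ^ paramDeg b := by
  unfold params paramDeg
  split <;> simp
  · omega
  · have := Nat.div_le_self n (heavyFactor k t)
    exact this.trans (Nat.le_mul_of_pos_left _ (Nat.succ_pos _))
  · have := Nat.div_le_self (2 * n) (4 * lossFactor k t)
    exact this.trans (Nat.mul_le_mul_right _ (Nat.le_add_left _ _))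
  · omega
  · nlinarith

/-- A level takes time `n ^ 5` and everything else time `n ^ 4`. Since there are no levels if `k =
0`, this is within `n ^ (k + 4)`. -/
theorem exists_main_cost_le (k t : ℕ) : ∃ A, ∀ n, 1 ≤ n →
    AProg.cost n (params n k t) main ≤ A * n ^ 5 ∧
    AProg.cost n (params n k t) main ≤ A * n ^ (k + 4) := by
  let π' := fun b => params 1 k t b + 2
  let a := sample.cost 1 π'
  let b := level.cost 1 π'
  let c := finish.cost 1 π'
  refine ⟨200 + 2 ^ draws k t * (a + k * (b + 40) + c + 40), fun n hn => ?_⟩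
  have ha : sample.cost n (params n k t) ≤ a * n ^ 1 :=
    AProg.cost_le hn (params_le hn k t) sample
  have hb : level.cost n (params n k t) ≤ b * n ^ 5 :=
    AProg.cost_le hn (params_le hn k t) level
  have hc : finish.cost n (params n k t) ≤ c * n ^ 4 :=
    AProg.cost_le hn (params_le hn k t) finish
  have hcost : AProg.cost n (params n k t) main = n * 62 + 60 + (2 + 5 + 2 ^ draws k t *
      (sample.cost n (params n k t) + (k * (20 + level.cost n (params n k t) + 20) + 20 +
        finish.cost n (params n k t)) + 20) + 20) := by
    simp only [main, AProg.cost, AExpr.cost]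
    rfl
  have main_le : ∀ e, 4 ≤ e → (k = 0 ∨ 5 ≤ e) → AProg.cost n (params n k t) main ≤
      (200 + 2 ^ draws k t * (a + k * (b + 40) + c + 40)) * n ^ e := by
    intro e he hke
    have h1 := le_mul_pow_of_le hn ha (show 1 ≤ e by omega)
    have h2 := le_mul_pow_of_le hn hc he
    have h3 : k * (20 + level.cost n (params n k t) + 20) ≤ k * (b + 40) * n ^ e := by
      rcases hke with rfl | hke
      · simp
      · have := le_mul_pow_of_le hn hb hke
        have h4 := le_mul_pow_of_const hn 40 e
        rw [mul_assoc]
        refine Nat.mul_le_mul_left _ ?_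
        rw [add_mul]; omega
    have h4 := le_mul_pow_of_const hn 40 e
    have h5 := le_mul_pow_of_const hn 100 e
    have h6 : n * 62 ≤ 62 * n ^ e := by
      rw [mul_comm]; exact Nat.mul_le_mul_left _ (Nat.le_self_pow (by omega) n)
    have h7 : 2 ^ draws k t * (sample.cost n (params n k t) + (k * (20 +
        level.cost n (params n k t) + 20) + 20 + finish.cost n (params n k t)) + 20) ≤
        2 ^ draws k t * ((a + k * (b + 40) + c + 40) * n ^ e) := by
      refine Nat.mul_le_mul_left _ ?_
      simp only [add_mul] at *; omega
    rw [hcost, add_mul, mul_assoc (2 ^ draws k t)]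
    omega
  refine ⟨main_le 5 (by omega) (Or.inr le_rfl), main_le (k + 4) (by omega) (by omega)⟩

end

/-! ### Random computations of the machine -/

section

variable {n w : ℕ} {s : State}

/-- The program `p`, started in `s`, stops within `B` time units; the result depends on a uniformly
random element `ω` of `Ω`, and the final state satisfies `Q ω`. -/
def RandEnds (Ω : Type) [Fintype Ω] [Nonempty Ω] (w : ℕ) (p : Cmd) (s : State) (B : ℕ)
    (Q : Ω → State → Prop) : Prop :=
  ∃ (F : Ω → State) (k : Ω → ℕ), (∀ ω, k ω ≤ B ∧ Q ω (F ω)) ∧ ∀ fuel, B ≤ fuel →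
    p.exec w fuel s = (PMF.uniformOfFintype Ω).map fun ω => some (F ω, k ω)

theorem andThen_map {α : Type} (p : PMF α) (F : α → State) (k : α → ℕ) (g : State → PMF Outcome) :
    andThen (p.map fun a => some (F a, k a)) g =
      p.bind fun a => (g (F a)).map (Option.map fun r => (r.1, k a + r.2)) := by
  rw [andThen, PMF.bind_map]; rfl

variable {Ω : Type} [Fintype Ω] [Nonempty Ω] {p q : Cmd} {B B₁ B₂ : ℕ} {Q R : Ω → State → Prop}

theorem Ends.randEnds {Q : State → Prop} (h : Ends w p s B Q) :
    RandEnds Ω w p s B fun _ => Q := by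
  obtain ⟨s', k, h1, h2, h3⟩ := h
  refine ⟨fun _ => s', fun _ => k, fun _ => ⟨h2, h3⟩, fun fuel hf => ?_⟩
  rw [h1 fuel (by omega)]
  exact (PMF.map_const _ _).symm

theorem RandEnds.mono_time (h : RandEnds Ω w p s B₁ Q) (hB : B₁ ≤ B) : RandEnds Ω w p s B Q := by
  obtain ⟨F, k, h1, h2⟩ := h
  exact ⟨F, k, fun ω => ⟨(h1 ω).1.trans hB, (h1 ω).2⟩, fun fuel hf => h2 fuel (hB.trans hf)⟩

theorem Ends.seq_rand {R : State → Prop} (hp : Ends w p s B₁ R)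
    (hq : ∀ s', R s' → RandEnds Ω w q s' B₂ Q) (hB : B₁ + B₂ ≤ B) :
    RandEnds Ω w (.seq p q) s B Q := by
  obtain ⟨s₁, k₁, h1, h2, h3⟩ := hp
  obtain ⟨F, k, h4, h5⟩ := hq s₁ h3
  refine ⟨F, fun ω => k₁ + k ω, fun ω => ⟨by have := (h4 ω).1; dsimp only; omega, (h4 ω).2⟩,
    fun fuel hf => ?_⟩
  rw [Cmd.exec, h1 fuel (by omega), andThen_pure, h5 fuel (by omega), PMF.map_comp]
  rfl

theorem RandEnds.seq_ends (hp : RandEnds Ω w p s B₁ R)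
    (hq : ∀ ω s', R ω s' → Ends w q s' B₂ (Q ω)) (hB : B₁ + B₂ ≤ B) :
    RandEnds Ω w (.seq p q) s B Q := by
  obtain ⟨F, k, h1, h2⟩ := hp
  choose F' k' h3 h4 h5 using fun ω => hq ω (F ω) (h1 ω).2
  refine ⟨F', fun ω => k ω + k' ω, fun ω => ⟨?_, h5 ω⟩, fun fuel hf => ?_⟩
  · have := (h1 ω).1
    have := h4 ω
    dsimp only
    omega
  rw [Cmd.exec, h2 fuel (by omega), andThen_map, PMF.map]
  congr 1
  funext ω
  have := h4 ω
  rw [h3 ω fuel (by omega), PMF.pure_map]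
  rfl

theorem RandEnds.ite_pos {e : Expr} (he : e.eval w s ≠ 0) (hp : RandEnds Ω w p s B₁ Q)
    (hB : e.cost + 1 + B₁ ≤ B) : RandEnds Ω w (.ite e p q) s B Q := by
  obtain ⟨F, k, h1, h2⟩ := hp
  refine ⟨F, fun ω => e.cost + 1 + k ω, fun ω => ⟨by have := (h1 ω).1; dsimp only; omega, (h1 ω).2⟩,
    fun fuel hf => ?_⟩
  rw [Cmd.exec, tick, andThen_pure, if_pos he, h2 fuel (by omega), PMF.map_comp]
  rfl

/-- The success probability of an algorithm that makes its random choices uniformly in `Ω` is the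
proportion of the good elements of `Ω`. -/
theorem findsIndepSet_of_randEnds {P : Cmd} {G : SimpleGraph (Fin n)} {ps : List ℕ} {T : ℕ} {m : ℝ}
    (h : RandEnds Ω w P (input G ps) T Q)
    (hind : ∀ ω s, Q ω s → G.IsIndepSet (output n s : Set (Fin n))) (good : Finset Ω)
    (hgood : ∀ ω ∈ good, ∀ s, Q ω s → m ≤ ((output n s).card : ℝ))
    (hcard : Fintype.card Ω ≤ 2 * good.card) : FindsIndepSet P G ps w T m := by
  classical
  obtain ⟨F, k, h1, h2⟩ := h
  refine ⟨T, ?_, ?_⟩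
  · rw [h2 T le_rfl]
    intro o ho
    rw [PMF.support_map] at ho
    obtain ⟨ω, -, rfl⟩ := ho
    exact ⟨F ω, k ω, rfl, (h1 ω).1, hind ω _ (h1 ω).2⟩
  · rw [h2 T le_rfl, PMF.toOuterMeasure_map_apply]
    refine le_trans ?_ (MeasureTheory.measure_mono (μ := (PMF.uniformOfFintype Ω).toOuterMeasure)
      (s := (good : Set Ω)) fun ω hω => ⟨F ω, k ω, rfl, hgood ω hω _ (h1 ω).2⟩)
    rw [PMF.toOuterMeasure_uniformOfFintype_apply]
    have h0 : (Fintype.card Ω : ℝ≥0∞) ≠ 0 := by simp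
    rw [ENNReal.div_le_iff (by simp) (by simp), mul_comm, ← mul_div_assoc,
      ENNReal.le_div_iff_mul_le (Or.inl h0) (Or.inl (by simp))]
    simp only [Fintype.card_coe, Finset.coe_sort_coe, one_mul]
    exact_mod_cast hcard

/-! ### Drawing the random vertices -/

theorem uniformBelow_eq [NeZero n] :
    uniformBelow n = (PMF.uniformOfFintype (Fin n)).map Fin.val := by
  cases n with
  | zero => exact absurd rfl (NeZero.ne 0)
  | succ n => rfl

/-- Uniformly random tuples arise from independent uniformly random entries. -/
theorem uniform_cons {A : Type} [Fintype A] [Nonempty A] (m : ℕ) :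
    PMF.uniformOfFintype (Fin (m + 1) → A) = (PMF.uniformOfFintype A).bind fun a =>
      (PMF.uniformOfFintype (Fin m → A)).map (Fin.cons (α := fun _ => A) a) := by
  classical
  ext x
  rw [PMF.bind_apply, tsum_fintype, Finset.sum_eq_single (x 0)]
  · rw [PMF.map_apply, tsum_fintype, Finset.sum_eq_single (Fin.tail x)]
    · rw [if_pos (Fin.cons_self_tail x).symm]
      simp only [PMF.uniformOfFintype_apply, Fintype.card_pi, Finset.prod_const, Finset.card_univ,
        Fintype.card_fin]
      rw [← ENNReal.mul_inv (by simp) (by simp), pow_succ']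
      push_cast
      rfl
    · intro ω _ hω
      rw [if_neg]
      intro hx
      exact hω (by rw [hx, Fin.tail_cons])
    · simp
  · intro a _ ha
    rw [PMF.map_apply, tsum_fintype, Finset.sum_eq_zero, mul_zero]
    intro ω _
    rw [if_neg]
    intro hx
    exact ha (by rw [hx, Fin.cons_zero])
  · simp

/-- Fill the memory with `var 8` random vertices. -/
def drawLoop : Cmd :=
  .loop (.op .lt (.var 3) (.var 8)) <| .seq (.rand 7 (.var 0)) <|
    .seq (.store (cell 17 (.var 3)) (.var 7)) (incr 3)

/-- The effect of one draw. -/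
def drawStep (n : ℕ) (s : State) (a : Fin n) : State where
  var := Function.update (Function.update s.var 7 a) 3 (s.var 3 + 1)
  mem := Function.update s.mem ((n + 17) * n + s.var 3) a

/-- The effect of several draws. -/
def drawState (n : ℕ) : (m : ℕ) → (Fin m → Fin n) → State → State
  | 0, _, s => s
  | m + 1, ω, s => drawState n m (Fin.tail ω) (drawStep n s (ω 0))

theorem drawState_var {m : ℕ} (ω : Fin m → Fin n) (s : State) {y : ℕ} (h3 : y ≠ 3) (h7 : y ≠ 7) :
    (drawState n m ω s).var y = s.var y := by
  induction m generalizing s with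
  | zero => rfl
  | succ m ih => rw [drawState, ih]; simp [drawStep, h3, h7]

theorem drawState_mem {m : ℕ} (ω : Fin m → Fin n) (s : State) (r : ℕ) :
    (drawState n m ω s).mem ((n + 17) * n + r) =
      if h : s.var 3 ≤ r ∧ r - s.var 3 < m then ((ω ⟨r - s.var 3, h.2⟩ : Fin n) : ℕ)
      else s.mem ((n + 17) * n + r) := by
  induction m generalizing s with
  | zero => simp [drawState]
  | succ m ih =>
    have h3 : (drawStep n s (ω 0)).var 3 = s.var 3 + 1 := by simp [drawStep]
    rw [drawState, ih]
    simp only [h3]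
    by_cases hr : r = s.var 3
    · subst hr; simp [drawStep]
    · have : (drawStep n s (ω 0)).mem ((n + 17) * n + r) = s.mem ((n + 17) * n + r) := by
        simp [drawStep, hr]
      rw [this]
      by_cases h : s.var 3 ≤ r ∧ r - s.var 3 < m + 1
      · rw [dif_pos h, dif_pos (by omega), Fin.tail]
        congr 2
        ext
        simp; omega
      · rw [dif_neg h, dif_neg (by omega)]

theorem drawState_mem_lt {m : ℕ} (ω : Fin m → Fin n) (s : State) {y : ℕ}
    (hy : y < (n + 17) * n) : (drawState n m ω s).mem y = s.mem y := by
  induction m generalizing s with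
  | zero => rfl
  | succ m ih =>
    rw [drawState, ih]
    have : y ≠ (n + 17) * n + s.var 3 := by omega
    simp [drawStep, this]

theorem drawLoop_randEnds [NeZero n] {m : ℕ} (h0 : s.var 0 = n) (h3 : s.var 3 = 0)
    (h8 : s.var 8 = m) (hw : (n + 17) * n + m < 2 ^ w) :
    RandEnds (Fin m → Fin n) w drawLoop s (m * 19 + 4) fun ω s' => s' = drawState n m ω s := by
  have hn : 1 ≤ n := Nat.one_le_iff_ne_zero.2 (NeZero.ne n)
  refine ⟨fun ω => drawState n m ω s, fun _ => m * 19 + 4, fun ω => ⟨le_rfl, rfl⟩, fun fuel hf => ?_⟩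
  have hbody : ∀ s : State, s.var 0 = n → s.var 3 < m →
      (Cmd.seq (.rand 7 (.var 0)) (.seq (.store (cell 17 (.var 3)) (.var 7)) (incr 3))).exec
        w fuel s = (PMF.uniformOfFintype (Fin n)).map fun a : Fin n => some (drawStep n s a, 15) := by
    intro s h0 h3
    have hrand : (Cmd.rand 7 (.var 0)).exec w fuel s = (PMF.uniformOfFintype (Fin n)).map
        fun a : Fin n => some (({ s with var := Function.update s.var 7 (a : ℕ) } : State), 2) := by
      rw [Cmd.exec, Expr.eval, h0, uniformBelow_eq, PMF.bind_map]
      rfl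
    rw [Cmd.exec, hrand, andThen_map, PMF.map]
    congr 1
    funext a
    have hcell : (cell 17 (.var 3)).eval w
        ({ s with var := Function.update s.var 7 (a : ℕ) } : State) = (n + 17) * n + s.var 3 := by
      rw [eval_cell (n := n) (by simpa using h0) hn le_rfl] <;> simp [Expr.eval]
      omega
    have hstep : (Cmd.seq (.store (cell 17 (.var 3)) (.var 7)) (incr 3)).exec w fuel
        ({ s with var := Function.update s.var 7 (a : ℕ) } : State) =
        PMF.pure (some (drawStep n s a, 13)) := by
      have h1 : (1 : ℕ) < 2 ^ w := by nlinarith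
      refine (andThen_pure_pure rfl).trans (congrArg (fun s' => PMF.pure (some (s', 13))) ?_)
      rw [hcell]
      simp only [drawStep, Expr.eval, Op.eval, Function.update_self, State.mk.injEq, and_true]
      rw [Function.update_of_ne (by decide), Nat.mod_eq_of_lt h1, Nat.mod_eq_of_lt (by omega)]
    rw [hstep, PMF.pure_map]
    rfl
  suffices H : ∀ m' s f', s.var 0 = n → s.var 8 = m → s.var 3 + m' = m → m' * 19 + 4 ≤ f' →
      iterate w (.op .lt (.var 3) (.var 8)) ((Cmd.seq (.rand 7 (.var 0))
        (.seq (.store (cell 17 (.var 3)) (.var 7)) (incr 3))).exec w fuel) f' s =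
      (PMF.uniformOfFintype (Fin m' → Fin n)).map fun ω =>
        some (drawState n m' ω s, m' * 19 + 4) from H m s fuel h0 h8 (by omega) hf
  intro m'
  induction m' with
  | zero =>
    intro s f' _ h8 h3 hf
    obtain ⟨f', rfl⟩ : ∃ g, f' = g + 1 := ⟨f' - 1, by omega⟩
    rw [iterate, tick, andThen_pure, if_neg (not_not.2 (lt_eval_eq_zero.2 (by omega))), tick,
      PMF.pure_map]
    exact (PMF.map_const _ _).symm
  | succ m' ih =>
    intro s f' h0 h8 h3 hf
    obtain ⟨f', rfl⟩ : ∃ g, f' = g + 1 := ⟨f' - 1, by omega⟩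
    rw [iterate, tick, andThen_pure, if_pos (lt_eval_ne_zero.2 (by omega)),
      hbody s h0 (by omega), andThen_map, uniform_cons, PMF.map_bind, PMF.map_bind]
    congr 1
    funext a
    rw [ih _ f' (by simp [drawStep, h0]) (by simp [drawStep, h8]) (by simp [drawStep]; omega)
      (by omega), PMF.map_comp, PMF.map_comp, PMF.map_comp]
    congr 1
    funext ω
    simp only [Function.comp_apply, Option.map_some, drawState, Fin.tail_cons, Fin.cons_zero,
      Expr.cost]
    congr 2
    omega

end

/-! ### Computing the parameters on the machine -/

/-- The operations on natural numbers, without overflow. -/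
def Op.ideal : Op → ℕ → ℕ → ℕ
  | .add, a, b => a + b
  | .sub, a, b => a - b
  | .mul, a, b => a * b
  | .div, a, b => a / b
  | .mod, a, b => a % b
  | .lt, a, b => if a < b then 1 else 0
  | .eq, a, b => if a = b then 1 else 0

/-- The value of an expression, without overflow. -/
def Expr.ideal (s : State) : Expr → ℕ
  | .const c => c
  | .var x => s.var x
  | .load e => s.mem (e.ideal s)
  | .op o e₁ e₂ => o.ideal (e₁.ideal s) (e₂.ideal s)

/-- No overflow occurs in the evaluation of the expression. -/
def Expr.Fits (w : ℕ) (s : State) : Expr → Prop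
  | .const c => c < 2 ^ w
  | .var _ => True
  | .load e => e.Fits w s
  | .op o e₁ e₂ => e₁.Fits w s ∧ e₂.Fits w s ∧ o.ideal (e₁.ideal s) (e₂.ideal s) < 2 ^ w

section

variable {n k t w : ℕ} {s : State}

theorem Expr.eval_eq_ideal {e : Expr} (h : e.Fits w s) : e.eval w s = e.ideal s := by
  induction e with
  | const c => exact Nat.mod_eq_of_lt h
  | var x => rfl
  | load e ih => rw [eval, ideal, ih h]
  | op o e₁ e₂ ih₁ ih₂ =>
    obtain ⟨h1, h2, h3⟩ := h
    rw [eval, ideal, ih₁ h1, ih₂ h2]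
    cases o <;> first | rfl | exact Nat.mod_eq_of_lt h3

theorem Ends.assign_seq {x : ℕ} {e : Expr} {q : Cmd} {B B' : ℕ} {Q : State → Prop}
    (hf : e.Fits w s)
    (hq : Ends w q { s with var := Function.update s.var x (e.ideal s) } B Q)
    (hB : e.cost + 1 + B ≤ B') : Ends w (.seq (.assign x e) q) s B' Q := by
  refine Ends.seq (B₁ := e.cost + 1) (R := fun s' =>
    s' = { s with var := Function.update s.var x (e.ideal s) }) (Ends.assign le_rfl ?_) ?_ hB
  · rw [Expr.eval_eq_ideal hf]
  · rintro s' rfl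
    exact hq

/-- Compute the power of `2` with exponent `var 8`. -/
def powLoop : Cmd :=
  .loop (.op .lt (.var 11) (.var 8)) <| .seq (.assign 12 (.op .mul (.const 2) (.var 12))) (incr 11)

theorem powLoop_ends {T : ℕ} (h8 : s.var 8 = T) (h11 : s.var 11 = 0) (h12 : s.var 12 = 1)
    (hw : 2 ^ T + 2 < 2 ^ w) : Ends w powLoop s (T * 20 + 20) fun s' => s'.mem = s.mem ∧
      s'.var 12 = 2 ^ T ∧ ∀ y, y ≠ 11 → y ≠ 12 → s'.var y = s.var y := by
  let I : ℕ → State → Prop := fun i s' => s'.mem = s.mem ∧ s'.var 11 = i ∧ s'.var 12 = 2 ^ i ∧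
    ∀ y, y ≠ 11 → y ≠ 12 → s'.var y = s.var y
  refine Ends.mono (Ends.loop (b := 8) T I ?_ ?_ (B := T * 20 + 20) ?_ ?_) le_rfl
    fun s' h => ⟨h.1, h.2.2⟩
  · rintro i hi s' ⟨h1, h2, h3, h4⟩
    have hpow : 2 ^ (i + 1) ≤ 2 ^ T := Nat.pow_le_pow_right (by omega) hi
    have hlt : T < 2 ^ T := Nat.lt_two_pow_self
    refine ⟨lt_eval_ne_zero.2 (by rw [h2, h4 8 (by omega) (by omega), h8]; exact hi), ?_⟩
    refine Ends.assign_seq (B := 4) ?_ (Ends.incr le_rfl ?_ ?_) (by simp [Expr.cost])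
    · simp only [Expr.Fits, Expr.ideal, Op.ideal, h3, true_and]
      rw [pow_succ] at hpow
      omega
    · simp [h2]; omega
    · refine ⟨h1, ?_, ?_, fun y hy hy' => ?_⟩
      · simp [h2]
      · simp [Expr.ideal, Op.ideal, h3, pow_succ']
      · simp [hy, hy', h4 y hy hy']
  · rintro s' ⟨h1, h2, h3, h4⟩
    exact lt_eval_eq_zero.2 (by rw [h2, h4 8 (by omega) (by omega), h8]; exact lt_irrefl _)
  · simp [Expr.cost]; omega
  · exact ⟨rfl, h11, by simpa using h12, fun _ _ _ => rfl⟩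

/-- A sequence of assignments followed by the program `q`. -/
def assigns (q : Cmd) : List (ℕ × Expr) → Cmd
  | [] => q
  | (x, e) :: l => .seq (.assign x e) (assigns q l)

/-- The variables after a sequence of assignments. -/
def afterAssigns : List (ℕ × Expr) → State → State
  | [], s => s
  | (x, e) :: l, s => afterAssigns l { s with var := Function.update s.var x (e.ideal s) }

/-- No overflow occurs in the assignments. -/
def AllFit (w : ℕ) : List (ℕ × Expr) → State → Prop
  | [], _ => True
  | (x, e) :: l, s => e.Fits w s ∧ AllFit w l { s with var := Function.update s.var x (e.ideal s) }

theorem Ends.assigns {l : List (ℕ × Expr)} {q : Cmd} {B B' : ℕ} {Q : State → Prop}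
    (hf : AllFit w l s) (hq : Ends w q (afterAssigns l s) B Q)
    (hB : (l.map fun a => a.2.cost + 1).sum + B ≤ B') : Ends w (assigns q l) s B' Q := by
  induction l generalizing s B' with
  | nil => exact hq.mono (by simpa using hB) fun _ h => h
  | cons a l ih =>
    rw [List.map_cons, List.sum_cons] at hB
    exact Ends.assign_seq hf.1 (ih hf.2 hq le_rfl) (by omega)

/-- Assignments that compute the parameters from `n`, `k`, `t` in the variables `0`, `1`, `2`,
except for the power of `2`. The variables `3` and `7` hold intermediate results. -/
def paramAssigns : List (ℕ × Expr) :=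
  [(3, .op .mul (.op .add (.var 1) (.const 1)) (.var 2)),
    (7, .op .mul (.op .mul (.const 32) (.var 3)) (.var 3)),
    (4, .var 1),
    (8, .op .add (.var 1) (.op .mul (.op .mul (.const 4) (.op .mul
      (.op .mul (.const 4) (.op .add (.var 1) (.const 1))) (.var 7))) (.var 7))),
    (16, .op .mul (.const 4) (.var 3)),
    (20, .op .mul (.const 2) (.op .mul (.const 4) (.var 3))),
    (24, .op .div (.var 0) (.var 7)),
    (28, .op .div (.op .mul (.const 2) (.var 0)) (.var 16)),
    (36, .op .add (.var 0) (.const 1)),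
    (40, .op .mul (.var 0) (.op .add (.var 0) (.const 1))),
    (1, .const 0), (2, .const 0), (12, .const 1), (11, .const 0)]

/-- Compute the parameters from `n`, `k`, `t` in the variables `0`, `1`, `2`. -/
def preamble : Cmd := assigns (.seq powLoop (.assign 3 (.const 0))) paramAssigns

/-- A bound for all numbers that occur in the preamble. -/
def wordBound (n k t : ℕ) : ℕ :=
  100 + (k + 1) + 4 * (k + 1) + lossFactor k t + 32 * lossFactor k t + heavyFactor k t +
    rareFactor k t + 4 * rareFactor k t + draws k t + 2 ^ draws k t + 2 * (4 * lossFactor k t) +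
    3 * n + n * (n + 1)

theorem preamble_ends (h0 : s.var 0 = n) (h1 : s.var 1 = k) (h2 : s.var 2 = t)
    (h4 : ∀ x, 4 ≤ x → s.var x = 0) (hw : wordBound n k t < 2 ^ w) :
    Ends w preamble s (draws k t * 20 + 400) fun s' => s'.mem = s.mem ∧
      (∀ b, s'.var (4 * b) = params n k t b) ∧ (∀ x, s'.var (4 * x + 1) = 0) ∧
      (∀ x, s'.var (4 * x + 2) = 0) ∧ s'.var 3 = 0 := by
  obtain ⟨f, mem⟩ := s
  dsimp only at h0 h1 h2 h4
  have hpow := Nat.one_le_two_pow (n := draws k t)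
  have hq := Nat.div_le_self n (heavyFactor k t)
  have hr := Nat.div_le_self (2 * n) (4 * lossFactor k t)
  have hvar : ∀ y, (afterAssigns paramAssigns ⟨f, mem⟩).var y =
      if y = 11 then 0 else if y = 12 then 1 else if y = 2 then 0 else if y = 1 then 0 else
      if y = 40 then n * (n + 1) else if y = 36 then n + 1 else
      if y = 28 then 2 * n / (4 * lossFactor k t) else if y = 24 then n / heavyFactor k t else
      if y = 20 then 2 * (4 * lossFactor k t) else if y = 16 then 4 * lossFactor k t else
      if y = 8 then draws k t else if y = 4 then k else
      if y = 7 then heavyFactor k t else if y = 3 then lossFactor k t else f y := by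
    intro y
    simp [paramAssigns, afterAssigns, Expr.ideal, Op.ideal, Function.update_apply, h0, h1, h2,
      lossFactor, heavyFactor, rareFactor, draws]
  refine Ends.assigns (B := draws k t * 20 + 22) ?_ ?_ ?_
  · simp only [wordBound, draws, rareFactor, heavyFactor, lossFactor] at hw hpow hq hr
    simp only [paramAssigns, AllFit, Expr.Fits, Expr.ideal, Op.ideal, Function.update_apply, h0, h1,
      h2, reduceIte, true_and, and_true, Nat.reduceEqDiff, OfNat.zero_ne_ofNat, OfNat.one_ne_ofNat]
    omega
  · refine Ends.seq (B₁ := draws k t * 20 + 20) (B₂ := 2)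
      (powLoop_ends (T := draws k t) (by simp [hvar]) (by simp [hvar]) (by simp [hvar])
      (by unfold wordBound at hw; omega)) ?_ le_rfl
    rintro s' ⟨e1, e2, e3⟩
    refine Ends.assign (by simp [Expr.cost]) ⟨e1, fun b => ?_, fun x => ?_, fun x => ?_, ?_⟩
    · dsimp only
      rw [Function.update_of_ne (by omega)]
      by_cases hb : b < 11
      · interval_cases b
        all_goals first
          | exact e2
          | (rw [e3 _ (by decide) (by decide), hvar]; simp [params, h0, h4])
      · rw [e3 _ (by omega) (by omega), hvar]
        have : params n k t b = 0 := by
          unfold params; split <;> omega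
        rw [this]
        repeat rw [if_neg (by omega)]
        exact h4 _ (by omega)
    · dsimp only
      rw [Function.update_of_ne (by omega), e3 _ (by omega) (by omega), hvar]
      by_cases hx : x = 0
      · simp [hx]
      · repeat rw [if_neg (by omega)]
        exact h4 _ (by omega)
    · dsimp only
      rw [Function.update_of_ne (by omega), e3 _ (by omega) (by omega), hvar]
      by_cases hx : x = 0
      · simp [hx]
      · repeat rw [if_neg (by omega)]
        exact h4 _ (by omega)
    · simp [Expr.eval]
  · simp [paramAssigns, Expr.cost]
    omega

/-- The input to the algorithm in the machine, with the parameters `k` and `t`. -/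
structure IsInput (G : SimpleGraph (Fin n)) (k t : ℕ) (s : State) : Prop where
  v0 : s.var 0 = n
  v1 : s.var 1 = k
  v2 : s.var 2 = t
  v4 : ∀ x, 4 ≤ x → s.var x = 0
  mem : s.mem = (input G []).mem

/-- The whole algorithm. For `n = 0`, when there are no vertices to draw, it does nothing. -/
def algorithm : Cmd := .ite (.var 0) (.seq preamble (.seq drawLoop (main.comp 0))) .skip

theorem input_adj {G : SimpleGraph (Fin n)} (u v : Fin n) [Decidable (G.Adj u v)] :
    (input G []).mem (u * n + v) = if G.Adj u v then 1 else 0 := by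
  have h : (∃ u' v' : Fin n, (u : ℕ) * n + v = u' * n + v' ∧ G.Adj u' v') ↔ G.Adj u v := by
    refine ⟨fun ⟨u', v', h, hadj⟩ => ?_, fun h => ⟨u, v, rfl, h⟩⟩
    have hn : 0 < n := u.pos
    have h1 : (u : ℕ) = u' := by
      have := congrArg (· / n) h
      simpa [Nat.add_div_of_dvd_right, Nat.mul_div_cancel _ hn, Nat.div_eq_of_lt] using this
    have h2 : (v : ℕ) = v' := by rw [h1] at h; omega
    rwa [Fin.ext h1, Fin.ext h2]
  simp only [input, h]

theorem input_zero {G : SimpleGraph (Fin n)} {y : ℕ} (hy : n * n ≤ y) : (input G []).mem y = 0 := by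
  simp only [input]
  rw [if_neg]
  rintro ⟨u, v, rfl, -⟩
  have := u.2
  have := v.2
  nlinarith

/-- The machine computes the result of the array program `main`, for uniformly random vertices. -/
theorem algorithm_randEnds [NeZero n] {G : SimpleGraph (Fin n)} (hs : IsInput G k t s)
    (hw : (n + 17) * n + (wordBound n k t + main.cost n (params n k t)) < 2 ^ w) :
    RandEnds (Fin (draws k t) → Fin n) w algorithm s
      (draws k t * 39 + 410 + main.cost n (params n k t)) fun ω s' =>
        Rep G (params n k t) (fun i => extend ω i)
          (main.run G (params n k t) (fun i => extend ω i)
            ⟨fun _ => 0, fun _ => 0, fun _ _ => 0⟩) s' := by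
  have hn : 1 ≤ n := Nat.one_le_iff_ne_zero.2 (NeZero.ne n)
  refine RandEnds.ite_pos (by rw [Expr.eval, hs.v0]; omega) (B₁ := draws k t * 39 + 404 +
    main.cost n (params n k t)) ?_ (by simp [Expr.cost]; omega)
  refine Ends.seq_rand (preamble_ends hs.v0 hs.v1 hs.v2 hs.v4 (by omega)) ?_
    (B₂ := draws k t * 19 + 4 + main.cost n (params n k t)) (by omega)
  rintro s₁ ⟨e1, e2, e3, e4, e5⟩
  have hpow := Nat.one_le_two_pow (n := draws k t)
  have hT : draws k t ≤ wordBound n k t := by unfold wordBound; omega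
  refine RandEnds.seq_ends (drawLoop_randEnds (n := n) (m := draws k t) (e2 0) e5 (e2 2) (by omega)) ?_
    le_rfl
  rintro ω s₂ rfl
  have hrep : Rep G (params n k t) (fun i => extend ω i) ⟨fun _ => 0, fun _ => 0, fun _ _ => 0⟩
      (drawState n (draws k t) ω s₁) := by
    classical
    refine ⟨fun b => ?_, fun x => ?_, fun x => ?_, fun u v => ?_, fun j u => ?_, fun r => ?_⟩
    · rw [drawState_var _ _ (by omega) (by omega), e2]
    · rw [drawState_var _ _ (by omega) (by omega), e3]
    · rw [drawState_var _ _ (by omega) (by omega), e4]; simp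
    · rw [drawState_mem_lt _ _ (by have := u.2; have := v.2; nlinarith), e1, hs.mem, input_adj]
    · have := u.2
      have := j.2
      rw [drawState_mem_lt _ _ (by nlinarith), e1, hs.mem, input_zero (by nlinarith)]
    · rw [drawState_mem, e5, extend]
      by_cases hr : r < draws k t
      · rw [dif_pos ⟨Nat.zero_le _, hr⟩, dif_pos hr]; rfl
      · rw [dif_neg (by omega), dif_neg hr, e1, hs.mem, input_zero (by nlinarith)]; simp
  have hb : Bounded n (params n k t) (fun i => extend ω i) (wordBound n k t)
      ⟨fun _ => 0, fun _ => 0, fun _ _ => 0⟩ := by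
    have hn' : n ≤ wordBound n k t := by unfold wordBound; omega
    refine ⟨hn, hn', fun b => ?_, fun r => (extend ω r).2.le.trans hn', fun _ => Nat.zero_le _,
      fun _ _ => Nat.zero_le _⟩
    have := Nat.div_le_self n (heavyFactor k t)
    have := Nat.div_le_self (2 * n) (4 * lossFactor k t)
    unfold params wordBound
    split <;> omega
  exact (main.comp_ends hrep hb rfl (by omega)).mono le_rfl fun s' h => h.1

end

/-! ### Resource bounds -/

/-- Word length and running time are bounded by the stated polynomials. -/
theorem exists_bound (k t : ℕ) : ∃ C, 500 ≤ C ∧ ∀ n, 1 ≤ n →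
    (n + 17) * n + (wordBound n k t + main.cost n (params n k t)) < C * (n + 1) ^ 5 ∧
    draws k t * 39 + 420 + main.cost n (params n k t) ≤ C * n ^ (k + 4) := by
  obtain ⟨A, hA⟩ := exists_main_cost_le k t
  refine ⟨wordBound 0 k t + draws k t * 39 + 500 + A, by omega, fun n hn => ?_⟩
  obtain ⟨h1, h2⟩ := hA n hn
  constructor
  · have e1 : n ^ 5 ≤ (n + 1) ^ 5 := Nat.pow_le_pow_left (by omega) 5
    have e2 : (n + 1) ^ 2 ≤ (n + 1) ^ 5 := Nat.pow_le_pow_right (by omega) (by omega)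
    have e3 : wordBound n k t = wordBound 0 k t + 3 * n + n * (n + 1) := by
      simp [wordBound]
    have e4 : A * n ^ 5 ≤ A * (n + 1) ^ 5 := Nat.mul_le_mul_left _ e1
    have e5 : wordBound 0 k t * 1 ≤ wordBound 0 k t * (n + 1) ^ 5 :=
      Nat.mul_le_mul_left _ (Nat.one_le_pow _ _ (by omega))
    rw [e3]
    nlinarith [Nat.zero_le (draws k t * (n + 1) ^ 5)]
  · have e1 : 1 ≤ n ^ (k + 4) := Nat.one_le_pow _ _ hn
    have e2 := Nat.mul_le_mul_left (wordBound 0 k t + draws k t * 39 + 500) e1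
    rw [add_mul]
    omega

section

variable {n k t w T : ℕ} {P : Cmd} {ps : List ℕ} {m : ℝ}

theorem findsIndepSet_zero {G : SimpleGraph (Fin 0)}
    (h : Ends w P (input G ps) T fun _ => True) (hm : m ≤ 0) : FindsIndepSet P G ps w T m := by
  refine findsIndepSet_of_randEnds (Ω := Unit) h.randEnds
    (fun _ _ _ => ?_) Finset.univ (fun _ _ s _ => hm.trans (Nat.cast_nonneg _)) (by simp)
  exact fun u => u.elim0

theorem Rep.coe_output {G : SimpleGraph (Fin n)} {π R : ℕ → ℕ} {σ : Store n} {s : State}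
    (h : Rep G π R σ s) : (output n s : Set (Fin n)) = σ.set 0 := by
  ext u
  have := h.a 0 u
  simp only [Fin.val_zero, add_zero] at this
  simp [output, this, Store.set]

/-- If `P` has the effect of `algorithm`, then it finds an independent set whose size is close to
the independence number. -/
theorem findsIndepSet_of_algorithm [NeZero n] {G : SimpleGraph (Fin n)} (ht : 1 ≤ t)
    (hG : G.iocp ≤ k)
    (h : RandEnds (Fin (draws k t) → Fin n) w P (input G ps) T fun ω s' =>
      Rep G (params n k t) (fun i => extend ω i) (main.run G (params n k t) (fun i => extend ω i)
        ⟨fun _ => 0, fun _ => 0, fun _ _ => 0⟩) s')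
    (hm : ∀ x : ℕ, G.indepNum * t ≤ x * t + n → m ≤ x) : FindsIndepSet P G ps w T m := by
  classical
  have hG' := SimpleGraph.not_hasInducedOddCyclePacking_of_iocp_le hG
  have hrec := fun ω : Fin (draws k t) → Fin n =>
    (main_spec (R := fun i => extend ω i) (σ := ⟨fun _ => 0, fun _ => 0, fun _ _ => 0⟩)
      ht hG' (ρ := extend ω) fun i _ => rfl).1
  obtain ⟨I, hI, hcard⟩ := G.exists_isNIndepSet_indepNum
  have hmax : ∀ u ∉ I, ∃ v ∈ I, G.Adj u v := by
    intro u hu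
    by_contra! hcon
    have : G.IsIndepSet ((insert u I : Finset (Fin n)) : Set (Fin n)) := by
      rw [Finset.coe_insert]
      exact Set.Pairwise.insert hI fun v hv _ => ⟨hcon v hv, fun h => hcon v hv h.symm⟩
    have := this.card_le_indepNum
    rw [Finset.card_insert_of_notMem hu] at this
    omega
  refine findsIndepSet_of_randEnds h (fun ω s hs => ?_)
    (Finset.univ.filter fun ω => I.card * t ≤
      (main.run G (params n k t) (fun i => extend ω i) ⟨fun _ => 0, fun _ => 0, fun _ _ => 0⟩).v 12 *
        t + n) (fun ω hω s hs => hm _ ?_) ?_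
  · rw [hs.coe_output]
    exact (hrec ω).1
  · rw [← hcard, ← Set.ncard_coe_finset (output n s), hs.coe_output, (hrec ω).2]
    exact (Finset.mem_filter.1 hω).2
  · have := card_good ht hG' hI hmax (fun _ => ⟨fun _ => 0, fun _ => 0, fun _ _ => 0⟩)
      (Finset.univ.filter fun ω => I.card * t ≤
      (main.run G (params n k t) (fun i => extend ω i) ⟨fun _ => 0, fun _ => 0, fun _ _ => 0⟩).v 12 *
        t + n) (fun ω hω => Finset.mem_filter.2 ⟨Finset.mem_univ _, hω⟩)
    simpa using this

end

end WordRAM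

open WordRAM

theorem mainTheorem1 :
    (∃ (P : WordRAM.Cmd) (c : ℕ), ∀ k t : ℕ, 1 ≤ t → ∃ C : ℕ,
      ∀ (n : ℕ) (G : SimpleGraph (Fin n)), G.iocp ≤ k →
        ∀ w : ℕ, C * (n + 1) ^ c ≤ 2 ^ w →
          WordRAM.FindsIndepSet P G [k, t] w (C * (max n 1) ^ (k + 4))
            ((G.indepNum : ℝ) - (n : ℝ) / (t : ℝ))) ∧
    (∃ (P : WordRAM.Cmd) (c : ℕ), ∀ k b a : ℕ, 1 ≤ b → 1 ≤ a → ∃ C : ℕ,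
      ∀ (n : ℕ) (G : SimpleGraph (Fin n)), G.iocp ≤ k → (n : ℝ) / (b : ℝ) ≤ (G.indepNum : ℝ) →
        ∀ w : ℕ, C * (n + 1) ^ c ≤ 2 ^ w →
          WordRAM.FindsIndepSet P G [k, b, a] w (C * (max n 1) ^ (k + 4))
            ((1 - 1 / (a : ℝ)) * (G.indepNum : ℝ))) := by
  -- The second program calls the first algorithm with `t = b a`, since then `n / t ≤ α(G) / a`.
  have hzero : ∀ G : SimpleGraph (Fin 0), G.indepNum = 0 := by
    intro G
    obtain ⟨I, -, hI⟩ := G.exists_isNIndepSet_indepNum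
    rw [← hI, Finset.card_eq_zero]
    exact Finset.eq_empty_of_isEmpty I
  refine ⟨⟨algorithm, 5, fun k t ht => ?_⟩, ⟨.seq (.assign 2 (.op .mul (.var 2) (.var 3))) algorithm,
    5, fun k b a hb ha => ?_⟩⟩
  · obtain ⟨C, hC, hbound⟩ := exists_bound k t
    refine ⟨C, fun n G hG w hw => ?_⟩
    rcases Nat.eq_zero_or_pos n with rfl | hn
    · refine findsIndepSet_zero (Ends.ite (B' := 1) (fun h => absurd rfl h)
        (fun _ => Ends.skip le_rfl trivial) ?_) (by simp [hzero])
      simp [Expr.cost]; omega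
    · have : NeZero n := ⟨hn.ne'⟩
      obtain ⟨h1, h2⟩ := hbound n hn
      rw [max_eq_left hn]
      have hs : IsInput G k t (input G [k, t]) :=
        ⟨rfl, rfl, rfl, fun x hx => List.getD_eq_default _ _ (by simp; omega), rfl⟩
      have hrand := (algorithm_randEnds hs (h1.trans_le hw)).mono_time
        (B := C * n ^ (k + 4)) (by omega)
      refine findsIndepSet_of_algorithm ht hG hrand fun x hx => ?_
      · have ht' : (0 : ℝ) < t := by exact_mod_cast ht
        rw [sub_le_iff_le_add, ← sub_le_iff_le_add', le_div_iff₀ ht']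
        have : (G.indepNum * t : ℝ) ≤ x * t + n := by exact_mod_cast hx
        linarith
  · obtain ⟨C, hC, hbound⟩ := exists_bound k (b * a)
    refine ⟨C + b * a, fun n G hG hα w hw => ?_⟩
    rcases Nat.eq_zero_or_pos n with rfl | hn
    · refine findsIndepSet_zero (Ends.seq (B₁ := 4) (B₂ := 3) (R := fun s => s.var 0 = 0)
        (Ends.assign le_rfl rfl) (fun s hs => Ends.ite (B' := 1) (fun h => absurd hs h)
        (fun _ => Ends.skip le_rfl trivial) le_rfl) ?_) (by simp [hzero])
      simp; omega
    · have : NeZero n := ⟨hn.ne'⟩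
      obtain ⟨h1, h2⟩ := hbound n hn
      rw [max_eq_left hn]
      have hpow : 1 ≤ (n + 1) ^ 5 := Nat.one_le_pow _ _ (by omega)
      have hba := Nat.mul_le_mul_left (b * a) hpow
      rw [add_mul] at hw ⊢
      have hs : Ends w (.assign 2 (.op .mul (.var 2) (.var 3))) (input G [k, b, a]) 4
          (IsInput G k (b * a)) := by
        refine Ends.assign le_rfl ⟨rfl, rfl, ?_, fun x hx => ?_, rfl⟩
        · simp only [Function.update_self]
          exact Nat.mod_eq_of_lt (by simp [Expr.eval, input]; omega)
        · dsimp only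
          rw [Function.update_of_ne (by omega)]
          exact List.getD_eq_default _ _ (by simpa using hx)
      have hrand := Ends.seq_rand hs (fun s hs => algorithm_randEnds hs (h1.trans_le (by omega)))
        (B := C * n ^ (k + 4) + b * a * n ^ (k + 4)) (by omega)
      refine findsIndepSet_of_algorithm (Nat.mul_pos hb ha) hG hrand fun x hx => ?_
      · have hb' : (0 : ℝ) < b := by exact_mod_cast hb
        have ha' : (0 : ℝ) < a := by exact_mod_cast ha
        have h3 : (G.indepNum * (b * a) : ℝ) ≤ x * (b * a) + n := by exact_mod_cast hx
        rw [div_le_iff₀ hb'] at hα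
        have h4 : (1 - 1 / (a : ℝ)) * G.indepNum = (G.indepNum * a - G.indepNum) / a := by
          field_simp
        rw [h4, div_le_iff₀ ha']
        nlinarith
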